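/- **Setting.** Let $k$ be a field of characteristic $0$ and $H$ a finite-dimensional $k$-vector space with a non-degenerate symmetric bilinear form $(\cdot,\cdot)$, a distinguished nonzero element $\mathbf 1$ and a basis $\{\phi_\alpha\}$ containing $\mathbf 1=\phi_1$; put $g_{\alpha\beta}=(\phi_\alpha,\phi_\beta)$, $(g^{\alpha\beta})=(g_{\alpha\beta})^{-1}$. On the loop space $\mathcal H=H((z^{-1}))$ consider the symplectic form $\Omega(\mathbf f,\mathbf g)=\frac1{2\pi i}\oint(\mathbf f(-z),\mathbf g(z))\,dz$ and the polarization $\mathcal H=\mathcal H_+\oplus\mathcal H_-$, $\mathcal H_+=H[z]$, $\mathcal H_-=z^{-1}H[[z^{-1}]]$, by which $\mathcal H=T^*\mathcal H_+$. The twisted loop group $\mathcal L^{(2)}GL(H)$ consists of the $\operatorname{End}(H)$-valued formal Laurent series $M$ in $z^{-1}$ with $M^*(-z)M(z)=1$, where $^*$ is the adjoint with respect to $(\cdot,\cdot)$. **Cones.** A formal germ $\mathcal L$ at a point $\mathbf f_0\in\mathcal H$ of a submanifold modelled on $H[z]$ is given by its points over all local Artinian $k$-algebras $A$ with residue field $k$: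 these are the values of a formal map $\Phi$ from $H[z]$ to $\mathcal H$, with $\Phi(0)=\mathbf f_0$ and injective differential at $0$, at the $A$-points of $H[z]$ with nilpotent coordinates. The tangent space $T_{\mathbf f}\mathcal L$ at an $A$-point $\mathbf f$ consists of all $\mathbf v$ such that $\mathbf f+\varepsilon\mathbf v$ is an $A[\varepsilon]/(\varepsilon^2)$-point of $\mathcal L$. A germ $\mathcal L$ at $\mathbf f_0\neq0$ satisfies $(\star)$ if it is a Lagrangian cone with vertex at the origin (each $T_{\mathbf f}\mathcal L$ equals its $\Omega$-orthogonal, and $\mathcal L$ is preserved by the scalars in $1+\mathfrak m_A$), and for each $A$-point $\mathbf f$ of $\mathcal L$ the tangent space $L=T_{\mathbf f}\mathcal L$ satisfies $zL\subset L$ and is tangent to $\mathcal L$ exactly along $zL$: the $A$-points $\mathbf g$ of $\mathcal L$ with $T_{\mathbf g}\mathcal L=L$ are exactly the elements of $zL$ that reduce to $\mathbf f_0$ modulo $\mathfrak m_A$. **Generating functions.** Let $\mathcal F$ be a formal function of $\mathbf t=(t_0,t_1,\dots)$, $t_n=\sum_\alpha t_n^\alpha\phi_\alpha$, near a finitely supported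 point $\mathbf t=a$ (a formal power series in $\mathbf t-a$), and $\partial_{\alpha,n}=\partial/\partial t_n^\alpha$. The system DE+SE+TRR is $$\partial_{1,1}\mathcal F=\sum_{n,\nu}t_n^\nu\partial_{\nu,n}\mathcal F-2\mathcal F,\qquad \partial_{1,0}\mathcal F=\tfrac12(t_0,t_0)+\sum_{n,\nu}t_{n+1}^\nu\partial_{\nu,n}\mathcal F,$$ $$\partial_{\alpha,k+1}\partial_{\beta,l}\partial_{\gamma,m}\mathcal F=\sum_{\mu,\nu}\partial_{\alpha,k}\partial_{\mu,0}\mathcal F\;g^{\mu\nu}\;\partial_{\nu,0}\partial_{\beta,l}\partial_{\gamma,m}\mathcal F\qquad(\text{all }\alpha,\beta,\gamma;\ k,l,m\ge0).$$ The graph of $d\mathcal F$ is the formal germ in $\mathcal H$ formed by the points $\mathbf q(z)+\sum_{n,\alpha,\beta}\partial_{\alpha,n}\mathcal F(\mathbf t)\,g^{\alpha\beta}\phi_\beta(-z)^{-n-1}$ with $\mathbf q(z)=-\mathbf 1z+\sum_nt_nz^n$ (dilaton shift). **Corollary.** Let $M\in\mathcal L^{(2)}GL(H)$. 1. A formal germ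 $\mathcal L$ at $\mathbf f_0$ is a Lagrangian cone satisfying $(\star)$ if and only if the germ $M\mathcal L$ at $M\mathbf f_0$ is one. 2. Let $\mathcal F$, formal near $\mathbf t=a$, satisfy DE+SE+TRR, and let $\mathcal L$ be the graph of $d\mathcal F$. (a) If the tangent space of $M\mathcal L$ at its base point is complementary to $\mathcal H_-$, then there are a unique point $b$ and a unique formal function $\mathcal F'$ near $\mathbf t=b$ such that $M\mathcal L$ is the graph of $d\mathcal F'$ and $\mathcal F'$ satisfies DE+SE+TRR. (b) Whenever $M\mathcal L$ is the graph of $d\mathcal G$ for a formal function $\mathcal G$ near some point, $\mathcal G+c$ satisfies DE+SE+TRR for exactly one constant $c$. -/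

import Mathlib

open scoped LaurentSeries

universe u v w

noncomputable section

namespace Givental

/-! ### The twisted loop group

Throughout, Laurent series in `z⁻¹` are modelled by Mathlib's Laurent series in the variable
`w = z⁻¹`: the coefficient of `z ^ n` is the coefficient of `w ^ (-n)`. -/

/-- The coefficient of `z ^ n` of a Laurent series in `z⁻¹`. -/
def zcoeff {R : Type*} [Zero R] (f : R⸨X⸩) (n : ℤ) : R := f.coeff (-n)

/-- The substitution `z ↦ -z` in a Laurent series in `z⁻¹`. -/
def negZ {R : Type*} [AddCommGroup R] (f : R⸨X⸩) : R⸨X⸩ where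
  coeff n := (n.negOnePow : ℤˣ) • f.coeff n
  isPWO_support' := f.isPWO_support.mono fun n hn hf => hn (by
    change (n.negOnePow : ℤˣ) • f.coeff n = 0
    rw [hf, smul_zero])

/-- A product of Laurent series may be computed by summing over any pair of partially
well-ordered sets that contain the supports. -/
theorem coeff_mul_of_subset {R : Type*} [NonUnitalNonAssocSemiring R] {x y : R⸨X⸩}
    {s t : Set ℤ} (hs : s.IsPWO) (ht : t.IsPWO) (hx : x.support ⊆ s) (hy : y.support ⊆ t) (a : ℤ) :
    (x * y).coeff a =
      ∑ ij ∈ Finset.antidiagonal hs ht a, x.coeff ij.1 * y.coeff ij.2 := by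
  rw [HahnSeries.coeff_mul]
  refine Finset.sum_subset (fun ij h => ?_) (fun ij h h' => ?_)
  · rw [Finset.mem_antidiagonal] at h ⊢
    exact ⟨hx h.1, hy h.2.1, h.2.2⟩
  · rw [Finset.mem_antidiagonal] at h h'
    by_cases h1 : x.coeff ij.1 = 0
    · rw [h1, zero_mul]
    · by_cases h2 : y.coeff ij.2 = 0
      · rw [h2, mul_zero]
      · exact absurd ⟨h1, h2, h.2.2⟩ h'

section LoopGroup

variable {k : Type u} {H : Type v} {ι : Type w} [Field k] [AddCommGroup H] [Module k H]

section Adjoint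

variable [FiniteDimensional k H] (η : LinearMap.BilinForm k H) (hη : η.Nondegenerate)

/-- The adjoint `T*` of an endomorphism `T` with respect to the pairing `η`. -/
def adj (T : Module.End k H) : Module.End k H :=
  LinearMap.BilinForm.leftAdjointOfNondegenerate η hη T

theorem adj_spec (T : Module.End k H) (x y : H) : η (adj η hη T x) y = η x (T y) :=
  LinearMap.BilinForm.isAdjointPairLeftAdjointOfNondegenerate η hη T x y

theorem eq_adj {S T : Module.End k H} (h : ∀ x y, η (S x) y = η x (T y)) : S = adj η hη T :=
  (LinearMap.BilinForm.isAdjointPair_iff_eq_of_nondegenerate η hη S T).1 h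

theorem adj_zero : adj η hη (0 : Module.End k H) = 0 :=
  (eq_adj η hη (by simp)).symm

theorem adj_one : adj η hη (1 : Module.End k H) = 1 :=
  (eq_adj η hη (by simp)).symm

theorem adj_add (S T : Module.End k H) : adj η hη (S + T) = adj η hη S + adj η hη T :=
  (eq_adj η hη (by simp [adj_spec])).symm

theorem adj_mul (S T : Module.End k H) : adj η hη (S * T) = adj η hη T * adj η hη S :=
  (eq_adj η hη (by simp [adj_spec])).symm

/-- The adjoint as an additive map. -/
def adjHom : Module.End k H →+ Module.End k H where
  toFun := adj η hη
  map_zero' := adj_zero η hη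
  map_add' := adj_add η hη

/-- The series `M*(-z)` attached to an `End(H)`-valued Laurent series `M(z)` in `z⁻¹`. -/
def adjNegZ (M : (Module.End k H)⸨X⸩) : (Module.End k H)⸨X⸩ :=
  negZ (M.map (adjHom η hη))

theorem coeff_adjNegZ (M : (Module.End k H)⸨X⸩) (n : ℤ) :
    (adjNegZ η hη M).coeff n = (n.negOnePow : ℤˣ) • adj η hη (M.coeff n) := rfl

theorem support_adjNegZ (M : (Module.End k H)⸨X⸩) : (adjNegZ η hη M).support ⊆ M.support := by
  intro n hn hM
  apply hn
  rw [coeff_adjNegZ, hM, adj_zero, smul_zero]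

theorem adjNegZ_one : adjNegZ η hη (1 : (Module.End k H)⸨X⸩) = 1 := by
  refine HahnSeries.ext (funext fun n => ?_)
  rw [coeff_adjNegZ, HahnSeries.coeff_one]
  split_ifs with h
  · subst h; simp [adj_one]
  · rw [adj_zero, smul_zero]

theorem adjNegZ_mul (M N : (Module.End k H)⸨X⸩) :
    adjNegZ η hη (M * N) = adjNegZ η hη N * adjNegZ η hη M := by
  refine HahnSeries.ext (funext fun n => ?_)
  rw [coeff_adjNegZ, HahnSeries.coeff_mul, coeff_mul_of_subset N.isPWO_support M.isPWO_support
    (support_adjNegZ η hη N) (support_adjNegZ η hη M)]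
  change _ • adjHom η hη _ = _
  rw [map_sum, Finset.smul_sum]
  refine Finset.sum_bij' (fun ij _ => (ij.2, ij.1)) (fun ij _ => (ij.2, ij.1)) ?_ ?_
    (fun _ _ => rfl) (fun _ _ => rfl) ?_
  · intro ij h
    rw [Finset.mem_antidiagonal] at h ⊢
    exact ⟨h.2.1, h.1, by rw [add_comm]; exact h.2.2⟩
  · intro ij h
    rw [Finset.mem_antidiagonal] at h ⊢
    exact ⟨h.2.1, h.1, by rw [add_comm]; exact h.2.2⟩
  · intro ij h
    rw [Finset.mem_antidiagonal] at h
    change _ • adj η hη _ = _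
    rw [adj_mul, coeff_adjNegZ, coeff_adjNegZ, ← h.2.2, Int.negOnePow_add, smul_mul_smul_comm,
      mul_comm (Int.negOnePow ij.1)]

end Adjoint

variable [Fintype ι] [DecidableEq ι]

/-- The matrix of an `End(H)`-valued Laurent series in a basis `φ` of `H`. -/
def loopMatrix (φ : Module.Basis ι k H) (M : (Module.End k H)⸨X⸩) : Matrix ι ι k⸨X⸩ :=
  fun α β => M.map (φ.coord α ∘ₗ LinearMap.applyₗ (φ β) : Module.End k H →ₗ[k] k)

theorem coeff_loopMatrix (φ : Module.Basis ι k H) (M : (Module.End k H)⸨X⸩) (α β : ι) (n : ℤ) :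
    (loopMatrix φ M α β).coeff n = φ.repr (M.coeff n (φ β)) α := rfl

theorem loopMatrix_one (φ : Module.Basis ι k H) : loopMatrix φ 1 = 1 := by
  ext α β n
  rw [coeff_loopMatrix, HahnSeries.coeff_one, Matrix.one_apply]
  by_cases h : n = 0 <;> by_cases h' : α = β <;>
    simp [h, h', HahnSeries.coeff_one]

theorem loopMatrix_mul (φ : Module.Basis ι k H) (M N : (Module.End k H)⸨X⸩) :
    loopMatrix φ (M * N) = loopMatrix φ M * loopMatrix φ N := by
  have hsupp : ∀ (P : (Module.End k H)⸨X⸩) (α β : ι),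
      (loopMatrix φ P α β).support ⊆ P.support := by
    intro P α β n hn hP
    apply hn
    rw [coeff_loopMatrix, hP]
    simp
  ext α β n
  rw [coeff_loopMatrix, Matrix.mul_apply, HahnSeries.coeff_sum, HahnSeries.coeff_mul]
  simp_rw [coeff_mul_of_subset M.isPWO_support N.isPWO_support (hsupp M _ _) (hsupp N _ _)]
  rw [Finset.sum_comm, LinearMap.sum_apply, map_sum, Finsupp.finsetSum_apply]
  refine Finset.sum_congr rfl fun ij _ => ?_
  simp only [coeff_loopMatrix]
  rw [Module.End.mul_apply]
  conv_lhs => rw [← φ.sum_repr (N.coeff ij.2 (φ β)), map_sum, map_sum, Finsupp.finsetSum_apply]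
  refine Finset.sum_congr rfl fun γ _ => ?_
  rw [map_smul, map_smul, Finsupp.smul_apply, smul_eq_mul, mul_comm]

theorem loopMatrix_injective (φ : Module.Basis ι k H) :
    Function.Injective (loopMatrix φ : (Module.End k H)⸨X⸩ → Matrix ι ι k⸨X⸩) := by
  intro M N h
  refine HahnSeries.ext (funext fun n => ?_)
  refine φ.ext fun β => φ.ext_elem fun α => ?_
  rw [← coeff_loopMatrix, ← coeff_loopMatrix, h]

section Group

variable [FiniteDimensional k H] (η : LinearMap.BilinForm k H) (hη : η.Nondegenerate)

/-- The twisted loop group `L⁽²⁾GL(H)`: all `End(H)`-valued formal Laurent series `M` in `z⁻¹`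
such that `M*(-z) M(z) = 1`. It is a group, see the instance below. -/
def twistedLoopGroup : Submonoid (Module.End k H)⸨X⸩ where
  carrier := {M | adjNegZ η hη M * M = 1}
  one_mem' := by
    change adjNegZ η hη 1 * 1 = 1
    rw [adjNegZ_one, mul_one]
  mul_mem' := by
    intro M N (hM : adjNegZ η hη M * M = 1) (hN : adjNegZ η hη N * N = 1)
    change adjNegZ η hη (M * N) * (M * N) = 1
    rw [adjNegZ_mul, mul_assoc, ← mul_assoc (adjNegZ η hη M) M N, hM, one_mul, hN]

theorem mul_adjNegZ {M : (Module.End k H)⸨X⸩} (hM : M ∈ twistedLoopGroup η hη) :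
    M * adjNegZ η hη M = 1 := by
  have hM' : adjNegZ η hη M * M = 1 := hM
  classical
  let φ := Module.finBasis k H
  apply loopMatrix_injective φ
  rw [loopMatrix_mul, loopMatrix_one, mul_eq_one_comm, ← loopMatrix_mul, hM', loopMatrix_one]

instance : Group (twistedLoopGroup η hη) where
  inv M := ⟨adjNegZ η hη M.1, by
    change adjNegZ η hη (adjNegZ η hη M.1) * adjNegZ η hη M.1 = 1
    rw [← adjNegZ_mul, mul_adjNegZ η hη M.2, adjNegZ_one]⟩
  inv_mul_cancel M := Subtype.ext M.2

end Group

end LoopGroup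

/-! ### The loop space and its symplectic form -/

section LoopSpace

variable {k : Type u} {H : Type v} {ι : Type w} [Field k] [AddCommGroup H] [Module k H]
  [Fintype ι] [DecidableEq ι]

/-- The `A`-points of the loop space `H((z⁻¹))`, that is `(H ⊗ A)((z⁻¹))`, written in coordinates
with respect to a basis of `H` indexed by `ι`. For `A = k` it is the loop space itself. -/
abbrev Loop (ι : Type w) (A : Type u) [Zero A] : Type (max u w) := ι → A⸨X⸩

/-- Multiplication by `z`. -/
def zmul {A : Type u} [CommRing A] (f : Loop ι A) : Loop ι A :=
  fun α => HahnSeries.single (-1) 1 * f α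

/-- The symplectic form `Ω(f, g) = (2πi)⁻¹ ∮ (f(-z), g(z)) dz`, i.e. the coefficient of `z⁻¹`
in `(f(-z), g(z))`, where `(·,·)` is the pairing `η` on `H`. -/
def omega (η : LinearMap.BilinForm k H) (φ : Module.Basis ι k H) {A : Type u} [CommRing A]
    [Algebra k A] (f g : Loop ι A) : A :=
  zcoeff (∑ α, ∑ β, η (φ α) (φ β) • (negZ (f α) * g β)) (-1)

/-- The subspace `z⁻¹ H[[z⁻¹]]` of the loop space. -/
def IsNegative {A : Type u} [CommRing A] (f : Loop ι A) : Prop :=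
  ∀ (α : ι) (n : ℕ), zcoeff (f α) n = 0

/-- Extension of scalars from `k` to `A`, coefficient by coefficient. -/
def extendHom (k A : Type u) [Field k] [CommRing A] [Algebra k A] : k⸨X⸩ →+* A⸨X⸩ where
  toFun f := f.map (algebraMap k A)
  map_one' := HahnSeries.map_one (algebraMap k A).toMonoidWithZeroHom
  map_mul' _ _ := HahnSeries.map_mul ((algebraMap k A : k →+* A) : k →ₙ+* A)
  map_zero' := HahnSeries.map_zero ((algebraMap k A : k →+* A) : ZeroHom k A)
  map_add' _ _ := HahnSeries.map_add ((algebraMap k A : k →+* A) : k →+ A)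

/-- Extension of scalars for the loop space. -/
def extend {k : Type u} (A : Type u) [Field k] [CommRing A] [Algebra k A] (f : Loop ι k) :
    Loop ι A := fun α => extendHom k A (f α)

/-- The action of an `End(H)`-valued Laurent series on the `A`-points of the loop space. -/
def act (φ : Module.Basis ι k H) (M : (Module.End k H)⸨X⸩) {A : Type u} [CommRing A]
    [Algebra k A] (f : Loop ι A) : Loop ι A :=
  ((loopMatrix φ M).map (extendHom k A)).mulVec f

/-! ### Formal geometry in the loop space

Formal germs are described by their points over local Artinian `k`-algebras `A` with residue
field `k`: an `A`-point of a formal germ at `f₀` is a point of `(H ⊗ A)((z⁻¹))` that reduces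
to `f₀` modulo the maximal ideal (which consists of the nilpotent elements of `A`). -/

/-- `A` is a local Artinian `k`-algebra with residue field `k`: it is nonzero, of finite
dimension, and each element is the sum of a constant and a nilpotent element. -/
class IsTestAlgebra (k A : Type u) [Field k] [CommRing A] [Algebra k A] : Prop where
  finite : Module.Finite k A
  nontrivial : Nontrivial A
  residue : ∀ a : A, ∃ c : k, IsNilpotent (a - algebraMap k A c)

instance (k : Type u) [Field k] : IsTestAlgebra k k where
  finite := inferInstance
  nontrivial := inferInstance
  residue a := ⟨a, by simp⟩

/-- The algebra `A[ε]` of dual numbers over a test algebra is a test algebra. -/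
instance (k A : Type u) [Field k] [CommRing A] [Algebra k A] [h : IsTestAlgebra k A] :
    IsTestAlgebra k (DualNumber A) where
  finite := by
    have := h.finite
    exact inferInstanceAs (Module.Finite k (A × A))
  nontrivial := by
    have := h.nontrivial
    exact inferInstanceAs (Nontrivial (A × A))
  residue a := by
    obtain ⟨c, hc⟩ := h.residue a.fst
    refine ⟨c, TrivSqZeroExt.isNilpotent_iff_isNilpotent_fst.2 ?_⟩
    simpa [TrivSqZeroExt.algebraMap_eq_inl'] using hc

/-- A formal subset of the loop space, given by its points over all test algebras. -/
def Germ (k : Type u) (ι : Type w) [Field k] : Type (max (u + 1) w) :=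
  ∀ (A : Type u) [CommRing A] [Algebra k A] [IsTestAlgebra k A], Set (Loop ι A)

/-- The image of a germ under an `End(H)`-valued Laurent series. -/
def actGerm (φ : Module.Basis ι k H) (M : (Module.End k H)⸨X⸩) (X : Germ k ι) : Germ k ι :=
  fun A _ _ _ => act φ M '' X A

theorem actGerm_one (φ : Module.Basis ι k H) (X : Germ k ι) : actGerm φ 1 X = X := by
  funext A _ _ _
  have : ∀ f : Loop ι A, act φ (1 : (Module.End k H)⸨X⸩) f = f := by
    intro f
    rw [act, loopMatrix_one, Matrix.map_one _ (map_zero _) (map_one _), Matrix.one_mulVec]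
  simp [actGerm, this]

theorem actGerm_mul (φ : Module.Basis ι k H) (M N : (Module.End k H)⸨X⸩) (X : Germ k ι) :
    actGerm φ (M * N) X = actGerm φ M (actGerm φ N X) := by
  funext A _ _ _
  have : ∀ f : Loop ι A, act φ (M * N) f = act φ M (act φ N f) := by
    intro f
    rw [act, act, act, loopMatrix_mul, Matrix.map_mul, Matrix.mulVec_mulVec]
  simp [actGerm, this, Set.image_image]

/-- The `A[ε]`-point `f + ε v` of the loop space. -/
def addEps {A : Type u} [CommRing A] (f v : Loop ι A) : Loop ι (DualNumber A) :=
  fun α => (f α).map (TrivSqZeroExt.inlHom A A) + (v α).map (TrivSqZeroExt.inrHom A A)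

/-- The tangent space `T_f X` at an `A`-point `f`: all `v` such that `f + ε v` lies on `X`. -/
def tangent (X : Germ k ι) {A : Type u} [CommRing A] [Algebra k A] [IsTestAlgebra k A]
    (f : Loop ι A) : Set (Loop ι A) :=
  {v | addEps f v ∈ X (DualNumber A)}

/-- `A`-points of the loop space that reduce to `f₀`. -/
def IsNear (f₀ : Loop ι k) {A : Type u} [CommRing A] [Algebra k A] (f : Loop ι A) : Prop :=
  ∀ (α : ι) (n : ℤ), IsNilpotent ((f α).coeff n - algebraMap k A ((f₀ α).coeff n))

/-- The monomial `∏ i, t i ^ m i`. -/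
def monom {σ : Type w} {A : Type u} [CommRing A] (t : σ →₀ A) (m : σ →₀ ℕ) : A :=
  m.prod fun i e => t i ^ e

/-- The formal map `Φ` from `H[z]`, with coordinates indexed by `ι × ℕ`, to the loop space, given
by its Taylor coefficients, evaluated at a finitely supported `t` with nilpotent entries
(all but finitely many terms of the sum vanish). -/
def evalMap (Φ : ((ι × ℕ) →₀ ℕ) → Loop ι k) {A : Type u} [CommRing A] [Algebra k A]
    (t : (ι × ℕ) →₀ A) : Loop ι A :=
  ∑ᶠ m, monom t m • extend A (Φ m)

/-- The formal function `F`, evaluated at a finitely supported `t` with nilpotent entries. -/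
def evalSeries {k : Type u} [Field k] (F : MvPowerSeries (ι × ℕ) k) {A : Type u} [CommRing A]
    [Algebra k A] (t : (ι × ℕ) →₀ A) : A :=
  ∑ᶠ m, algebraMap k A (MvPowerSeries.coeff m F) * monom t m

/-- `X` is a formal germ at `f₀` of a submanifold of the loop space modelled on `H[z]`: it is
parametrized by a formal map `Φ` from `H[z]` to the loop space with `Φ(0) = f₀` and with injective
differential at `0`. -/
def IsSubmanifoldGerm (f₀ : Loop ι k) (X : Germ k ι) : Prop :=
  ∃ Φ : ((ι × ℕ) →₀ ℕ) → Loop ι k, Φ 0 = f₀ ∧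
    LinearIndependent k (fun i : ι × ℕ => Φ (Finsupp.single i 1)) ∧
    ∀ (A : Type u) [CommRing A] [Algebra k A] [IsTestAlgebra k A],
      X A = {f | ∃ t : (ι × ℕ) →₀ A, (∀ i, IsNilpotent (t i)) ∧ f = evalMap Φ t}

/-- All tangent spaces of `X` are Lagrangian, i.e. they coincide with their `Ω`-orthogonals. -/
def IsLagrangian (η : LinearMap.BilinForm k H) (φ : Module.Basis ι k H) (X : Germ k ι) : Prop :=
  ∀ (A : Type u) [CommRing A] [Algebra k A] [IsTestAlgebra k A], ∀ f ∈ X A,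
    tangent X f = {v | ∀ u ∈ tangent X f, omega η φ u v = 0}

/-- `X` is a formal germ of a cone with vertex at the origin: it is preserved by the scalars
infinitely close to `1`. -/
def IsCone (X : Germ k ι) : Prop :=
  ∀ (A : Type u) [CommRing A] [Algebra k A] [IsTestAlgebra k A], ∀ f ∈ X A,
    ∀ c : A, IsNilpotent (c - 1) → c • f ∈ X A

/-- The tangent spaces `L` of the germ `X` at `f₀` satisfy `zL ⊆ L`, and `L` is tangent to `X`
exactly along `zL`: near `f₀`, the points of `zL` are precisely the points of `X` at which the
tangent space is `L`. -/
def TangentExactlyAlongZ (f₀ : Loop ι k) (X : Germ k ι) : Prop :=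
  ∀ (A : Type u) [CommRing A] [Algebra k A] [IsTestAlgebra k A], ∀ f ∈ X A,
    (∀ v ∈ tangent X f, zmul v ∈ tangent X f) ∧
    {g | g ∈ X A ∧ tangent X g = tangent X f} = {g | g ∈ zmul '' tangent X f ∧ IsNear f₀ g}

/-- The class of germs, at points `f₀ ≠ 0`, of Lagrangian cones with property `(⋆)`. -/
structure IsStarCone (η : LinearMap.BilinForm k H) (φ : Module.Basis ι k H)
    (f₀ : Loop ι k) (X : Germ k ι) : Prop where
  ne_zero : f₀ ≠ 0
  submanifold : IsSubmanifoldGerm f₀ X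
  lagrangian : IsLagrangian η φ X
  cone : IsCone X
  tangent_along : TangentExactlyAlongZ f₀ X

/-- The tangent spaces of `X` at its `k`-points are complementary to `z⁻¹ H[[z⁻¹]]`; equivalently,
`X` is a formal section of the projection of the loop space to `H[z]` along `z⁻¹ H[[z⁻¹]]`. -/
def IsTransverse (X : Germ k ι) : Prop :=
  ∀ f ∈ X k, ∀ v : Loop ι k, ∃! l, l ∈ tangent X f ∧ IsNegative (v - l)

/-! ### Generating functions -/

/-- The Gram matrix `(g_αβ)`. -/
def gram (η : LinearMap.BilinForm k H) (φ : Module.Basis ι k H) : Matrix ι ι k :=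
  fun α β => η (φ α) (φ β)

/-- The partial derivative `∂_{α,n} F` with respect to `t_n^α`. -/
def pd (α : ι) (n : ℕ) (F : MvPowerSeries (ι × ℕ) k) : MvPowerSeries (ι × ℕ) k :=
  MvPowerSeries.pderiv k (α, n) F

/-- The coordinate function `t_n^α` as a formal function near the point `a`, i.e. as
a formal series in the increments `s = t - a`. -/
def tvar (a : (ι × ℕ) →₀ k) (α : ι) (n : ℕ) : MvPowerSeries (ι × ℕ) k :=
  MvPowerSeries.C (a (α, n)) + MvPowerSeries.X (α, n)

/-- The sum of a family of formal functions of which only finitely many contribute to each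
given monomial. -/
def formalSum {k : Type u} [Field k] (G : ι × ℕ → MvPowerSeries (ι × ℕ) k) :
    MvPowerSeries (ι × ℕ) k :=
  fun m => ∑ᶠ i, MvPowerSeries.coeff m (G i)

/-- The system DE + SE + TRR for a formal function `F` near the point `t = a` (a formal series
in `s = t - a`). The basis vector `φ o` is the distinguished element `1` of `H`. -/
structure IsGenerating (η : LinearMap.BilinForm k H) (φ : Module.Basis ι k H) (o : ι)
    (a : (ι × ℕ) →₀ k) (F : MvPowerSeries (ι × ℕ) k) : Prop where
  dilaton : pd o 1 F = formalSum (fun i => tvar a i.1 i.2 * pd i.1 i.2 F) - 2 * F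
  string : pd o 0 F =
    MvPowerSeries.C (1 / 2 : k) *
        (∑ α, ∑ β, MvPowerSeries.C (gram η φ α β) * tvar a α 0 * tvar a β 0)
      + formalSum (fun i => tvar a i.1 (i.2 + 1) * pd i.1 i.2 F)
  trr : ∀ (α β γ : ι) (l m n : ℕ),
    pd α (l + 1) (pd β m (pd γ n F)) =
      ∑ μ, ∑ ν, pd α l (pd μ 0 F) * MvPowerSeries.C ((gram η φ)⁻¹ μ ν) *
        pd ν 0 (pd β m (pd γ n F))

/-- The graph of `dF`, for a formal function `F` near `t = a`, as a germ in the loop space.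
With the dilaton shift, `t = a + s` corresponds to `q(z) = -z + ∑ t_n z ^ n` in `H[z]`, where `-z`
stands for `-(φ o) z`. The covector `p = dF` is identified through `q' ↦ Ω(p, q')` with
the element `∑ g^{αβ} (∂_{α,n} F) φ_β (-z)^(-n-1)` of `z⁻¹ H[[z⁻¹]]`, sum over `α, β, n`. -/
def graph (η : LinearMap.BilinForm k H) (φ : Module.Basis ι k H) (o : ι)
    (a : (ι × ℕ) →₀ k) (F : MvPowerSeries (ι × ℕ) k) : Germ k ι :=
  fun A _ _ _ => {f | ∃ s : (ι × ℕ) →₀ A, (∀ i, IsNilpotent (s i)) ∧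
    (∀ (β : ι) (n : ℕ), zcoeff (f β) n =
      algebraMap k A (a (β, n)) + s (β, n) - if (β, n) = (o, 1) then 1 else 0) ∧
    ∀ (β : ι) (n : ℕ), zcoeff (f β) (-(n : ℤ) - 1) =
      (-1) ^ (n + 1) *
        ∑ α, algebraMap k A ((gram η φ)⁻¹ α β) * evalSeries (pd α n F) s}

end LoopSpace

end Givental

end

open Givental

/-! Property (⋆) involves only the linear structure of the loop space, the form Ω and multiplication
by z. An element M of the twisted loop group acts by a linear automorphism that commutes with z
(`act_zmul`) and preserves Ω (`omega_act`), because M*(-z)M(z) = 1 is exactly invariance of the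
residue pairing. It therefore transports parametrizations, tangent spaces and cones
(`IsStarCone.actGerm`), and M⁻¹ gives the converse.

The rest is a dictionary between (⋆) and DE+SE+TRR. In the Darboux coordinates q = `pos`, p = `neg`,
the graph of dF is p = ∇F(q) and T_f is the graph of the Hessian. The dilaton shift makes DE and SE
homogeneous in q; differentiated, they say that f and z⁻¹f lie in T_f. SE and TRR together imply a
quadratic relation between second derivatives (`IsGenerating.hess_up`), which is zT_f ⊆ T_f. TRR
itself says that third derivatives vanish in the directions of zT_f. Uniqueness for a linear
differential system integrates this along segments (`IsGenerating.hess_pathPoint`): the Hessian is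
constant along zT_f. This gives tangency exactly along zT_f, then the cone property
(`IsGenerating.isStarCone`).

Conversely, let a graph satisfy (⋆). Then f ∈ zT_f ⊆ T_f gives the differentials of SE and DE, and
moving f by εzv, which does not move the tangent space, gives TRR (`IsStarCone.third_up`). The
equations DE and SE themselves can now fail only by constants. Adding c to F changes the defect of
DE by -2c, so exactly one c removes it. The constant defect of SE is -½Ω(z⁻¹f, f) at the base point
f, and vanishes since T_f is isotropic (`constantCoeff_stringDefect`).

For (a), transversality and a formal inverse function theorem (`existsUnique_pos_evalMap`) turn the
germ into a section p = P(q). The Lagrangian condition says that P is closed, and the formal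
Poincaré lemma (`exists_potential`) yields a potential. Formal functions are handled throughout by
their values at nilpotent points, which `series_ext` and `exists_series_of_natural` justify. -/

noncomputable section

namespace Givental

/-! ### Evaluation of formal functions at nilpotent points -/

section Evaluation

variable {k : Type u} {ι : Type w} [Field k]

/-- The exponents `n` bound the nilpotency of the entries of `s`. -/
def Kills {A : Type u} [CommRing A] (n : (ι × ℕ) →₀ ℕ) (s : (ι × ℕ) →₀ A) : Prop :=
  ∀ i, s i ^ (n i + 1) = 0

theorem Kills.mono {A : Type u} [CommRing A] {n n' : (ι × ℕ) →₀ ℕ} {s : (ι × ℕ) →₀ A}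
    (h : Kills n s) (hn : n ≤ n') : Kills n' s := fun i =>
  pow_eq_zero_of_le (Nat.succ_le_succ (hn i)) (h i)

theorem exists_kills {A : Type u} [CommRing A] {s : (ι × ℕ) →₀ A} (hs : ∀ i, IsNilpotent (s i)) :
    ∃ n : (ι × ℕ) →₀ ℕ, Kills n s := by
  classical
  -- Exponent 0 wherever `s` vanishes keeps the bound finitely supported.
  refine ⟨Finsupp.onFinset s.support (fun i => if s i = 0 then 0 else (hs i).choose)
    (fun i hi => ?_), fun i => ?_⟩
  · rw [Finsupp.mem_support_iff]
    intro h
    simp [h] at hi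
  · by_cases h : s i = 0
    · simp [h]
    · simp only [Finsupp.onFinset_apply, h, if_false]
      exact pow_eq_zero_of_le (Nat.le_succ _) (hs i).choose_spec

theorem monom_eq_zero {A : Type u} [CommRing A] {n m : (ι × ℕ) →₀ ℕ} {s : (ι × ℕ) →₀ A}
    (h : Kills n s) (hm : ¬ m ≤ n) : monom s m = 0 := by
  rw [Finsupp.le_def] at hm
  push Not at hm
  obtain ⟨i, hi⟩ := hm
  have : i ∈ m.support := by rw [Finsupp.mem_support_iff]; omega
  exact Finset.prod_eq_zero this (pow_eq_zero_of_le hi (h i))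

variable {A : Type u} [CommRing A] [Algebra k A]

theorem finsum_monom_eq {M : Type*} [AddCommGroup M] [Module A M] {n : (ι × ℕ) →₀ ℕ}
    {s : (ι × ℕ) →₀ A} (h : Kills n s) (c : ((ι × ℕ) →₀ ℕ) → M) [DecidableEq ι] :
    ∑ᶠ m, monom s m • c m = ∑ m ∈ Finset.Iic n, monom s m • c m := by
  refine finsum_eq_sum_of_support_subset _ fun m hm => ?_
  rw [Finset.coe_Iic, Set.mem_Iic]
  by_contra h'
  exact hm (by simp only [monom_eq_zero h h', zero_smul])

theorem evalSeries_eq_sum [DecidableEq ι] {n : (ι × ℕ) →₀ ℕ} {s : (ι × ℕ) →₀ A} (h : Kills n s)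
    (F : MvPowerSeries (ι × ℕ) k) :
    evalSeries F s = ∑ m ∈ Finset.Iic n, algebraMap k A (MvPowerSeries.coeff m F) * monom s m := by
  rw [evalSeries]
  simp_rw [mul_comm _ (monom s _), ← smul_eq_mul (monom s _)]
  exact finsum_monom_eq h _

theorem evalSeries_congr {n : (ι × ℕ) →₀ ℕ} {s : (ι × ℕ) →₀ A} (h : Kills n s)
    {F G : MvPowerSeries (ι × ℕ) k}
    (hFG : ∀ m ≤ n, MvPowerSeries.coeff m F = MvPowerSeries.coeff m G) :
    evalSeries F s = evalSeries G s := by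
  classical
  rw [evalSeries_eq_sum h, evalSeries_eq_sum h]
  exact Finset.sum_congr rfl fun m hm => by rw [hFG m (Finset.mem_Iic.1 hm)]

theorem evalSeries_coe {s : (ι × ℕ) →₀ A} (P : MvPolynomial (ι × ℕ) k) :
    evalSeries (P : MvPowerSeries (ι × ℕ) k) s = MvPolynomial.aeval s P := by
  rw [MvPolynomial.aeval_def, MvPolynomial.eval₂_eq, evalSeries]
  refine finsum_eq_sum_of_support_subset _ fun m hm => ?_
  rw [Finset.mem_coe, MvPolynomial.mem_support_iff]
  intro h
  exact hm (by simp [h])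

/-- Monomials not dividing the bound `n` vanish at `s`, so a formal function may be replaced by a
polynomial. Ring laws and the chain rule are reduced to polynomials in this way. -/
theorem evalSeries_eq_aeval [DecidableEq ι] {n : (ι × ℕ) →₀ ℕ} {s : (ι × ℕ) →₀ A} (h : Kills n s)
    (F : MvPowerSeries (ι × ℕ) k) :
    evalSeries F s = MvPolynomial.aeval s (MvPowerSeries.trunc' k n F) := by
  rw [← evalSeries_coe]
  refine evalSeries_congr h fun m hm => ?_
  rw [MvPolynomial.coeff_coe, MvPowerSeries.coeff_trunc', if_pos hm]

theorem evalSeries_add {s : (ι × ℕ) →₀ A} (hs : ∀ i, IsNilpotent (s i))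
    (F G : MvPowerSeries (ι × ℕ) k) : evalSeries (F + G) s = evalSeries F s + evalSeries G s := by
  classical
  obtain ⟨n, h⟩ := exists_kills hs
  simp_rw [evalSeries_eq_aeval h, map_add]

theorem evalSeries_mul {s : (ι × ℕ) →₀ A} (hs : ∀ i, IsNilpotent (s i))
    (F G : MvPowerSeries (ι × ℕ) k) : evalSeries (F * G) s = evalSeries F s * evalSeries G s := by
  classical
  obtain ⟨n, h⟩ := exists_kills hs
  rw [evalSeries_eq_aeval h F, evalSeries_eq_aeval h G, ← map_mul, ← evalSeries_coe]
  refine evalSeries_congr h fun m hm => ?_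
  rw [← MvPowerSeries.coeff_trunc'_mul_trunc'_eq_coeff_mul _ _ _ hm, ← MvPolynomial.coeff_coe]

theorem evalSeries_C (s : (ι × ℕ) →₀ A) (c : k) :
    evalSeries (MvPowerSeries.C c : MvPowerSeries (ι × ℕ) k) s = algebraMap k A c := by
  rw [← MvPolynomial.coe_C, evalSeries_coe, MvPolynomial.aeval_C]

theorem evalSeries_X (s : (ι × ℕ) →₀ A) (i : ι × ℕ) :
    evalSeries (MvPowerSeries.X i : MvPowerSeries (ι × ℕ) k) s = s i := by
  rw [← MvPolynomial.coe_X, evalSeries_coe, MvPolynomial.aeval_X]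

/-- Evaluation at a nilpotent point, as a ring homomorphism. -/
def evalHom {s : (ι × ℕ) →₀ A} (hs : ∀ i, IsNilpotent (s i)) :
    MvPowerSeries (ι × ℕ) k →+* A where
  toFun F := evalSeries F s
  map_one' := by rw [← map_one MvPowerSeries.C, evalSeries_C, map_one]
  map_mul' := evalSeries_mul hs
  map_zero' := by rw [← map_zero MvPowerSeries.C, evalSeries_C, map_zero]
  map_add' := evalSeries_add hs

theorem evalHom_apply {s : (ι × ℕ) →₀ A} (hs : ∀ i, IsNilpotent (s i))
    (F : MvPowerSeries (ι × ℕ) k) : evalHom hs F = evalSeries F s := rfl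

theorem evalSeries_zero_point (F : MvPowerSeries (ι × ℕ) k) :
    evalSeries F (0 : (ι × ℕ) →₀ A) = algebraMap k A (MvPowerSeries.constantCoeff F) := by
  classical
  have h : Kills 0 (0 : (ι × ℕ) →₀ A) := fun i => by simp
  rw [evalSeries_eq_sum h]
  have : (Finset.Iic 0 : Finset ((ι × ℕ) →₀ ℕ)) = {0} := by
    ext m; simp
  rw [this, Finset.sum_singleton]
  simp [monom]

variable {B : Type u} [CommRing B] [Algebra k B]

theorem map_evalSeries (ψ : A →ₐ[k] B) {s : (ι × ℕ) →₀ A} (hs : ∀ i, IsNilpotent (s i))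
    {s' : (ι × ℕ) →₀ B} (h' : ∀ i, s' i = ψ (s i)) (F : MvPowerSeries (ι × ℕ) k) :
    ψ (evalSeries F s) = evalSeries F s' := by
  classical
  obtain ⟨n, h⟩ := exists_kills hs
  have h2 : Kills n s' := fun i => by rw [h', ← map_pow, h, map_zero]
  rw [evalSeries_eq_sum h, evalSeries_eq_sum h2, map_sum]
  refine Finset.sum_congr rfl fun m _ => ?_
  rw [map_mul, AlgHom.commutes, monom, monom, Finsupp.prod, map_prod]
  simp_rw [map_pow, h']
  rfl

/-- The chain rule, for a derivation `δ` along an algebra homomorphism `ψ`. -/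
theorem chain_rule (ψ : A →ₐ[k] B) (δ : A →ₗ[k] B)
    (hδ : ∀ x y, δ (x * y) = ψ x * δ y + ψ y * δ x)
    {s : (ι × ℕ) →₀ A} (hs : ∀ i, IsNilpotent (s i))
    {s' : (ι × ℕ) →₀ B} (h' : ∀ i, s' i = ψ (s i)) {d : (ι × ℕ) →₀ B} (hd : ∀ i, d i = δ (s i))
    (F : MvPowerSeries (ι × ℕ) k) :
    δ (evalSeries F s) =
      Finsupp.linearCombination B (fun i => evalSeries (MvPowerSeries.pderiv k i F) s') d := by
  classical
  have h1 : δ 1 = 0 := by simpa using hδ 1 1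
  have halg : ∀ c : k, δ (algebraMap k A c) = 0 := fun c => by
    rw [Algebra.algebraMap_eq_smul_one, map_smul, h1, smul_zero]
  have hpoly : ∀ P : MvPolynomial (ι × ℕ) k, δ (MvPolynomial.aeval s P) =
      Finsupp.linearCombination B (fun i => MvPolynomial.aeval s' (MvPolynomial.pderiv i P)) d := by
    intro P
    induction P using MvPolynomial.induction_on with
    | C c => simp [halg, Finsupp.linearCombination_apply, Finsupp.sum]
    | add P Q hP hQ =>
      rw [map_add, map_add, hP, hQ]
      simp [Finsupp.linearCombination_apply, Finsupp.sum, mul_add, Finset.sum_add_distrib]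
    | mul_X P j hP =>
      have hψ : ψ (MvPolynomial.aeval s P) = MvPolynomial.aeval s' P := by
        rw [← AlgHom.comp_apply, MvPolynomial.comp_aeval]
        congr 2
        exact funext fun i => (h' i).symm
      rw [map_mul, hδ, hP, hψ, MvPolynomial.aeval_X, ← h', ← hd]
      simp only [Finsupp.linearCombination_apply, Finsupp.sum, smul_eq_mul, Finset.mul_sum,
        Derivation.leibniz, map_add, map_mul, MvPolynomial.aeval_X, MvPolynomial.pderiv_X,
        mul_add, Finset.sum_add_distrib, Pi.single_apply]
      congr 1
      · rw [Finset.sum_eq_single j]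
        · simp [mul_comm]
        · intro i _ hi
          simp [hi.symm]
        · intro hj
          simp [Finsupp.notMem_support_iff.1 hj]
      · exact Finset.sum_congr rfl fun i _ => by ring
  obtain ⟨n, h⟩ := exists_kills hs
  -- Differentiation lowers an exponent by one, so truncation at `n` would lose top coefficients of
  -- the derivatives. One extra degree in each variable of the support of `s` repairs this.
  have hn : n ≤ n + Finsupp.indicator s.support (fun _ _ => 1) := by
    intro i; simp only [Finsupp.add_apply]; omega
  set N := n + Finsupp.indicator s.support (fun _ _ => 1)
  have hN := h.mono hn
  rw [evalSeries_eq_aeval hN, hpoly, Finsupp.linearCombination_apply,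
    Finsupp.linearCombination_apply]
  refine Finsupp.sum_congr fun i hi => ?_
  have hsi : s i ≠ 0 := by
    intro hsi
    rw [Finsupp.mem_support_iff, hd, hsi, map_zero] at hi
    exact hi rfl
  have hNi : n + Finsupp.single i 1 ≤ N := by
    intro j
    simp only [N, Finsupp.add_apply, Finsupp.single_apply]
    split_ifs with hij
    · subst hij
      simp [Finsupp.indicator_apply, hsi]
    · simp
  rw [← evalSeries_coe, ← MvPowerSeries.pderiv_coe]
  congr 1
  have h2 : Kills n s' := fun i => by rw [h', ← map_pow, h, map_zero]
  refine evalSeries_congr h2 fun m hm => ?_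
  rw [MvPowerSeries.coeff_pderiv, MvPowerSeries.coeff_pderiv, MvPolynomial.coeff_coe,
    MvPowerSeries.coeff_trunc', if_pos]
  exact (add_le_add_left hm _).trans hNi

end Evaluation

/-! ### Universal nilpotent points -/

section Universal

variable (k : Type u) [Field k]

/-- The ideal spanned by the monomials that do not divide the monomial with exponents `N`. -/
def truncIdeal (N : ℕ →₀ ℕ) : Ideal (MvPolynomial ℕ k) :=
  Ideal.span ((fun s => MvPolynomial.monomial s (1 : k)) '' {s | ¬ s ≤ N})

/-- The algebra of polynomials truncated beyond the exponents `N`. -/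
abbrev TruncAlg (N : ℕ →₀ ℕ) : Type u := MvPolynomial ℕ k ⧸ truncIdeal k N

variable {k}

/-- The ideal is monomial, so the monomials with exponents at most `N` form a basis of the quotient.
The variables are indexed by `ℕ` rather than `ι × ℕ` because test algebras have to live in the
universe of `k`. -/
theorem mem_truncIdeal {N : ℕ →₀ ℕ} {P : MvPolynomial ℕ k} :
    P ∈ truncIdeal k N ↔ ∀ m ≤ N, P.coeff m = 0 := by
  rw [truncIdeal, MvPolynomial.mem_ideal_span_monomial_image]
  refine ⟨fun h m hm => ?_, fun h m hm => ⟨m, fun h' => ?_, le_rfl⟩⟩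
  · by_contra h'
    obtain ⟨m', h1, h2⟩ := h m (MvPolynomial.mem_support_iff.2 h')
    exact h1 (h2.trans hm)
  · exact MvPolynomial.mem_support_iff.1 hm (h m h')

theorem truncMk_eq_iff {N : ℕ →₀ ℕ} {P Q : MvPolynomial ℕ k} :
    Ideal.Quotient.mk (truncIdeal k N) P = Ideal.Quotient.mk (truncIdeal k N) Q ↔
      ∀ m ≤ N, P.coeff m = Q.coeff m := by
  rw [Ideal.Quotient.eq, mem_truncIdeal]
  simp_rw [MvPolynomial.coeff_sub, sub_eq_zero]

theorem truncIdeal_anti {N N' : ℕ →₀ ℕ} (h : N' ≤ N) : truncIdeal k N ≤ truncIdeal k N' :=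
  fun _ hP => mem_truncIdeal.2 fun m hm => mem_truncIdeal.1 hP m (hm.trans h)

theorem truncMk_X_pow (N : ℕ →₀ ℕ) (j : ℕ) :
    (Ideal.Quotient.mk (truncIdeal k N) (MvPolynomial.X j)) ^ (N j + 1) = 0 := by
  rw [← map_pow, Ideal.Quotient.eq_zero_iff_mem, MvPolynomial.X_pow_eq_monomial]
  refine Ideal.subset_span ⟨_, fun h => ?_, rfl⟩
  have := h j
  simp at this

instance (N : ℕ →₀ ℕ) : IsTestAlgebra k (TruncAlg k N) where
  finite := by
    classical
    refine ⟨⟨(Finset.Iic N).image fun m =>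
      Ideal.Quotient.mk (truncIdeal k N) (MvPolynomial.monomial m (1 : k)), ?_⟩⟩
    rw [eq_top_iff]
    rintro x -
    obtain ⟨P, rfl⟩ := Ideal.Quotient.mk_surjective x
    have hP : Ideal.Quotient.mk (truncIdeal k N) P = Ideal.Quotient.mk (truncIdeal k N)
        (∑ m ∈ Finset.Iic N, P.coeff m • MvPolynomial.monomial m 1) := by
      rw [truncMk_eq_iff]
      intro m hm
      simp only [MvPolynomial.coeff_sum, MvPolynomial.coeff_smul, MvPolynomial.coeff_monomial,
        smul_eq_mul]
      rw [Finset.sum_eq_single m]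
      · simp
      · intro b _ hb
        simp [hb]
      · intro h
        exact absurd (Finset.mem_Iic.2 hm) h
    rw [hP, map_sum]
    refine Submodule.sum_mem _ fun m hm => ?_
    change Ideal.Quotient.mkₐ k (truncIdeal k N) _ ∈ _
    rw [map_smul]
    exact Submodule.smul_mem _ _ (Submodule.subset_span (by
      rw [Finset.coe_image]
      exact ⟨m, hm, rfl⟩))
  nontrivial := by
    refine ⟨⟨Ideal.Quotient.mk _ 1, Ideal.Quotient.mk _ 0, fun h => ?_⟩⟩
    have := truncMk_eq_iff.1 h 0 (Finsupp.le_def.2 fun _ => Nat.zero_le _)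
    simp at this
  residue x := by
    obtain ⟨P, rfl⟩ := Ideal.Quotient.mk_surjective x
    refine ⟨MvPolynomial.constantCoeff P, ?_⟩
    change IsNilpotent (Ideal.Quotient.mk (truncIdeal k N) P -
      Ideal.Quotient.mk (truncIdeal k N) (MvPolynomial.C (MvPolynomial.constantCoeff P)))
    induction P using MvPolynomial.induction_on with
    | C c => simp
    | add P Q hP hQ =>
      have := (Commute.all _ _).isNilpotent_add hP hQ
      rw [sub_add_sub_comm] at this
      rwa [RingHom.map_add, RingHom.map_add, MvPolynomial.C_add, RingHom.map_add]
    | mul_X P j hP =>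
      simp only [map_mul, MvPolynomial.constantCoeff_X, mul_zero, map_zero, sub_zero]
      exact (Commute.all _ _).isNilpotent_mul_left ⟨_, truncMk_X_pow N j⟩

/-- The homomorphism from a truncated polynomial algebra given by the images of the variables. -/
def truncLift {A : Type u} [CommRing A] [Algebra k A] {N : ℕ →₀ ℕ} (x : ℕ → A)
    (hx : ∀ j, x j ^ (N j + 1) = 0) : TruncAlg k N →ₐ[k] A :=
  Ideal.Quotient.liftₐ (truncIdeal k N) (MvPolynomial.aeval x) (by
    suffices h : truncIdeal k N ≤ RingHom.ker (MvPolynomial.aeval x : MvPolynomial ℕ k →ₐ[k] A) from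
      fun a ha => h ha
    rw [truncIdeal, Ideal.span_le]
    rintro _ ⟨m, hm, rfl⟩
    rw [SetLike.mem_coe, RingHom.mem_ker, MvPolynomial.aeval_monomial]
    rw [Set.mem_ofPred_eq, Finsupp.le_def] at hm
    push Not at hm
    obtain ⟨j, hj⟩ := hm
    have : j ∈ m.support := by rw [Finsupp.mem_support_iff]; omega
    rw [Finsupp.prod, Finset.prod_eq_zero (f := fun a => x a ^ m a) this
      (pow_eq_zero_of_le hj (hx j)), mul_zero])

variable {ι : Type w}

/-- The universal point with nilpotency bounded by `n`. -/
def univPoint (e : ι × ℕ ↪ ℕ) (n : (ι × ℕ) →₀ ℕ) : (ι × ℕ) →₀ TruncAlg k (n.embDomain e) :=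
  Finsupp.onFinset n.support (fun i => Ideal.Quotient.mk _ (MvPolynomial.X (e i))) (by
    intro i hi
    rw [Finsupp.mem_support_iff]
    intro h
    apply hi
    have := truncMk_X_pow (k := k) (n.embDomain e) (e i)
    rwa [Finsupp.embDomain_apply_self, h, zero_add, pow_one] at this)

theorem kills_univPoint (e : ι × ℕ ↪ ℕ) (n : (ι × ℕ) →₀ ℕ) : Kills n (univPoint (k := k) e n) := by
  intro i
  have := truncMk_X_pow (k := k) (n.embDomain e) (e i)
  rwa [Finsupp.embDomain_apply_self] at this

theorem Kills.isNilpotent {A : Type u} [CommRing A] {n : (ι × ℕ) →₀ ℕ} {s : (ι × ℕ) →₀ A}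
    (h : Kills n s) (i : ι × ℕ) : IsNilpotent (s i) := ⟨_, h i⟩

theorem embDomain_le_iff (e : ι × ℕ ↪ ℕ) {n m : (ι × ℕ) →₀ ℕ} :
    m.embDomain e ≤ n.embDomain e ↔ m ≤ n := by
  refine ⟨fun h i => by simpa using h (e i), fun h j => ?_⟩
  by_cases hj : j ∈ Set.range e
  · obtain ⟨i, rfl⟩ := hj
    simpa using h i
  · rw [Finsupp.embDomain_of_notMem_range _ _ _ hj]
    exact Nat.zero_le _

theorem exists_embDomain_eq (e : ι × ℕ ↪ ℕ) {n : (ι × ℕ) →₀ ℕ} {M : ℕ →₀ ℕ}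
    (h : M ≤ n.embDomain e) : ∃ m ≤ n, M = m.embDomain e := by
  have hM : M = (M.comapDomain e e.injective.injOn).embDomain e := by
    ext j
    by_cases hj : j ∈ Set.range e
    · obtain ⟨i, rfl⟩ := hj
      simp
    · rw [Finsupp.embDomain_of_notMem_range _ _ _ hj]
      have := h j
      rw [Finsupp.embDomain_of_notMem_range _ _ _ hj] at this
      exact Nat.le_zero.1 this
  refine ⟨_, ?_, hM⟩
  rwa [hM, embDomain_le_iff] at h

theorem evalSeries_univPoint [DecidableEq ι] (e : ι × ℕ ↪ ℕ) (n : (ι × ℕ) →₀ ℕ)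
    (F : MvPowerSeries (ι × ℕ) k) :
    evalSeries F (univPoint e n) =
      Ideal.Quotient.mk _ (MvPolynomial.rename e (MvPowerSeries.trunc' k n F)) := by
  rw [evalSeries_eq_aeval (kills_univPoint e n)]
  change _ = Ideal.Quotient.mkₐ k _ _
  rw [← AlgHom.comp_apply]
  congr 1
  refine MvPolynomial.algHom_ext fun i => ?_
  rw [MvPolynomial.aeval_X, AlgHom.comp_apply, MvPolynomial.rename_X]
  rfl

theorem coeff_rename_trunc [DecidableEq ι] (e : ι × ℕ ↪ ℕ) {n m : (ι × ℕ) →₀ ℕ} (hm : m ≤ n)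
    (F : MvPowerSeries (ι × ℕ) k) :
    (MvPolynomial.rename e (MvPowerSeries.trunc' k n F)).coeff (m.embDomain e) =
      MvPowerSeries.coeff m F := by
  rw [MvPolynomial.coeff_rename_embDomain, MvPowerSeries.coeff_trunc', if_pos hm]

/-- A formal function is determined by its values at nilpotent points over test algebras. -/
theorem series_ext [Finite ι] {F G : MvPowerSeries (ι × ℕ) k}
    (h : ∀ (A : Type u) [CommRing A] [Algebra k A] [IsTestAlgebra k A] (s : (ι × ℕ) →₀ A),
      (∀ i, IsNilpotent (s i)) → evalSeries F s = evalSeries G s) : F = G := by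
  classical
  obtain ⟨e, he⟩ := exists_injective_nat (ι × ℕ)
  let e' : ι × ℕ ↪ ℕ := ⟨e, he⟩
  ext m
  -- The universal point with bound `m` still sees the coefficient at `m`, so equal values there
  -- force equal coefficients.
  have := h _ (univPoint (k := k) e' m) (kills_univPoint e' m).isNilpotent
  rw [evalSeries_univPoint, evalSeries_univPoint, truncMk_eq_iff] at this
  rw [← coeff_rename_trunc e' le_rfl, ← coeff_rename_trunc e' le_rfl]
  exact this _ le_rfl

/-- A function on nilpotent points that is natural in the test algebra is a formal function. -/
theorem exists_series_of_natural [Finite ι]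
    (p : ∀ (A : Type u) [CommRing A] [Algebra k A] [IsTestAlgebra k A], ((ι × ℕ) →₀ A) → A)
    (hp : ∀ (A B : Type u) [CommRing A] [Algebra k A] [IsTestAlgebra k A] [CommRing B]
      [Algebra k B] [IsTestAlgebra k B] (ψ : A →ₐ[k] B) (s : (ι × ℕ) →₀ A) (s' : (ι × ℕ) →₀ B),
      (∀ i, IsNilpotent (s i)) → (∀ i, s' i = ψ (s i)) → p B s' = ψ (p A s)) :
    ∃ P : MvPowerSeries (ι × ℕ) k,
      ∀ (A : Type u) [CommRing A] [Algebra k A] [IsTestAlgebra k A] (s : (ι × ℕ) →₀ A),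
        (∀ i, IsNilpotent (s i)) → p A s = evalSeries P s := by
  classical
  obtain ⟨e, he⟩ := exists_injective_nat (ι × ℕ)
  let e' : ι × ℕ ↪ ℕ := ⟨e, he⟩
  have hQ : ∀ n, ∃ Q : MvPolynomial ℕ k,
      p _ (univPoint (k := k) e' n) = Ideal.Quotient.mk _ Q := fun n =>
    (Ideal.Quotient.mk_surjective _).imp fun _ h => h.symm
  choose Q hQ using hQ
  -- Each coefficient is read off at the smallest universal point that sees it; naturality along the
  -- truncation maps shows that larger bounds give the same coefficient.
  let P : MvPowerSeries (ι × ℕ) k := fun m => (Q m).coeff (m.embDomain e')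
  have hcoeff : ∀ n m, m ≤ n →
      (Q n).coeff (m.embDomain e') = (Q m).coeff (m.embDomain e') := by
    intro n m hm
    have hle := truncIdeal_anti (k := k) ((embDomain_le_iff e').2 hm)
    have := hp _ _ (Ideal.Quotient.factorₐ k hle) (univPoint e' n) (univPoint e' m)
      (kills_univPoint e' n).isNilpotent (fun i => rfl)
    rw [hQ, hQ] at this
    change _ = Ideal.Quotient.mk _ _ at this
    rw [truncMk_eq_iff] at this
    exact (this _ le_rfl).symm
  have huniv : ∀ n, p _ (univPoint (k := k) e' n) = evalSeries P (univPoint e' n) := by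
    intro n
    rw [hQ, evalSeries_univPoint, truncMk_eq_iff]
    intro M hM
    obtain ⟨m, hm, rfl⟩ := exists_embDomain_eq e' hM
    rw [hcoeff n m hm, coeff_rename_trunc e' hm]
    rfl
  refine ⟨P, fun A _ _ _ s hs => ?_⟩
  obtain ⟨n, hn⟩ := exists_kills hs
  -- Variables outside the image of `e'` are sent to 0; every nilpotent point then becomes the image
  -- of a universal one.
  have hx : ∀ j, Function.extend e' s 0 j ^ (n.embDomain e' j + 1) = 0 := by
    intro j
    by_cases hj : j ∈ Set.range e'
    · obtain ⟨i, rfl⟩ := hj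
      rw [e'.injective.extend_apply, Finsupp.embDomain_apply_self]
      exact hn i
    · rw [Function.extend_apply' _ _ _ hj]
      simp
  have hψ : ∀ i, s i = truncLift (k := k) _ hx (univPoint e' n i) := by
    intro i
    change _ = MvPolynomial.aeval _ _
    rw [MvPolynomial.aeval_X, e'.injective.extend_apply]
  rw [hp _ _ (truncLift _ hx) (univPoint e' n) s (kills_univPoint e' n).isNilpotent hψ, huniv,
    map_evalSeries _ (kills_univPoint e' n).isNilpotent hψ]

end Universal

/-! ### Formal calculus -/

section Calculus

open Polynomial

variable {k : Type u} {ι : Type w} [Field k] {A : Type u} [CommRing A] [Algebra k A]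

/-- The `A[ε]`-point `s + ε v`. -/
def dualPoint (s v : (ι × ℕ) →₀ A) : (ι × ℕ) →₀ DualNumber A :=
  s.mapRange (TrivSqZeroExt.inlHom A A) (map_zero _) +
    v.mapRange (TrivSqZeroExt.inrHom A A) (map_zero _)

theorem fst_dualPoint (s v : (ι × ℕ) →₀ A) (i : ι × ℕ) : (dualPoint s v i).fst = s i := by
  simp [dualPoint]

theorem snd_dualPoint (s v : (ι × ℕ) →₀ A) (i : ι × ℕ) : (dualPoint s v i).snd = v i := by
  simp [dualPoint]

theorem isNilpotent_dualPoint {s : (ι × ℕ) →₀ A} (hs : ∀ i, IsNilpotent (s i))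
    (v : (ι × ℕ) →₀ A) (i : ι × ℕ) : IsNilpotent (dualPoint s v i) := by
  rw [TrivSqZeroExt.isNilpotent_iff_isNilpotent_fst, fst_dualPoint]
  exact hs i

theorem fst_evalSeries_dualPoint {s : (ι × ℕ) →₀ A} (hs : ∀ i, IsNilpotent (s i))
    (v : (ι × ℕ) →₀ A) (F : MvPowerSeries (ι × ℕ) k) :
    (evalSeries F (dualPoint s v)).fst = evalSeries F s :=
  map_evalSeries (TrivSqZeroExt.fstHom k A A) (isNilpotent_dualPoint hs v)
    (fun i => (fst_dualPoint s v i).symm) F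

theorem snd_evalSeries_dualPoint {s : (ι × ℕ) →₀ A} (hs : ∀ i, IsNilpotent (s i))
    (v : (ι × ℕ) →₀ A) (F : MvPowerSeries (ι × ℕ) k) :
    (evalSeries F (dualPoint s v)).snd =
      Finsupp.linearCombination A (fun i => evalSeries (pd i.1 i.2 F) s) v :=
  chain_rule (TrivSqZeroExt.fstHom k A A) ((TrivSqZeroExt.sndHom A A).restrictScalars k)
    (fun x y => by simp [mul_comm]) (isNilpotent_dualPoint hs v)
    (fun i => (fst_dualPoint s v i).symm) (fun i => (snd_dualPoint s v i).symm) F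

/-- The point `s + y u` over the polynomials in `y`. -/
def pathPoint (s u : (ι × ℕ) →₀ A) : (ι × ℕ) →₀ A[X] :=
  s.mapRange C (map_zero _) + u.mapRange (fun a => C a * X) (by simp)

theorem isNilpotent_pathPoint {s u : (ι × ℕ) →₀ A} (hs : ∀ i, IsNilpotent (s i))
    (hu : ∀ i, IsNilpotent (u i)) (i : ι × ℕ) : IsNilpotent (pathPoint s u i) := by
  simp only [pathPoint, Finsupp.add_apply, Finsupp.mapRange_apply]
  exact (Commute.all _ _).isNilpotent_add ((hs i).map C)
    ((Commute.all _ _).isNilpotent_mul_right ((hu i).map C))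

/-- `A[X]` is not a test algebra, but evaluation and the chain rule only need nilpotent entries. -/
theorem derivative_evalSeries_pathPoint {s u : (ι × ℕ) →₀ A} (hs : ∀ i, IsNilpotent (s i))
    (hu : ∀ i, IsNilpotent (u i)) (F : MvPowerSeries (ι × ℕ) k) :
    derivative (evalSeries F (pathPoint s u)) =
      Finsupp.linearCombination A[X] (fun i => evalSeries (pd i.1 i.2 F) (pathPoint s u))
        (u.mapRange C (map_zero _)) :=
  chain_rule (AlgHom.id k A[X]) (derivative.restrictScalars k)
    (fun x y => by simp [derivative_mul]; ring) (isNilpotent_pathPoint hs hu)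
    (fun i => rfl) (fun i => by simp [pathPoint]) F

theorem eval_evalSeries_pathPoint {s u : (ι × ℕ) →₀ A} (hs : ∀ i, IsNilpotent (s i))
    (hu : ∀ i, IsNilpotent (u i)) (r : A) (F : MvPowerSeries (ι × ℕ) k) :
    (evalSeries F (pathPoint s u)).eval r = evalSeries F (s + r • u) := by
  have := map_evalSeries ((Polynomial.aeval r : A[X] →ₐ[A] A).restrictScalars k)
    (isNilpotent_pathPoint hs hu) (s' := s + r • u)
    (fun i => by simp [pathPoint, mul_comm r]) F
  rwa [AlgHom.restrictScalars_apply, Polynomial.coe_aeval_eq_eval] at this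

theorem eq_zero_of_mul_natCast_succ (k : Type u) [Field k] [CharZero k] {A : Type u} [CommRing A]
    [Algebra k A] {a : A} (n : ℕ) (h : a * ((n : A) + 1) = 0) : a = 0 := by
  have h1 : (n : k) + 1 ≠ 0 := Nat.cast_add_one_ne_zero n
  have h2 : ((n : A) + 1) * algebraMap k A ((n : k) + 1)⁻¹ = 1 := by
    rw [← map_natCast (algebraMap k A), ← map_one (algebraMap k A), ← map_add, ← map_mul,
      mul_inv_cancel₀ h1]
  rw [← mul_one a, ← h2, ← mul_assoc, h, zero_mul]

/-- A homogeneous linear differential system with zero initial value has only the zero solution. -/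
theorem eq_zero_of_derivative_mem_span (k : Type u) [Field k] [CharZero k] {A : Type u} [CommRing A]
    [Algebra k A] {J : Type*} (δ : J → A[X]) (h0 : ∀ j, (δ j).coeff 0 = 0)
    (h : ∀ j, derivative (δ j) ∈ Ideal.span (Set.range δ)) (j : J) : δ j = 0 := by
  -- If a power of `X` divides all `δ j`, it divides their derivatives too, and integration in
  -- characteristic 0 gains one more power.
  have key : ∀ n j, X ^ (n + 1) ∣ δ j := by
    intro n
    induction n with
    | zero => intro j; rw [zero_add, pow_one, X_dvd_iff]; exact h0 j
    | succ n ih =>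
      intro j
      have hle : Ideal.span (Set.range δ) ≤ Ideal.span {X ^ (n + 1)} := by
        rw [Ideal.span_le]
        rintro _ ⟨j, rfl⟩
        exact Ideal.mem_span_singleton.2 (ih j)
      have hd := X_pow_dvd_iff.1 (Ideal.mem_span_singleton.1 (hle (h j)))
      rw [X_pow_dvd_iff]
      rintro (_ | d) hdlt
      · exact h0 j
      · have := hd d (by omega)
        rw [coeff_derivative] at this
        exact eq_zero_of_mul_natCast_succ k d this
  ext n
  rw [coeff_zero]
  exact X_pow_dvd_iff.1 (key n j) n (Nat.lt_succ_self n)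

theorem pd_comm (α β : ι) (l m : ℕ) (F : MvPowerSeries (ι × ℕ) k) :
    pd α l (pd β m F) = pd β m (pd α l F) := by
  classical
  ext n
  simp only [pd, MvPowerSeries.coeff_pderiv, Finsupp.add_apply]
  by_cases h : (α, l) = (β, m)
  · rw [h]
  · rw [Finsupp.single_eq_of_ne h, Finsupp.single_eq_of_ne (Ne.symm h), add_right_comm]
    simp only [add_zero]
    ring

theorem pd_mul (α : ι) (l : ℕ) (F G : MvPowerSeries (ι × ℕ) k) :
    pd α l (F * G) = F * pd α l G + G * pd α l F := by
  simp [pd]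

theorem pd_C (α : ι) (l : ℕ) (c : k) :
    pd α l (MvPowerSeries.C c : MvPowerSeries (ι × ℕ) k) = 0 := MvPowerSeries.pderiv_C

theorem pd_add (α : ι) (l : ℕ) (F G : MvPowerSeries (ι × ℕ) k) :
    pd α l (F + G) = pd α l F + pd α l G := map_add _ _ _

theorem pd_sub (α : ι) (l : ℕ) (F G : MvPowerSeries (ι × ℕ) k) :
    pd α l (F - G) = pd α l F - pd α l G := map_sub _ _ _

theorem pd_sum {J : Type*} (t : Finset J) (α : ι) (l : ℕ) (F : J → MvPowerSeries (ι × ℕ) k) :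
    pd α l (∑ j ∈ t, F j) = ∑ j ∈ t, pd α l (F j) := map_sum _ _ _

theorem pd_tvar [DecidableEq ι] (a : (ι × ℕ) →₀ k) (α β : ι) (l m : ℕ) :
    pd α l (tvar a β m) = if (β, m) = (α, l) then 1 else 0 := by
  rw [tvar, pd_add, pd_C, zero_add, pd, MvPowerSeries.pderiv_X, Pi.single_apply]

theorem series_const [CharZero k] {F : MvPowerSeries (ι × ℕ) k} (h : ∀ α l, pd α l F = 0) :
    F = MvPowerSeries.C (MvPowerSeries.constantCoeff F) := by
  refine MvPowerSeries.pderiv.ext (fun i => ?_) (by simp)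
  rw [MvPowerSeries.pderiv_C]
  exact h i.1 i.2

theorem evalSeries_tvar (a : (ι × ℕ) →₀ k) (β : ι) (m : ℕ) {s : (ι × ℕ) →₀ A}
    (hs : ∀ i, IsNilpotent (s i)) :
    evalSeries (tvar a β m) s = algebraMap k A (a (β, m)) + s (β, m) := by
  rw [tvar, evalSeries_add hs, evalSeries_C, evalSeries_X]

theorem coeff_tvar_mul_eq_zero {a : (ι × ℕ) →₀ k} {i : ι × ℕ} {m : (ι × ℕ) →₀ ℕ}
    (ha : a i = 0) (hm : m i = 0) (F : MvPowerSeries (ι × ℕ) k) :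
    MvPowerSeries.coeff m (tvar a i.1 i.2 * F) = 0 := by
  rw [tvar, ha, map_zero, zero_add]
  exact MvPowerSeries.X_dvd_iff.1 (dvd_mul_right _ _) m hm

/-- Where `a` vanishes, the coordinate is a bare variable dividing its term, so up to the exponents
`n` only indices from two finite supports contribute. The map `e` will be the identity for DE and
`up` for SE. -/
theorem support_coeff_tvar_mul [DecidableEq ι] (a : (ι × ℕ) →₀ k) {e : ι × ℕ → ι × ℕ}
    (he : Function.Injective e) (G : ι × ℕ → MvPowerSeries (ι × ℕ) k) {m n : (ι × ℕ) →₀ ℕ}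
    (hm : m ≤ n) :
    (Function.support fun i => MvPowerSeries.coeff m (tvar a (e i).1 (e i).2 * G i)) ⊆
      ((a.support ∪ n.support).preimage e he.injOn : Finset (ι × ℕ)) := by
  intro i hi
  rw [Finset.mem_coe, Finset.mem_preimage, Finset.mem_union]
  by_contra h
  push Not at h
  refine hi (coeff_tvar_mul_eq_zero (Finsupp.notMem_support_iff.1 h.1) ?_ _)
  exact Nat.le_zero.1 ((hm _).trans_eq (Finsupp.notMem_support_iff.1 h.2))

theorem coeff_formalSum_tvar [DecidableEq ι] (a : (ι × ℕ) →₀ k) {e : ι × ℕ → ι × ℕ}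
    (he : Function.Injective e) (G : ι × ℕ → MvPowerSeries (ι × ℕ) k) {m n : (ι × ℕ) →₀ ℕ}
    (hm : m ≤ n) :
    MvPowerSeries.coeff m (formalSum fun i => tvar a (e i).1 (e i).2 * G i) =
      MvPowerSeries.coeff m (∑ i ∈ (a.support ∪ n.support).preimage e he.injOn,
        tvar a (e i).1 (e i).2 * G i) := by
  rw [map_sum]
  exact finsum_eq_sum_of_support_subset _ (support_coeff_tvar_mul a he G hm)

theorem evalSeries_formalSum_tvar (a : (ι × ℕ) →₀ k) {e : ι × ℕ → ι × ℕ}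
    (he : Function.Injective e) (G : ι × ℕ → MvPowerSeries (ι × ℕ) k) {s p : (ι × ℕ) →₀ A}
    (hs : ∀ i, IsNilpotent (s i)) (hp : ∀ i, p i = algebraMap k A (a (e i)) + s (e i)) :
    evalSeries (formalSum fun i => tvar a (e i).1 (e i).2 * G i) s =
      Finsupp.linearCombination A (fun i => evalSeries (G i) s) p := by
  classical
  obtain ⟨n, hn⟩ := exists_kills hs
  rw [evalSeries_congr hn fun m hm => coeff_formalSum_tvar a he G hm, ← evalHom_apply hs, map_sum,
    Finsupp.linearCombination_apply,
    Finsupp.sum_of_support_subset (s := (a.support ∪ n.support).preimage e he.injOn)]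
  · refine Finset.sum_congr rfl fun i _ => ?_
    rw [evalHom_apply, evalSeries_mul hs, evalSeries_tvar _ _ _ hs, hp, smul_eq_mul]
  · intro i hi
    rw [Finset.mem_preimage, Finset.mem_union]
    by_contra h
    push Not at h
    rw [Finsupp.mem_support_iff, hp, Finsupp.notMem_support_iff.1 h.1, map_zero, zero_add] at hi
    have := hn (e i)
    rw [Finsupp.notMem_support_iff.1 h.2, zero_add, pow_one] at this
    exact hi this
  · simp

theorem pd_formalSum_tvar [DecidableEq ι] (a : (ι × ℕ) →₀ k) {e : ι × ℕ → ι × ℕ}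
    (he : Function.Injective e) (G : ι × ℕ → MvPowerSeries (ι × ℕ) k) (β : ι) (l : ℕ) :
    pd β l (formalSum fun i => tvar a (e i).1 (e i).2 * G i) =
      formalSum (fun i => tvar a (e i).1 (e i).2 * pd β l (G i)) +
        formalSum (fun i => if e i = (β, l) then G i else 0) := by
  ext m
  have hm : m ≤ m + Finsupp.single (β, l) 1 := le_self_add
  rw [pd, MvPowerSeries.coeff_pderiv, coeff_formalSum_tvar a he _ le_rfl,
    ← MvPowerSeries.coeff_pderiv, map_add, coeff_formalSum_tvar a he _ hm]
  change MvPowerSeries.coeff m (pd β l _) = _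
  set T := (a.support ∪ (m + Finsupp.single (β, l) 1).support).preimage e he.injOn
  have hT : MvPowerSeries.coeff m (formalSum fun i => if e i = (β, l) then G i else 0) =
      MvPowerSeries.coeff m (∑ i ∈ T, if e i = (β, l) then G i else 0) := by
    rw [map_sum]
    refine finsum_eq_sum_of_support_subset _ fun i hi => ?_
    have : e i = (β, l) := by
      by_contra h
      exact hi (by simp [h])
    rw [Finset.mem_coe, Finset.mem_preimage, this, Finset.mem_union]
    exact Or.inr (by simp)
  rw [hT, ← map_add, ← Finset.sum_add_distrib, pd_sum]
  congr 1
  refine Finset.sum_congr rfl fun i _ => ?_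
  rw [pd_mul, pd_tvar]
  congr 1
  split_ifs <;> simp

theorem formalSum_ite_of_eq [DecidableEq ι] {e : ι × ℕ → ι × ℕ} (he : Function.Injective e)
    (G : ι × ℕ → MvPowerSeries (ι × ℕ) k) (i : ι × ℕ) :
    formalSum (fun j => if e j = e i then G j else 0) = G i := by
  ext m
  refine (finsum_eq_single _ i fun j hj => ?_).trans (by simp)
  simp [he.ne hj]

theorem formalSum_ite_of_ne [DecidableEq ι] {e : ι × ℕ → ι × ℕ}
    (G : ι × ℕ → MvPowerSeries (ι × ℕ) k) {i : ι × ℕ} (hi : ∀ j, e j ≠ i) :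
    formalSum (fun j => if e j = i then G j else 0) = 0 := by
  ext m
  simp only [hi, if_false]
  change ∑ᶠ _, _ = _
  simp

end Calculus

/-! ### Darboux coordinates on the loop space -/

section Coordinates

set_option linter.unusedSectionVars false

variable {k : Type u} {ι : Type w} [Field k] [Fintype ι] {A : Type u} [CommRing A]

theorem exists_zcoeff_eq_zero (f : Loop ι A) : ∃ N : ℕ, ∀ α, ∀ n : ℕ, N ≤ n → zcoeff (f α) n = 0 := by
  have h : ∀ α, ∃ N : ℕ, ∀ n : ℕ, N ≤ n → zcoeff (f α) n = 0 := by
    intro α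
    refine ⟨(-(f α).order).toNat + 1, fun n hn => HahnSeries.coeff_eq_zero_of_lt_order ?_⟩
    omega
  choose N hN using h
  exact ⟨Finset.univ.sup N, fun α n hn => hN α n ((Finset.le_sup (Finset.mem_univ α)).trans hn)⟩

/-- The coefficients of the nonnegative powers of `z`. -/
def pos : Loop ι A →ₗ[A] ((ι × ℕ) →₀ A) where
  toFun f := Finsupp.ofSupportFinite (fun i => zcoeff (f i.1) i.2) (by
    obtain ⟨N, hN⟩ := exists_zcoeff_eq_zero f
    refine ((Set.finite_univ (α := ι)).prod (Set.finite_lt_nat N)).subset fun i hi => ?_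
    refine ⟨Set.mem_univ _, ?_⟩
    by_contra h
    exact hi (hN i.1 i.2 (not_lt.1 h)))
  map_add' f h := by ext; rfl
  map_smul' c f := by ext; rfl

theorem pos_apply (f : Loop ι A) (i : ι × ℕ) : pos f i = zcoeff (f i.1) i.2 := rfl

variable [Algebra k A]

/-- The coefficients of the negative powers of `z`, paired with the basis by means of the Gram
matrix `g`. -/
def neg (g : Matrix ι ι k) : Loop ι A →ₗ[A] (ι × ℕ → A) where
  toFun f j := (-1) ^ (j.2 + 1) *
    ∑ β, algebraMap k A (g j.1 β) * zcoeff (f β) (-(j.2 : ℤ) - 1)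
  map_add' f h := by
    ext j
    simp [zcoeff, mul_add, Finset.sum_add_distrib]
  map_smul' c f := by
    ext j
    simp only [zcoeff, Pi.smul_apply, HahnSeries.coeff_smul, smul_eq_mul, RingHom.id_apply,
      Finset.mul_sum]
    exact Finset.sum_congr rfl fun β _ => by ring

theorem neg_apply (g : Matrix ι ι k) (f : Loop ι A) (j : ι × ℕ) :
    neg g f j = (-1) ^ (j.2 + 1) *
      ∑ β, algebraMap k A (g j.1 β) * zcoeff (f β) (-(j.2 : ℤ) - 1) := rfl

theorem neg_one_pow_mul_self (n : ℕ) : (-1 : A) ^ n * (-1) ^ n = 1 := by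
  rw [← mul_pow]; simp

variable [DecidableEq ι]

theorem sum_inv_mul {g h : Matrix ι ι k} (hg : g * h = 1) (x : ι → A) (α : ι) :
    ∑ β, algebraMap k A (g α β) * ∑ γ, algebraMap k A (h β γ) * x γ = x α := by
  simp_rw [Finset.mul_sum]
  rw [Finset.sum_comm]
  simp_rw [← mul_assoc, ← map_mul, ← Finset.sum_mul, ← map_sum, ← Matrix.mul_apply, hg,
    Matrix.one_apply]
  rw [Finset.sum_eq_single α]
  · simp
  · intro b _ hb
    simp [hb.symm]
  · simp

theorem inv_symm {g : Matrix ι ι k} (hs : g.IsSymm) (α β : ι) : g⁻¹ α β = g⁻¹ β α := by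
  conv_lhs => rw [← Matrix.transpose_apply g⁻¹, Matrix.transpose_nonsing_inv, hs.eq]

theorem zcoeff_eq_neg {g : Matrix ι ι k} (hg : IsUnit g.det) (hs : g.IsSymm) (f : Loop ι A) (β : ι)
    (n : ℕ) : zcoeff (f β) (-(n : ℤ) - 1) =
      (-1) ^ (n + 1) * ∑ α, algebraMap k A (g⁻¹ α β) * neg g f (α, n) := by
  simp_rw [neg_apply, mul_left_comm _ ((-1 : A) ^ (n + 1)), ← Finset.mul_sum, ← mul_assoc,
    neg_one_pow_mul_self, one_mul, inv_symm hs _ β]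
  exact (sum_inv_mul (Matrix.nonsing_inv_mul g hg) (fun γ => zcoeff (f γ) (-(n : ℤ) - 1)) β).symm

theorem int_cases (n : ℤ) : (∃ m : ℕ, n = m) ∨ ∃ m : ℕ, n = -(m : ℤ) - 1 := by
  rcases lt_or_ge n 0 with h | h
  · exact Or.inr ⟨(-n - 1).toNat, by omega⟩
  · exact Or.inl ⟨n.toNat, by omega⟩

/-- `pos` and `neg` serve as Darboux coordinates q and p. The Gram matrix and the signs are absorbed
into `neg`, so that Ω becomes canonical and the graph of dF becomes p = ∇F(q). -/
theorem loop_ext {g : Matrix ι ι k} (hg : IsUnit g.det) (hs : g.IsSymm) {f h : Loop ι A}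
    (h1 : pos f = pos h) (h2 : neg g f = neg g h) : f = h := by
  funext β
  ext n
  have key : ∀ n : ℤ, zcoeff (f β) n = zcoeff (h β) n := by
    intro n
    rcases int_cases n with ⟨m, rfl⟩ | ⟨m, rfl⟩
    · exact DFunLike.congr_fun h1 (β, m)
    · rw [zcoeff_eq_neg hg hs, zcoeff_eq_neg hg hs, h2]
  simpa [zcoeff] using key (-n)

/-- The loop with given coordinates. -/
def mkLoop (g : Matrix ι ι k) (p : (ι × ℕ) →₀ A) (m : ι × ℕ → A) : Loop ι A := fun β =>
  -- The exponent `n` is that of z⁻¹: a positive `n` stands for z⁻ⁿ, which is paired with the index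
  -- `n - 1`.
  HahnSeries.ofSuppBddBelow (fun n : ℤ => if 0 < n then
    (-1) ^ n.toNat * ∑ α, algebraMap k A (g⁻¹ α β) * m (α, n.toNat - 1) else p (β, (-n).toNat)) (by
      refine ⟨-(p.support.sup Prod.snd : ℕ), fun n hn => ?_⟩
      by_contra h
      have hn' : ¬ 0 < n := by omega
      rw [Function.mem_support, if_neg hn', ← Finsupp.mem_support_iff] at hn
      have : (-n).toNat ≤ p.support.sup Prod.snd := Finset.le_sup (f := Prod.snd) hn
      omega)

theorem pos_mkLoop (g : Matrix ι ι k) (p : (ι × ℕ) →₀ A) (m : ι × ℕ → A) :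
    pos (mkLoop g p m) = p := by
  ext i
  refine (if_neg (by omega)).trans ?_
  simp

theorem zcoeff_mkLoop (g : Matrix ι ι k) (p : (ι × ℕ) →₀ A) (m : ι × ℕ → A) (β : ι) (n : ℕ) :
    zcoeff (mkLoop g p m β) (-(n : ℤ) - 1) =
      (-1) ^ (n + 1) * ∑ α, algebraMap k A (g⁻¹ α β) * m (α, n) := by
  have : (-(-(n : ℤ) - 1)).toNat = n + 1 := by omega
  refine (if_pos (by omega)).trans ?_
  rw [this]
  rfl

theorem neg_mkLoop {g : Matrix ι ι k} (hg : IsUnit g.det) (hs : g.IsSymm) (p : (ι × ℕ) →₀ A)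
    (m : ι × ℕ → A) : neg g (mkLoop g p m) = m := by
  ext ⟨α, n⟩
  simp_rw [neg_apply, zcoeff_mkLoop, mul_left_comm _ ((-1 : A) ^ (n + 1)), ← Finset.mul_sum,
    ← mul_assoc, neg_one_pow_mul_self, one_mul]
  rw [Finset.sum_congr rfl fun β _ => by
    rw [Finset.sum_congr rfl fun γ _ => by rw [inv_symm hs γ β]]]
  exact sum_inv_mul (Matrix.mul_nonsing_inv g hg) (fun γ => m (γ, n)) α

/-- Multiplication of an index by `z`. -/
def up (i : ι × ℕ) : ι × ℕ := (i.1, i.2 + 1)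

theorem up_injective : Function.Injective (up : ι × ℕ → ι × ℕ) := by
  rintro ⟨α, n⟩ ⟨β, m⟩ h
  simpa [up] using h

theorem zcoeff_zmul (f : Loop ι A) (β : ι) (n : ℤ) :
    zcoeff (zmul f β) n = zcoeff (f β) (n - 1) := by
  have := HahnSeries.coeff_single_mul_add (r := (1 : A)) (x := f β) (a := -n + 1) (b := -1)
  rw [one_mul, add_neg_cancel_right] at this
  rw [zcoeff, zmul, this, zcoeff]
  congr 1
  ring

theorem pos_zmul_up (f : Loop ι A) (i : ι × ℕ) : pos (zmul f) (up i) = pos f i := by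
  rw [pos_apply, zcoeff_zmul, pos_apply]
  congr 1
  simp [up]

theorem pos_zmul_zero {g : Matrix ι ι k} (hg : IsUnit g.det) (hs : g.IsSymm) (f : Loop ι A)
    (ν : ι) : pos (zmul f) (ν, 0) = -∑ μ, algebraMap k A (g⁻¹ μ ν) * neg g f (μ, 0) := by
  have := zcoeff_eq_neg hg hs f ν 0
  rw [pos_apply, zcoeff_zmul]
  simpa using this

theorem neg_zmul (g : Matrix ι ι k) (f : Loop ι A) (j : ι × ℕ) :
    neg g (zmul f) j = -neg g f (up j) := by
  simp_rw [neg_apply, zcoeff_zmul, up]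
  rw [pow_succ _ (j.2 + 1), mul_neg_one, neg_mul, neg_neg]
  congr 1
  refine Finset.sum_congr rfl fun β _ => ?_
  congr 2
  push_cast
  ring

/-- Multiplication by z shifts q upwards, and the vacated place z⁰ is filled by the lowest
p-coordinate, with the index raised by the inverse Gram matrix. The homomorphism `ψ` is the identity
for tangent vectors and `Polynomial.C` along paths. -/
theorem linearCombination_pos_zmul {g : Matrix ι ι k} (hg : IsUnit g.det) (hs : g.IsSymm)
    (f : Loop ι A) {B : Type*} [CommRing B] (ψ : A →+* B) (c : ι × ℕ → B) :
    Finsupp.linearCombination B c ((pos (zmul f)).mapRange ψ (map_zero ψ)) =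
      Finsupp.linearCombination B (fun i => c (up i)) ((pos f).mapRange ψ (map_zero ψ)) -
      ∑ ν, (∑ μ, ψ (algebraMap k A (g⁻¹ μ ν)) * ψ (neg g f (μ, 0))) * c (ν, 0) := by
  have h : (pos (zmul f)).mapRange ψ (map_zero ψ) =
      ((pos f).mapRange ψ (map_zero ψ)).mapDomain up +
        ∑ ν, Finsupp.single (ν, 0) (ψ (pos (zmul f) (ν, 0))) := by
    ext ⟨β, n⟩
    rw [Finsupp.add_apply, Finsupp.finsetSum_apply, Finsupp.mapRange_apply]
    rcases n with _ | n
    · rw [Finsupp.mapDomain_of_notMem_range, zero_add, Finset.sum_eq_single β]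
      · simp
      · intro γ _ hγ
        simp [hγ]
      · simp
      · rintro ⟨i, hi⟩
        simp [up] at hi
    · have : ((β, n + 1) : ι × ℕ) = up (β, n) := rfl
      rw [this, Finsupp.mapDomain_apply up_injective, Finsupp.mapRange_apply, pos_zmul_up,
        Finset.sum_eq_zero, add_zero]
      intro γ _
      simp [up]
  rw [h, map_add, Finsupp.linearCombination_mapDomain, map_sum, sub_eq_add_neg,
    ← Finset.sum_neg_distrib]
  congr 1
  refine Finset.sum_congr rfl fun ν _ => ?_
  rw [Finsupp.linearCombination_single, pos_zmul_zero hg hs]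
  simp

theorem linearCombination_eq_sum_range {B : Type*} [CommRing B] (p : (ι × ℕ) →₀ B) (c : ι × ℕ → B)
    {N : ℕ} (hN : ∀ α, ∀ n, N ≤ n → p (α, n) = 0) :
    Finsupp.linearCombination B c p = ∑ α, ∑ n ∈ Finset.range N, p (α, n) * c (α, n) := by
  rw [Finsupp.linearCombination_apply,
    Finsupp.sum_of_support_subset (s := Finset.univ ×ˢ Finset.range N), Finset.sum_product]
  · rfl
  · rintro ⟨α, n⟩ h
    rw [Finset.mem_product, Finset.mem_range]
    refine ⟨Finset.mem_univ _, ?_⟩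
    by_contra h'
    exact Finsupp.mem_support_iff.1 h (hN α n (not_lt.1 h'))
  · simp

/-- This coefficient is the residue, as the variable is z⁻¹. Of two integers with sum 1 exactly one
is nonpositive, whence the two finite sums. -/
theorem coeff_one_mul {x y : A⸨X⸩} {N : ℕ} (hx : ∀ n : ℕ, N ≤ n → x.coeff (-n) = 0)
    (hy : ∀ n : ℕ, N ≤ n → y.coeff (-n) = 0) :
    (x * y).coeff 1 = ∑ n ∈ Finset.range N, x.coeff (-(n : ℤ)) * y.coeff (n + 1) +
      ∑ n ∈ Finset.range N, x.coeff (n + 1) * y.coeff (-(n : ℤ)) := by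
  rw [HahnSeries.coeff_mul, ← Finset.sum_filter_add_sum_filter_not _ (fun ij : ℤ × ℤ => ij.1 ≤ 0)]
  congr 1
  · refine Finset.sum_bij_ne_zero (fun ij _ _ => (-ij.1).toNat) ?_ ?_ ?_ ?_
    · rintro ⟨i, j⟩ h h'
      rw [Finset.mem_filter] at h
      rw [Finset.mem_range]
      by_contra hN
      have := hx _ (not_lt.1 hN)
      have hi : -((-i).toNat : ℤ) = i := by have := h.2; simp only at this; omega
      rw [hi] at this
      simp [this] at h'
    · rintro ⟨i, j⟩ h1 - ⟨i', j'⟩ h2 - h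
      simp only [Finset.mem_filter, Finset.mem_antidiagonal] at h1 h2 h
      ext <;> simp only <;> omega
    · intro n _ h'
      refine ⟨(-(n : ℤ), n + 1), ?_, h', by simp⟩
      rw [Finset.mem_filter, Finset.mem_antidiagonal]
      exact ⟨⟨left_ne_zero_of_mul h', right_ne_zero_of_mul h', by simp⟩, by simp⟩
    · rintro ⟨i, j⟩ h _
      simp only [Finset.mem_filter, Finset.mem_antidiagonal] at h
      congr 2 <;> simp only <;> omega
  · refine Finset.sum_bij_ne_zero (fun ij _ _ => (-ij.2).toNat) ?_ ?_ ?_ ?_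
    · rintro ⟨i, j⟩ h h'
      simp only [Finset.mem_filter, Finset.mem_antidiagonal] at h
      rw [Finset.mem_range]
      by_contra hN
      have := hy _ (not_lt.1 hN)
      have hi : -((-j).toNat : ℤ) = j := by omega
      rw [hi] at this
      simp [this] at h'
    · rintro ⟨i, j⟩ h1 - ⟨i', j'⟩ h2 - h
      simp only [Finset.mem_filter, Finset.mem_antidiagonal] at h1 h2 h
      ext <;> simp only <;> omega
    · intro n _ h'
      refine ⟨((n : ℤ) + 1, -(n : ℤ)), ?_, h', by simp⟩
      rw [Finset.mem_filter, Finset.mem_antidiagonal]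
      exact ⟨⟨left_ne_zero_of_mul h', right_ne_zero_of_mul h', by simp⟩, by simp⟩
    · rintro ⟨i, j⟩ h _
      simp only [Finset.mem_filter, Finset.mem_antidiagonal] at h
      congr 2 <;> simp only <;> omega

end Coordinates

/-! ### Graphs in Darboux coordinates -/

section Graphs

set_option linter.unusedSectionVars false

variable {k : Type u} {H : Type v} {ι : Type w} [Field k] [AddCommGroup H] [Module k H]
  [Fintype ι] [DecidableEq ι] {A : Type u} [CommRing A] [Algebra k A]

theorem gram_isSymm {η : LinearMap.BilinForm k H} (hsymm : η.IsSymm) (φ : Module.Basis ι k H) :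
    (gram η φ).IsSymm := by
  ext α β
  exact hsymm.eq _ _

theorem gram_isUnit_det {η : LinearMap.BilinForm k H} (hη : η.Nondegenerate)
    (φ : Module.Basis ι k H) : IsUnit (gram η φ).det := by
  rw [isUnit_iff_ne_zero]
  have h := (LinearMap.BilinForm.nondegenerate_iff_det_ne_zero φ).1 hη
  have : LinearMap.BilinForm.toMatrix φ η = gram η φ := by
    ext α β
    simp [gram, LinearMap.BilinForm.toMatrix_apply]
  rwa [this] at h

/-- The signs produced by f(-z) are those built into `neg`, and the symmetry of `η` lets both halves
use the same Gram matrix; Ω is thus canonical. -/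
theorem omega_eq {η : LinearMap.BilinForm k H} (hsymm : η.IsSymm) (φ : Module.Basis ι k H)
    (f h : Loop ι A) :
    omega η φ f h = Finsupp.linearCombination A (neg (gram η φ) f) (pos h) -
      Finsupp.linearCombination A (neg (gram η φ) h) (pos f) := by
  obtain ⟨N, hN⟩ := exists_zcoeff_eq_zero f
  obtain ⟨N', hN'⟩ := exists_zcoeff_eq_zero h
  have hf : ∀ α, ∀ n : ℕ, max N N' ≤ n → zcoeff (f α) n = 0 := fun α n hn =>
    hN α n ((le_max_left _ _).trans hn)
  have hh : ∀ α, ∀ n : ℕ, max N N' ≤ n → zcoeff (h α) n = 0 := fun α n hn =>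
    hN' α n ((le_max_right _ _).trans hn)
  generalize max N N' = K at hf hh
  have hc : ∀ α β, (negZ (f α) * h β).coeff 1 =
      ∑ n ∈ Finset.range K, (-1) ^ n * (zcoeff (f α) n * zcoeff (h β) (-(n : ℤ) - 1)) +
      ∑ n ∈ Finset.range K, (-1) ^ (n + 1) * (zcoeff (f α) (-(n : ℤ) - 1) * zcoeff (h β) n) := by
    intro α β
    rw [coeff_one_mul (N := K) (fun n hn => ?_) (hh β)]
    · congr 1
      · refine Finset.sum_congr rfl fun n _ => ?_
        change ((-(n : ℤ)).negOnePow : ℤˣ) • _ * _ = _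
        have hz : (n : ℤ) + 1 = -(-(n : ℤ) - 1) := by ring
        rw [Int.negOnePow_neg, hz, Units.smul_def, Int.coe_negOnePow_natCast]
        simp [zcoeff, mul_assoc]
      · refine Finset.sum_congr rfl fun n _ => ?_
        change (((n : ℤ) + 1).negOnePow : ℤˣ) • _ * _ = _
        have hz : (n : ℤ) + 1 = ((n + 1 : ℕ) : ℤ) := by push_cast; ring
        have hz' : -(-(n : ℤ) - 1) = ((n + 1 : ℕ) : ℤ) := by push_cast; ring
        rw [hz, zcoeff, hz', Units.smul_def, Int.coe_negOnePow_natCast]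
        simp [zcoeff, mul_assoc]
    · change _ • (f α).coeff _ = 0
      rw [show (f α).coeff (-(n : ℤ)) = 0 from hf α n hn, smul_zero]
  rw [linearCombination_eq_sum_range _ _ (fun α n hn => hh α n hn),
    linearCombination_eq_sum_range _ _ (fun α n hn => hf α n hn), omega]
  have h1 : (-(-1) : ℤ) = 1 := by norm_num
  simp only [zcoeff, h1, HahnSeries.coeff_sum, HahnSeries.coeff_smul]
  simp_rw [hc, smul_add, Finset.sum_add_distrib]
  rw [add_comm, sub_eq_add_neg]
  congr 1
  · rw [Finset.sum_comm]
    refine Finset.sum_congr rfl fun β _ => ?_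
    simp_rw [Finset.smul_sum]
    rw [Finset.sum_comm]
    refine Finset.sum_congr rfl fun n _ => ?_
    rw [neg_apply, pos_apply, Finset.mul_sum, Finset.mul_sum]
    refine Finset.sum_congr rfl fun α _ => ?_
    rw [Algebra.smul_def, gram, hsymm.eq (φ β) (φ α)]
    ring
  · rw [← Finset.sum_neg_distrib]
    refine Finset.sum_congr rfl fun α _ => ?_
    simp_rw [Finset.smul_sum]
    rw [Finset.sum_comm, ← Finset.sum_neg_distrib]
    refine Finset.sum_congr rfl fun n _ => ?_
    rw [neg_apply, pos_apply, Finset.mul_sum, Finset.mul_sum, ← Finset.sum_neg_distrib]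
    refine Finset.sum_congr rfl fun β _ => ?_
    rw [Algebra.smul_def, gram]
    ring

theorem pos_addEps (f v : Loop ι A) : pos (addEps f v) = dualPoint (pos f) (pos v) := by
  ext i <;> rfl

theorem fst_neg_addEps (g : Matrix ι ι k) (f v : Loop ι A) (j : ι × ℕ) :
    (neg g (addEps f v) j).fst = neg g f j := by
  have h : ∀ β n, (zcoeff (addEps f v β) n).fst = zcoeff (f β) n := fun β n => by
    simp [zcoeff, addEps]
  rw [neg_apply, neg_apply]
  simp [TrivSqZeroExt.fst_sum, TrivSqZeroExt.algebraMap_eq_inl', h]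

theorem snd_neg_addEps (g : Matrix ι ι k) (f v : Loop ι A) (j : ι × ℕ) :
    (neg g (addEps f v) j).snd = neg g v j := by
  have h : ∀ β n, (zcoeff (addEps f v β) n).snd = zcoeff (v β) n := fun β n => by
    simp [zcoeff, addEps]
  have hc : ∀ (c : k) (x : DualNumber A),
      (algebraMap k (DualNumber A) c * x).snd = algebraMap k A c * x.snd := fun c x => by
    rw [← Algebra.smul_def, TrivSqZeroExt.snd_smul, Algebra.smul_def]
  have hp : ((-1 : DualNumber A) ^ (j.2 + 1)) = algebraMap k (DualNumber A) ((-1) ^ (j.2 + 1)) := by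
    simp
  rw [neg_apply, neg_apply, hp, hc]
  simp only [map_pow, map_neg, map_one, TrivSqZeroExt.snd_sum, hc, h]

/-- The base point of the graph over a neighbourhood of `t = a`, after the dilaton shift. -/
def base (o : ι) (a : (ι × ℕ) →₀ k) : (ι × ℕ) →₀ k := a - Finsupp.single (o, 1) 1

/-- Extension of scalars for points of `H[z]`. -/
def ext (A : Type u) [CommRing A] [Algebra k A] (a : (ι × ℕ) →₀ k) : (ι × ℕ) →₀ A :=
  a.mapRange (algebraMap k A) (map_zero _)

theorem ext_apply (a : (ι × ℕ) →₀ k) (i : ι × ℕ) : ext A a i = algebraMap k A (a i) := rfl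

theorem algebraMap_base (o : ι) (a : (ι × ℕ) →₀ k) (i : ι × ℕ) :
    algebraMap k A (base o a i) = algebraMap k A (a i) - if i = (o, 1) then 1 else 0 := by
  rw [base, Finsupp.sub_apply, map_sub, Finsupp.single_apply]
  congr 1
  simp_rw [eq_comm (a := i)]
  split_ifs <;> simp

/-- The gradient of a formal function at a nilpotent point. -/
def grad (F : MvPowerSeries (ι × ℕ) k) (s : (ι × ℕ) →₀ A) (j : ι × ℕ) : A :=
  evalSeries (pd j.1 j.2 F) s

/-- The Hessian of a formal function at a nilpotent point. -/
def hess (F : MvPowerSeries (ι × ℕ) k) (s : (ι × ℕ) →₀ A) (i j : ι × ℕ) : A :=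
  evalSeries (pd i.1 i.2 (pd j.1 j.2 F)) s

theorem hess_comm (F : MvPowerSeries (ι × ℕ) k) (s : (ι × ℕ) →₀ A) (i j : ι × ℕ) :
    hess F s i j = hess F s j i := by
  rw [hess, pd_comm]
  rfl

variable {η : LinearMap.BilinForm k H} (hsymm : η.IsSymm) (hη : η.Nondegenerate)
  (φ : Module.Basis ι k H) (o : ι) (a : (ι × ℕ) →₀ k) (F : MvPowerSeries (ι × ℕ) k)

include hsymm hη

theorem mem_graph [IsTestAlgebra k A] {f : Loop ι A} : f ∈ graph η φ o a F A ↔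
    ∃ s : (ι × ℕ) →₀ A, (∀ i, IsNilpotent (s i)) ∧ pos f = ext A (base o a) + s ∧
      neg (gram η φ) f = grad F s := by
  have hg := gram_isUnit_det hη φ
  have hs := gram_isSymm hsymm φ
  refine exists_congr fun s => and_congr_right fun _ => and_congr ?_ ?_
  · refine ⟨fun h => ?_, fun h β n => ?_⟩
    · ext ⟨β, n⟩
      rw [pos_apply, Finsupp.add_apply, ext_apply, algebraMap_base, h]
      ring
    · have := DFunLike.congr_fun h (β, n)
      rw [pos_apply, Finsupp.add_apply, ext_apply, algebraMap_base] at this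
      rw [this]
      ring
  · refine ⟨fun h => ?_, fun h β n => ?_⟩
    · have : neg (gram η φ) f = neg (gram η φ) (mkLoop (gram η φ) (pos f) (grad F s)) := by
        ext j
        simp_rw [neg_apply, h, zcoeff_mkLoop]
        rfl
      rw [this, neg_mkLoop hg hs]
    · rw [zcoeff_eq_neg hg hs, h]
      rfl

/-- The point of the graph over a nilpotent point. -/
theorem mkLoop_mem_graph [IsTestAlgebra k A] {s : (ι × ℕ) →₀ A} (h : ∀ i, IsNilpotent (s i)) :
    mkLoop (gram η φ) (ext A (base o a) + s) (grad F s) ∈ graph η φ o a F A :=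
  (mem_graph hsymm hη φ o a F).2 ⟨s, h, pos_mkLoop _ _ _,
    neg_mkLoop (gram_isUnit_det hη φ) (gram_isSymm hsymm φ) _ _⟩

/-- The q-part of f + εv forces the parameter to be s + ε·`pos v`. The ε-coefficient of p = ∇F(q) is
then the Hessian equation. -/
theorem mem_tangent_graph [IsTestAlgebra k A] {f v : Loop ι A} {s : (ι × ℕ) →₀ A}
    (hs : ∀ i, IsNilpotent (s i)) (hpos : pos f = ext A (base o a) + s)
    (hneg : neg (gram η φ) f = grad F s) :
    v ∈ tangent (graph η φ o a F) f ↔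
      ∀ j, neg (gram η φ) v j = Finsupp.linearCombination A (fun i => hess F s i j) (pos v) := by
  have hbase : ∀ t : (ι × ℕ) →₀ DualNumber A,
      pos (addEps f v) = ext (DualNumber A) (base o a) + t ↔ t = dualPoint s (pos v) := by
    intro t
    have : dualPoint (pos f) (pos v) = ext (DualNumber A) (base o a) + dualPoint s (pos v) := by
      rw [hpos]
      ext i
      · simp [fst_dualPoint, ext_apply, TrivSqZeroExt.algebraMap_eq_inl']
      · simp [snd_dualPoint, ext_apply, TrivSqZeroExt.algebraMap_eq_inl']
    rw [pos_addEps, this, add_right_inj, eq_comm]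
  change addEps f v ∈ graph η φ o a F (DualNumber A) ↔ _
  rw [mem_graph hsymm hη]
  simp_rw [hbase]
  have hn := isNilpotent_dualPoint hs (pos v)
  have : (∃ t : (ι × ℕ) →₀ DualNumber A, (∀ i, IsNilpotent (t i)) ∧ t = dualPoint s (pos v) ∧
      neg (gram η φ) (addEps f v) = grad F t) ↔
      neg (gram η φ) (addEps f v) = grad F (dualPoint s (pos v)) :=
    ⟨fun ⟨_, _, h, h'⟩ => h ▸ h', fun h => ⟨_, hn, rfl, h⟩⟩
  rw [this]
  refine ⟨fun h j => ?_, fun h => ?_⟩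
  · have := congrArg TrivSqZeroExt.snd (congrFun h j)
    rw [snd_neg_addEps, grad, snd_evalSeries_dualPoint hs] at this
    exact this
  · ext j
    · rw [fst_neg_addEps, hneg, grad, grad, fst_evalSeries_dualPoint hs]
    · rw [snd_neg_addEps, grad, snd_evalSeries_dualPoint hs, h]
      rfl

theorem isNear_iff {f₀ : Loop ι k} {f : Loop ι A} : IsNear f₀ f ↔
    (∀ i, IsNilpotent (pos f i - algebraMap k A (pos f₀ i))) ∧
      ∀ j, IsNilpotent (neg (gram η φ) f j - algebraMap k A (neg (gram η φ) f₀ j)) := by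
  have hg := gram_isUnit_det hη φ
  have hs := gram_isSymm hsymm φ
  have hsum : ∀ (c : A) (d : ι → A) (x y : ι → A), (∀ β, IsNilpotent (x β - y β)) →
      IsNilpotent (c * ∑ β, d β * x β - c * ∑ β, d β * y β) := by
    intro c d x y h
    rw [← mul_sub, ← Finset.sum_sub_distrib]
    refine (Commute.all _ _).isNilpotent_mul_left (isNilpotent_sum fun β _ => ?_)
    rw [← mul_sub]
    exact (Commute.all _ _).isNilpotent_mul_left (h β)
  constructor
  · intro h
    refine ⟨fun i => h i.1 _, fun j => ?_⟩
    have : algebraMap k A (neg (gram η φ) f₀ j) = (-1) ^ (j.2 + 1) *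
        ∑ β, algebraMap k A (gram η φ j.1 β) * algebraMap k A (zcoeff (f₀ β) (-(j.2 : ℤ) - 1)) := by
      rw [neg_apply]
      simp
    rw [this, neg_apply]
    exact hsum _ _ _ _ fun β => h β _
  · rintro ⟨h1, h2⟩ β n
    have key : ∀ n : ℤ, IsNilpotent (zcoeff (f β) n - algebraMap k A (zcoeff (f₀ β) n)) := by
      intro n
      rcases int_cases n with ⟨m, rfl⟩ | ⟨m, rfl⟩
      · exact h1 (β, m)
      · have : algebraMap k A (zcoeff (f₀ β) (-(m : ℤ) - 1)) = (-1) ^ (m + 1) *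
            ∑ α, algebraMap k A ((gram η φ)⁻¹ α β) *
              algebraMap k A (neg (gram η φ) f₀ (α, m)) := by
          rw [zcoeff_eq_neg hg hs]
          simp
        rw [this, zcoeff_eq_neg hg hs]
        exact hsum _ _ _ _ fun α => h2 (α, m)
    simpa [zcoeff] using key (-n)

-- Modulo the nilradical the point `s` becomes 0.
omit hsymm hη in
theorem isNilpotent_evalSeries_sub {s : (ι × ℕ) →₀ A} (hs : ∀ i, IsNilpotent (s i)) :
    IsNilpotent (evalSeries F s - algebraMap k A (MvPowerSeries.constantCoeff F)) := by
  have h := map_evalSeries (Ideal.Quotient.mkₐ k (nilradical A)) hs (s' := 0)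
    (fun i => ((Ideal.Quotient.eq_zero_iff_mem).2 (mem_nilradical.2 (hs i))).symm) F
  rw [evalSeries_zero_point, ← AlgHom.commutes (Ideal.Quotient.mkₐ k (nilradical A)), ← sub_eq_zero,
    ← map_sub] at h
  exact mem_nilradical.1 (Ideal.Quotient.eq_zero_iff_mem.1 h)

end Graphs

/-! ### The infinitesimal form of the system DE + SE + TRR -/

section Equations

set_option linter.unusedSectionVars false

variable {k : Type u} {H : Type v} {ι : Type w} [Field k] [AddCommGroup H] [Module k H]
  [Fintype ι] [DecidableEq ι] {A : Type u} [CommRing A] [Algebra k A]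

/-- Division of a point of `H[z]` by `z`, without the polar term. -/
def down (p : (ι × ℕ) →₀ A) : (ι × ℕ) →₀ A := p.comapDomain up up_injective.injOn

theorem down_apply (p : (ι × ℕ) →₀ A) (i : ι × ℕ) : down p i = p (up i) := rfl

theorem linearCombination_eq_down (c : ι × ℕ → A) (p : (ι × ℕ) →₀ A) :
    Finsupp.linearCombination A c p =
      Finsupp.linearCombination A (fun i => c (up i)) (down p) + ∑ α, p (α, 0) * c (α, 0) := by
  have h : p = (down p).mapDomain up + ∑ α, Finsupp.single (α, 0) (p (α, 0)) := by
    ext ⟨β, n⟩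
    rw [Finsupp.add_apply, Finsupp.finsetSum_apply]
    rcases n with _ | n
    · rw [Finsupp.mapDomain_of_notMem_range, zero_add, Finset.sum_eq_single β]
      · simp
      · intro γ _ hγ
        simp [hγ]
      · simp
      · rintro ⟨i, hi⟩
        simp [up] at hi
    · have : ((β, n + 1) : ι × ℕ) = up (β, n) := rfl
      rw [this, Finsupp.mapDomain_apply up_injective, down_apply, Finset.sum_eq_zero, add_zero]
      intro γ _
      simp [up]
  conv_lhs => rw [h]
  rw [map_add, Finsupp.linearCombination_mapDomain, map_sum]
  simp_rw [Finsupp.linearCombination_single, smul_eq_mul]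
  rfl

theorem linearCombination_comm (h : ι × ℕ → ι × ℕ → A) (p q : (ι × ℕ) →₀ A) :
    Finsupp.linearCombination A (fun j => Finsupp.linearCombination A (fun i => h i j) q) p =
      Finsupp.linearCombination A (fun i => Finsupp.linearCombination A (fun j => h i j) p) q := by
  simp only [Finsupp.linearCombination_apply, Finsupp.sum, smul_eq_mul, Finset.mul_sum]
  rw [Finset.sum_comm]
  exact Finset.sum_congr rfl fun i _ => Finset.sum_congr rfl fun j _ => by ring

/-- The third derivatives of a formal function at a nilpotent point. -/
def third (F : MvPowerSeries (ι × ℕ) k) (s : (ι × ℕ) →₀ A) (i j l : ι × ℕ) : A :=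
  evalSeries (pd i.1 i.2 (pd j.1 j.2 (pd l.1 l.2 F))) s

variable (η : LinearMap.BilinForm k H) (φ : Module.Basis ι k H) (o : ι) (a : (ι × ℕ) →₀ k)
  (F : MvPowerSeries (ι × ℕ) k)

/-- The differential of the equation DE, that of SE, and TRR, at all nilpotent points. -/
structure IsInfGenerating : Prop where
  euler : ∀ (A : Type u) [CommRing A] [Algebra k A] [IsTestAlgebra k A] (s : (ι × ℕ) →₀ A),
    (∀ i, IsNilpotent (s i)) → ∀ j, grad F s j =
      Finsupp.linearCombination A (fun i => hess F s i j) (ext A (base o a) + s)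
  string_zero : ∀ (A : Type u) [CommRing A] [Algebra k A] [IsTestAlgebra k A] (s : (ι × ℕ) →₀ A),
    (∀ i, IsNilpotent (s i)) → ∀ α,
      Finsupp.linearCombination A (fun i => hess F s i (α, 0)) (down (ext A (base o a) + s)) =
        -∑ β, algebraMap k A (gram η φ α β) * (ext A (base o a) + s) (β, 0)
  string_up : ∀ (A : Type u) [CommRing A] [Algebra k A] [IsTestAlgebra k A] (s : (ι × ℕ) →₀ A),
    (∀ i, IsNilpotent (s i)) → ∀ j,
      Finsupp.linearCombination A (fun i => hess F s i (up j)) (down (ext A (base o a) + s)) =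
        -grad F s j
  trr : ∀ (A : Type u) [CommRing A] [Algebra k A] [IsTestAlgebra k A] (s : (ι × ℕ) →₀ A),
    (∀ i, IsNilpotent (s i)) → ∀ i j l, third F s (up i) j l =
      ∑ μ, ∑ ν, hess F s i (μ, 0) * algebraMap k A ((gram η φ)⁻¹ μ ν) * third F s (ν, 0) j l

/-- The defect of the dilaton equation. -/
def dilatonDefect : MvPowerSeries (ι × ℕ) k :=
  formalSum (fun i => tvar (base o a) i.1 i.2 * pd i.1 i.2 F) - 2 * F

/-- The defect of the string equation. -/
def stringDefect : MvPowerSeries (ι × ℕ) k :=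
  MvPowerSeries.C (1 / 2 : k) * (∑ α, ∑ β,
      MvPowerSeries.C (gram η φ α β) * tvar (base o a) α 0 * tvar (base o a) β 0) +
    formalSum (fun i => tvar (base o a) (up i).1 (up i).2 * pd i.1 i.2 F)

/-- The dilaton shift from t to q. For `e` the identity or `up`, the extra sum has a single term,
∂_{1,1}F or ∂_{1,0}F. It cancels the left side of DE or SE, leaving Σ qₙ∂ₙF = 2F and ½(q₀,q₀) + Σ
qₙ₊₁∂ₙF = 0. -/
theorem formalSum_tvar_base {e : ι × ℕ → ι × ℕ} (he : Function.Injective e)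
    (G : ι × ℕ → MvPowerSeries (ι × ℕ) k) :
    formalSum (fun i => tvar a (e i).1 (e i).2 * G i) =
      formalSum (fun i => tvar (base o a) (e i).1 (e i).2 * G i) +
        formalSum (fun i => if e i = (o, 1) then G i else 0) := by
  have h : ∀ i, tvar a (e i).1 (e i).2 * G i =
      tvar (base o a) (e i).1 (e i).2 * G i + if e i = (o, 1) then G i else 0 := by
    intro i
    have := algebraMap_base (A := k) o a (e i)
    simp only [Algebra.algebraMap_self, RingHom.id_apply] at this
    simp only [tvar, Prod.mk.eta, this, map_sub]
    split_ifs
    · simp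
      ring
    · simp
  ext m
  rw [map_add]
  change ∑ᶠ i, MvPowerSeries.coeff m (tvar a (e i).1 (e i).2 * G i) = ∑ᶠ i, _ + ∑ᶠ i, _
  rw [← finsum_add_distrib]
  · simp_rw [h, map_add]
  · exact (Finset.finite_toSet _).subset (support_coeff_tvar_mul (base o a) he G le_rfl)
  · refine ((Set.finite_singleton (o, 1)).preimage he.injOn).subset fun i hi => ?_
    by_contra h'
    exact hi (by simp [show e i ≠ (o, 1) from h'])

theorem isGenerating_iff : IsGenerating η φ o a F ↔ dilatonDefect o a F = 0 ∧
    stringDefect η φ o a F = 0 ∧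
    ∀ (α β γ : ι) (l m n : ℕ), pd α (l + 1) (pd β m (pd γ n F)) =
      ∑ μ, ∑ ν, pd α l (pd μ 0 F) * MvPowerSeries.C ((gram η φ)⁻¹ μ ν) *
        pd ν 0 (pd β m (pd γ n F)) := by
  have hid : formalSum (fun i => tvar a i.1 i.2 * pd i.1 i.2 F) =
      formalSum (fun i => tvar (base o a) i.1 i.2 * pd i.1 i.2 F) + pd o 1 F := by
    refine (formalSum_tvar_base o a Function.injective_id (fun i => pd i.1 i.2 F)).trans ?_
    congr 1
    exact formalSum_ite_of_eq Function.injective_id (fun i => pd i.1 i.2 F) (o, 1)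
  have hup : formalSum (fun i => tvar a i.1 (i.2 + 1) * pd i.1 i.2 F) =
      formalSum (fun i => tvar (base o a) i.1 (i.2 + 1) * pd i.1 i.2 F) + pd o 0 F := by
    refine (formalSum_tvar_base o a up_injective (fun i => pd i.1 i.2 F)).trans ?_
    congr 1
    exact formalSum_ite_of_eq up_injective (fun i => pd i.1 i.2 F) (o, 0)
  have hzero : ∀ α, tvar a α 0 = tvar (base o a) α 0 := by
    intro α
    simp [tvar, base]
  have hd : dilatonDefect o a F = 0 ↔
      pd o 1 F = formalSum (fun i => tvar a i.1 i.2 * pd i.1 i.2 F) - 2 * F := by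
    rw [hid, dilatonDefect]
    constructor <;> intro h <;> linear_combination (exp := 1) -h
  have hs : stringDefect η φ o a F = 0 ↔ pd o 0 F =
      MvPowerSeries.C (1 / 2 : k) *
        (∑ α, ∑ β, MvPowerSeries.C (gram η φ α β) * tvar a α 0 * tvar a β 0)
      + formalSum (fun i => tvar a i.1 (i.2 + 1) * pd i.1 i.2 F) := by
    simp_rw [hzero]
    rw [hup, stringDefect]
    change _ + formalSum (fun i => tvar (base o a) i.1 (i.2 + 1) * pd i.1 i.2 F) = 0 ↔ _
    constructor <;> intro h <;> linear_combination (exp := 1) -h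
  rw [hd, hs]
  exact ⟨fun h => ⟨h.1, h.2, h.3⟩, fun h => ⟨h.1, h.2.1, h.2.2⟩⟩

theorem pd_dilatonDefect (β : ι) (l : ℕ) : pd β l (dilatonDefect o a F) =
    formalSum (fun i => tvar (base o a) i.1 i.2 * pd β l (pd i.1 i.2 F)) - pd β l F := by
  have h2 : pd β l (2 * F) = 2 * pd β l F := by rw [two_mul, pd_add, two_mul]
  have h3 := pd_formalSum_tvar (base o a) Function.injective_id (fun i => pd i.1 i.2 F) β l
  have h4 := formalSum_ite_of_eq Function.injective_id (fun i => pd i.1 i.2 F) (β, l)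
  simp only [id_eq] at h3 h4
  rw [dilatonDefect, pd_sub, h2, h3, h4]
  ring

theorem pd_up_stringDefect (j : ι × ℕ) : pd (up j).1 (up j).2 (stringDefect η φ o a F) =
    formalSum (fun i => tvar (base o a) (up i).1 (up i).2 * pd (up j).1 (up j).2 (pd i.1 i.2 F)) +
      pd j.1 j.2 F := by
  have hz : ∀ α, pd (up j).1 (up j).2 (tvar (base o a) α 0) = 0 := fun α => by
    rw [pd_tvar, if_neg (by simp [up])]
  rw [stringDefect, pd_add, pd_formalSum_tvar (base o a) up_injective (fun i => pd i.1 i.2 F)]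
  simp_rw [pd_mul, pd_sum, pd_mul, pd_C, hz]
  simp only [mul_zero, Finset.sum_const_zero, add_zero, zero_add]
  congr 1
  exact formalSum_ite_of_eq up_injective (fun i => pd i.1 i.2 F) j

theorem pd_zero_stringDefect [CharZero k] (hg : (gram η φ).IsSymm) (γ : ι) :
    pd γ 0 (stringDefect η φ o a F) =
      ∑ β, MvPowerSeries.C (gram η φ γ β) * tvar (base o a) β 0 +
      formalSum (fun i => tvar (base o a) (up i).1 (up i).2 * pd γ 0 (pd i.1 i.2 F)) := by
  rw [stringDefect, pd_add, pd_formalSum_tvar (base o a) up_injective (fun i => pd i.1 i.2 F),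
    formalSum_ite_of_ne, add_zero]
  swap
  · intro j
    simp [up]
  congr 1
  simp_rw [pd_mul, pd_sum, pd_mul, pd_C, pd_tvar]
  simp only [mul_zero, add_zero, Prod.mk.injEq, and_true, Finset.sum_add_distrib, mul_ite, mul_one,
    Finset.sum_ite_eq', Finset.mem_univ, if_true]
  have h1 : ∑ α, ∑ β, (if α = γ then tvar (base o a) β 0 * MvPowerSeries.C (gram η φ α β) else 0) =
      ∑ β, MvPowerSeries.C (gram η φ γ β) * tvar (base o a) β 0 := by
    rw [Finset.sum_eq_single γ]
    · simp [mul_comm]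
    · intro b _ hb
      simp [hb]
    · simp
  have h2 : ∑ α, MvPowerSeries.C (gram η φ α γ) * tvar (base o a) α 0 =
      ∑ β, MvPowerSeries.C (gram η φ γ β) * tvar (base o a) β 0 :=
    Finset.sum_congr rfl fun α _ => by rw [hg.apply γ α]
  rw [h1, h2, ← two_mul, ← mul_assoc]
  have h3 : (MvPowerSeries.C (1 / 2 : k) : MvPowerSeries (ι × ℕ) k) * 2 = 1 := by
    have : (2 : MvPowerSeries (ι × ℕ) k) = MvPowerSeries.C (2 : k) := (map_ofNat _ 2).symm
    rw [this, ← map_mul]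
    norm_num
  rw [h3, one_mul]

variable {s : (ι × ℕ) →₀ A} (hs : ∀ i, IsNilpotent (s i))

include hs

theorem evalSeries_pd_dilatonDefect (j : ι × ℕ) :
    evalSeries (pd j.1 j.2 (dilatonDefect o a F)) s =
      Finsupp.linearCombination A (fun i => hess F s i j) (ext A (base o a) + s) - grad F s j := by
  have h := evalSeries_formalSum_tvar (base o a) Function.injective_id
    (fun i => pd j.1 j.2 (pd i.1 i.2 F)) hs (p := ext A (base o a) + s) (fun i => rfl)
  simp only [id_eq] at h
  rw [pd_dilatonDefect, ← evalHom_apply hs, map_sub, evalHom_apply, evalHom_apply, h]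
  simp_rw [hess_comm F s _ j]
  rfl

theorem evalSeries_pd_up_stringDefect (j : ι × ℕ) :
    evalSeries (pd (up j).1 (up j).2 (stringDefect η φ o a F)) s =
      Finsupp.linearCombination A (fun i => hess F s i (up j)) (down (ext A (base o a) + s)) +
        grad F s j := by
  rw [pd_up_stringDefect, evalSeries_add hs,
    evalSeries_formalSum_tvar (base o a) up_injective
      (fun i => pd (up j).1 (up j).2 (pd i.1 i.2 F)) hs (p := down (ext A (base o a) + s))
      (fun i => rfl)]
  simp_rw [hess_comm F s _ (up j)]
  rfl

theorem evalSeries_pd_zero_stringDefect [CharZero k] (hg : (gram η φ).IsSymm) (γ : ι) :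
    evalSeries (pd γ 0 (stringDefect η φ o a F)) s =
      ∑ β, algebraMap k A (gram η φ γ β) * (ext A (base o a) + s) (β, 0) +
      Finsupp.linearCombination A (fun i => hess F s i (γ, 0)) (down (ext A (base o a) + s)) := by
  rw [pd_zero_stringDefect _ _ _ _ _ hg, evalSeries_add hs,
    evalSeries_formalSum_tvar (base o a) up_injective
      (fun i => pd γ 0 (pd i.1 i.2 F)) hs (p := down (ext A (base o a) + s))
      (fun i => rfl), ← evalHom_apply hs, map_sum]
  simp_rw [map_mul, evalHom_apply, evalSeries_C, evalSeries_tvar _ _ _ hs, hess_comm F s _ (γ, 0)]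
  rfl

theorem evalSeries_trr (i j l : ι × ℕ) :
    evalSeries (∑ μ, ∑ ν, pd i.1 i.2 (pd μ 0 F) * MvPowerSeries.C ((gram η φ)⁻¹ μ ν) *
        pd ν 0 (pd j.1 j.2 (pd l.1 l.2 F))) s =
      ∑ μ, ∑ ν, hess F s i (μ, 0) * algebraMap k A ((gram η φ)⁻¹ μ ν) * third F s (ν, 0) j l := by
  rw [← evalHom_apply hs]
  simp_rw [map_sum, map_mul, evalHom_apply, evalSeries_C]
  rfl

omit hs

theorem evalSeries_zero_series (s : (ι × ℕ) →₀ A) :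
    evalSeries (0 : MvPowerSeries (ι × ℕ) k) s = 0 := by
  rw [← map_zero MvPowerSeries.C, evalSeries_C, map_zero]

variable {η φ o a F}

theorem IsGenerating.isInfGenerating [CharZero k] (hg : (gram η φ).IsSymm)
    (h : IsGenerating η φ o a F) : IsInfGenerating η φ o a F := by
  obtain ⟨h1, h2, h3⟩ := (isGenerating_iff η φ o a F).1 h
  have pd_zero : ∀ β l, pd β l (0 : MvPowerSeries (ι × ℕ) k) = 0 := fun β l => map_zero _
  refine ⟨?_, ?_, ?_, ?_⟩
  · intro A _ _ _ s hs j
    have := evalSeries_pd_dilatonDefect o a F hs j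
    rw [h1, pd_zero, evalSeries_zero_series] at this
    exact (sub_eq_zero.1 this.symm).symm
  · intro A _ _ _ s hs α
    have := evalSeries_pd_zero_stringDefect η φ o a F hs hg α
    rw [h2, pd_zero, evalSeries_zero_series] at this
    exact (neg_eq_of_add_eq_zero_right this.symm).symm
  · intro A _ _ _ s hs j
    have := evalSeries_pd_up_stringDefect η φ o a F hs j
    rw [h2, pd_zero, evalSeries_zero_series] at this
    exact (neg_eq_of_add_eq_zero_left this.symm).symm
  · intro A _ _ _ s hs i j l
    rw [← evalSeries_trr η φ F hs, ← h3]
    rfl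

/-- The quadratic relation between the second derivatives. -/
theorem IsGenerating.hess_up [CharZero k] (hg : (gram η φ).IsSymm) (h : IsGenerating η φ o a F)
    [IsTestAlgebra k A] {s : (ι × ℕ) →₀ A} (hs : ∀ i, IsNilpotent (s i)) (i j : ι × ℕ) :
    hess F s i (up j) + hess F s (up i) j =
      ∑ μ, ∑ ν, hess F s i (μ, 0) * algebraMap k A ((gram η φ)⁻¹ μ ν) * hess F s (ν, 0) j := by
  obtain ⟨h1, h2, h3⟩ := (isGenerating_iff η φ o a F).1 h
  have hF := h.isInfGenerating hg
  have pd_zero : ∀ β l, pd β l (0 : MvPowerSeries (ι × ℕ) k) = 0 := fun β l => map_zero _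
  -- SE is differentiated along `up j`, and then along `up i` (`hup`) or along `(ν, 0)` (`hzero`).
  -- TRR expresses the third derivatives in the first result through those in the second;
  -- eliminating them leaves the quadratic relation.
  have h4 := pd_up_stringDefect η φ o a F j
  rw [h2, pd_zero] at h4
  have hup : Finsupp.linearCombination A (fun l => third F s (up i) (up j) l)
      (down (ext A (base o a) + s)) + hess F s (up j) i + hess F s (up i) j = 0 := by
    have h5 := congrArg (fun G => evalSeries (pd (up i).1 (up i).2 G) s) h4
    simp only [pd_zero, evalSeries_zero_series, pd_add] at h5
    rw [pd_formalSum_tvar (base o a) up_injective (fun l => pd (up j).1 (up j).2 (pd l.1 l.2 F)),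
      evalSeries_add hs, evalSeries_add hs, evalSeries_formalSum_tvar (base o a) up_injective
      (fun l => pd (up i).1 (up i).2 (pd (up j).1 (up j).2 (pd l.1 l.2 F))) hs
      (p := down (ext A (base o a) + s)) (fun i => rfl)] at h5
    have h6 := formalSum_ite_of_eq up_injective (fun l => pd (up j).1 (up j).2 (pd l.1 l.2 F)) i
    rw [show ((up i).1, (up i).2) = up i from rfl, h6] at h5
    exact h5.symm
  have hzero : ∀ ν, Finsupp.linearCombination A (fun l => third F s (ν, 0) (up j) l)
      (down (ext A (base o a) + s)) + hess F s (ν, 0) j = 0 := by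
    intro ν
    have h5 := congrArg (fun G => evalSeries (pd ν 0 G) s) h4
    simp only [pd_zero, evalSeries_zero_series, pd_add] at h5
    rw [pd_formalSum_tvar (base o a) up_injective (fun l => pd (up j).1 (up j).2 (pd l.1 l.2 F)),
      formalSum_ite_of_ne _ (fun i => by simp [up]), add_zero, evalSeries_add hs,
      evalSeries_formalSum_tvar (base o a) up_injective
      (fun l => pd ν 0 (pd (up j).1 (up j).2 (pd l.1 l.2 F))) hs
      (p := down (ext A (base o a) + s)) (fun i => rfl)] at h5
    exact h5.symm
  have hlc : Finsupp.linearCombination A (fun l => third F s (up i) (up j) l)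
      (down (ext A (base o a) + s)) =
      ∑ μ, ∑ ν, hess F s i (μ, 0) * algebraMap k A ((gram η φ)⁻¹ μ ν) *
        Finsupp.linearCombination A (fun l => third F s (ν, 0) (up j) l)
          (down (ext A (base o a) + s)) := by
    simp only [Finsupp.linearCombination_apply, Finsupp.sum, smul_eq_mul, Finset.mul_sum,
      hF.trr A s hs]
    rw [Finset.sum_comm]
    refine Finset.sum_congr rfl fun μ _ => ?_
    rw [Finset.sum_comm]
    refine Finset.sum_congr rfl fun ν _ => Finset.sum_congr rfl fun l _ => by ring
  rw [hlc] at hup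
  have hsub : ∑ μ, ∑ ν, hess F s i (μ, 0) * algebraMap k A ((gram η φ)⁻¹ μ ν) *
        Finsupp.linearCombination A (fun l => third F s (ν, 0) (up j) l)
          (down (ext A (base o a) + s)) = -
      ∑ μ, ∑ ν, hess F s i (μ, 0) * algebraMap k A ((gram η φ)⁻¹ μ ν) * hess F s (ν, 0) j := by
    simp_rw [← Finset.sum_neg_distrib]
    refine Finset.sum_congr rfl fun μ _ => Finset.sum_congr rfl fun ν _ => ?_
    linear_combination (hess F s i (μ, 0) * algebraMap k A ((gram η φ)⁻¹ μ ν)) * hzero ν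
  rw [hsub] at hup
  rw [hess_comm F s i (up j)]
  linear_combination hup

/-- Over base point 0, the differentiated string equation at εφ_β reads 0 = -ε g_αβ, since εφ_β has
no positive power of z. The Gram matrix would vanish, although `ι` is nonempty. -/
theorem IsInfGenerating.base_ne_zero (hdet : IsUnit (gram η φ).det)
    (h : IsInfGenerating η φ o a F) : base o a ≠ 0 := by
  intro hb
  have hzero : gram η φ = 0 := by
    ext α β
    have hs := isNilpotent_dualPoint (A := k) (s := 0) (fun i => by simp)
      (Finsupp.single ((β, 0) : ι × ℕ) 1)
    have := h.string_zero _ _ hs α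
    rw [hb] at this
    have hd : down (ext (DualNumber k) (0 : (ι × ℕ) →₀ k) +
        dualPoint (0 : (ι × ℕ) →₀ k) (Finsupp.single ((β, 0) : ι × ℕ) 1)) = 0 := by
      ext i
      · simp [down_apply, ext_apply, fst_dualPoint]
      · simp [down_apply, ext_apply, snd_dualPoint, up]
    rw [hd, map_zero, eq_comm, neg_eq_zero] at this
    have h2 := congrArg TrivSqZeroExt.snd this
    simp only [TrivSqZeroExt.snd_sum, Finsupp.add_apply, ext_apply, Finsupp.coe_zero,
      Pi.zero_apply, map_zero, zero_add] at h2
    rw [Finset.sum_eq_single β] at h2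
    · simpa [TrivSqZeroExt.algebraMap_eq_inl', snd_dualPoint] using h2
    · intro γ _ hγ
      simp [TrivSqZeroExt.algebraMap_eq_inl', snd_dualPoint, hγ.symm]
    · simp
  have : Nonempty ι := ⟨o⟩
  rw [hzero, Matrix.det_zero] at hdet
  exact not_isUnit_zero hdet

theorem pd_add_C (β : ι) (l : ℕ) (F : MvPowerSeries (ι × ℕ) k) (c : k) :
    pd β l (F + MvPowerSeries.C c) = pd β l F := by
  rw [pd_add, pd_C, add_zero]

theorem dilatonDefect_add_C (F : MvPowerSeries (ι × ℕ) k) (c : k) :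
    dilatonDefect o a (F + MvPowerSeries.C c) = dilatonDefect o a F - MvPowerSeries.C (2 * c) := by
  simp only [dilatonDefect, pd_add_C]
  rw [map_mul, map_ofNat]
  ring

theorem IsGenerating.const_unique [CharZero k] {c d : k}
    (hc : IsGenerating η φ o a (F + MvPowerSeries.C c))
    (hd : IsGenerating η φ o a (F + MvPowerSeries.C d)) : c = d := by
  have h1 := ((isGenerating_iff _ _ _ _ _).1 hc).1
  have h2 := ((isGenerating_iff _ _ _ _ _).1 hd).1
  rw [dilatonDefect_add_C, sub_eq_zero] at h1 h2
  have := MvPowerSeries.C_injective (h1.symm.trans h2)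
  simpa using this

/-- With Y = (b₀,b₀) and X = Σ bₙ₊₁∂ₙF at the base point b, the constant is ½Y + X. The differential
of DE rewrites X as the Hessian paired with z⁻¹b (without polar part) and b; contracting first with
the former, by the differential of SE, gives X = -X - Y. In invariant terms, Ω(z⁻¹f, f) = 0 because
f and z⁻¹f are both tangent at f. -/
theorem constantCoeff_stringDefect [CharZero k] (h : IsInfGenerating η φ o a F) :
    MvPowerSeries.constantCoeff (stringDefect η φ o a F) = 0 := by
  have hs : ∀ i, IsNilpotent ((0 : (ι × ℕ) →₀ k) i) := fun i => by simp
  have h0 : ext k (base o a) + 0 = base o a := by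
    ext i
    simp [ext_apply]
  have he := h.euler k 0 hs
  have hz := h.string_zero k 0 hs
  have hu := h.string_up k 0 hs
  rw [h0] at he hz hu
  set b := base o a
  set X := Finsupp.linearCombination k (grad F (0 : (ι × ℕ) →₀ k)) (down b) with hX
  set Y := ∑ α, ∑ β, gram η φ α β * b (α, 0) * b (β, 0) with hY
  have hS : MvPowerSeries.constantCoeff (stringDefect η φ o a F) = 1 / 2 * Y + X := by
    have : evalSeries (stringDefect η φ o a F) (0 : (ι × ℕ) →₀ k) = 1 / 2 * Y + X := by
      rw [stringDefect, evalSeries_add hs, evalSeries_formalSum_tvar b up_injective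
        (fun i => pd i.1 i.2 F) hs (p := down b) (fun i => by simp [down_apply]),
        ← evalHom_apply hs]
      simp_rw [map_mul, map_sum, map_mul, evalHom_apply, evalSeries_C, evalSeries_tvar _ _ _ hs]
      simp [hY, hX, b]
      rfl
    rw [evalSeries_zero_point] at this
    exact this
  have hXY : X = -X - Y := by
    have h1 : X = Finsupp.linearCombination k (fun j => Finsupp.linearCombination k
        (fun i => hess F (0 : (ι × ℕ) →₀ k) i j) (down b)) b := by
      rw [linearCombination_comm, hX]
      congr 2
      funext i
      rw [he]
      simp_rw [hess_comm F _ _ i]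
    conv_lhs => rw [h1]
    rw [linearCombination_eq_down]
    simp_rw [hz, hu, sub_eq_add_neg]
    congr 1
    · rw [hX]
      simp [Finsupp.linearCombination_apply, Finsupp.sum]
    · simp only [hY, ← Finset.sum_neg_distrib, Algebra.algebraMap_self, RingHom.id_apply,
        Finset.mul_sum]
      exact Finset.sum_congr rfl fun α _ => Finset.sum_congr rfl fun β _ => by ring
  rw [hS]
  linear_combination (1 / 2) * hXY

theorem IsInfGenerating.exists_isGenerating [CharZero k] (hg : (gram η φ).IsSymm)
    (h : IsInfGenerating η φ o a F) : ∃ c : k, IsGenerating η φ o a (F + MvPowerSeries.C c) := by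
  have hD : ∀ β l, pd β l (dilatonDefect o a F) = 0 := fun β l => series_ext fun A _ _ _ s hs => by
    rw [evalSeries_zero_series]
    refine (evalSeries_pd_dilatonDefect o a F hs (β, l)).trans ?_
    rw [h.euler A s hs, sub_self]
  have hS : ∀ β l, pd β l (stringDefect η φ o a F) = 0 := fun β l =>
    series_ext fun A _ _ _ s hs => by
      rw [evalSeries_zero_series]
      rcases l with _ | l
      · rw [evalSeries_pd_zero_stringDefect η φ o a F hs hg, h.string_zero A s hs, add_neg_cancel]
      · refine (evalSeries_pd_up_stringDefect η φ o a F hs (β, l)).trans ?_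
        rw [h.string_up A s hs, neg_add_cancel]
  -- DE contains F itself with coefficient -2, so half of its constant defect is the correction. SE
  -- and TRR see only derivatives of F and are not disturbed.
  refine ⟨MvPowerSeries.constantCoeff (dilatonDefect o a F) / 2,
    (isGenerating_iff _ _ _ _ _).2 ⟨?_, ?_, ?_⟩⟩
  · rw [dilatonDefect_add_C, mul_div_cancel₀ _ (two_ne_zero), ← series_const hD, sub_self]
  · have : stringDefect η φ o a F = 0 := by
      rw [series_const hS, constantCoeff_stringDefect h, map_zero]
    rw [← this]
    simp only [stringDefect, pd_add_C]
  · intro α β γ l m n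
    simp only [pd_add_C]
    refine series_ext fun A _ _ _ s hs => ?_
    exact (h.trr A s hs (α, l) (β, m) (γ, n)).trans (evalSeries_trr η φ F hs _ _ _).symm

end Equations

/-! ### The graph of a generating function is a Lagrangian cone -/

section GraphCone

set_option linter.unusedSectionVars false

theorem linearCombination_sum_sum {ι : Type w} [Fintype ι] {B : Type*} [CommRing B]
    (x : ι × ℕ → ι → B) (c : ι → ι → B) (y : ι → B) (p : (ι × ℕ) →₀ B) :
    Finsupp.linearCombination B (fun i => ∑ μ, ∑ ν, x i μ * c μ ν * y ν) p =
      ∑ ν, (∑ μ, c μ ν * Finsupp.linearCombination B (fun i => x i μ) p) * y ν := by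
  simp only [Finsupp.linearCombination_apply, Finsupp.sum, smul_eq_mul, Finset.mul_sum,
    Finset.sum_mul]
  rw [Finset.sum_comm, Finset.sum_congr rfl fun μ _ => Finset.sum_comm, Finset.sum_comm]
  exact Finset.sum_congr rfl fun ν _ => Finset.sum_congr rfl fun μ _ =>
    Finset.sum_congr rfl fun i _ => by ring

variable {k : Type u} {H : Type v} {ι : Type w} [Field k] [AddCommGroup H] [Module k H]
  [Fintype ι] [DecidableEq ι] {A : Type u} [CommRing A] [Algebra k A]

theorem pos_extend (x : Loop ι k) (i : ι × ℕ) : pos (extend A x) i = algebraMap k A (pos x i) := rfl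

theorem neg_extend (g : Matrix ι ι k) (x : Loop ι k) (j : ι × ℕ) :
    neg g (extend A x) j = algebraMap k A (neg g x j) := by
  rw [neg_apply, neg_apply]
  simp only [map_mul, map_pow, map_neg, map_one, map_sum]
  rfl

theorem evalMap_eq_sum {n : (ι × ℕ) →₀ ℕ} {t : (ι × ℕ) →₀ A} (h : Kills n t)
    (Φ : ((ι × ℕ) →₀ ℕ) → Loop ι k) :
    evalMap Φ t = ∑ m ∈ Finset.Iic n, monom t m • extend A (Φ m) := finsum_monom_eq h _

/-- The formal function with given coefficients. -/
def ofCoeff (c : ((ι × ℕ) →₀ ℕ) → k) : MvPowerSeries (ι × ℕ) k := c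

theorem coeff_ofCoeff (c : ((ι × ℕ) →₀ ℕ) → k) (m : (ι × ℕ) →₀ ℕ) :
    MvPowerSeries.coeff m (ofCoeff c) = c m := rfl

theorem pos_evalMap {t : (ι × ℕ) →₀ A} (ht : ∀ i, IsNilpotent (t i))
    (Φ : ((ι × ℕ) →₀ ℕ) → Loop ι k) (i : ι × ℕ) :
    pos (evalMap Φ t) i =
      evalSeries (ofCoeff fun m => pos (Φ m) i) t := by
  obtain ⟨n, hn⟩ := exists_kills ht
  rw [evalMap_eq_sum hn, evalSeries_eq_sum hn, map_sum, Finsupp.finsetSum_apply]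
  refine Finset.sum_congr rfl fun m _ => ?_
  rw [map_smul, Finsupp.smul_apply, pos_extend, smul_eq_mul, mul_comm, coeff_ofCoeff]

theorem neg_evalMap (g : Matrix ι ι k) {t : (ι × ℕ) →₀ A} (ht : ∀ i, IsNilpotent (t i))
    (Φ : ((ι × ℕ) →₀ ℕ) → Loop ι k) (j : ι × ℕ) :
    neg g (evalMap Φ t) j =
      evalSeries (ofCoeff fun m => neg g (Φ m) j) t := by
  obtain ⟨n, hn⟩ := exists_kills ht
  rw [evalMap_eq_sum hn, evalSeries_eq_sum hn, map_sum, Finset.sum_apply]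
  refine Finset.sum_congr rfl fun m _ => ?_
  rw [map_smul, Pi.smul_apply, neg_extend, smul_eq_mul, mul_comm, coeff_ofCoeff]

theorem zmul_sub (v w : Loop ι A) : zmul (v - w) = zmul v - zmul w := by
  funext α
  exact mul_sub _ _ _

theorem zmul_smul (c : A) (v : Loop ι A) : zmul (c • v) = c • zmul v := by
  have h : ∀ (f : Loop ι A) α n, (zmul f α).coeff n = (f α).coeff (n + 1) := fun f α n => by
    have := zcoeff_zmul f α (-n)
    rwa [zcoeff, zcoeff, neg_neg, neg_sub, sub_neg_eq_add, add_comm] at this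
  funext α
  ext n
  rw [h, Pi.smul_apply, Pi.smul_apply, HahnSeries.coeff_smul, HahnSeries.coeff_smul, h]

theorem exists_zmul_eq (f : Loop ι A) : ∃ w, zmul w = f := by
  refine ⟨fun α => HahnSeries.single 1 1 * f α, funext fun α => ?_⟩
  rw [zmul, ← mul_assoc, HahnSeries.single_mul_single]
  simp

/-- Together with `neg_up_eq` and `neg_zero_eq`, this expresses the coordinates of z⁻¹f through
those of f. The string conditions of `IsInfGenerating` thereby say that z⁻¹f is tangent at f. -/
theorem pos_eq_down (w : Loop ι A) : pos w = down (pos (zmul w)) := by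
  ext i
  rw [down_apply, pos_zmul_up]

theorem neg_up_eq (g : Matrix ι ι k) (w : Loop ι A) (j : ι × ℕ) :
    neg g w (up j) = -neg g (zmul w) j := by
  rw [neg_zmul, neg_neg]

theorem neg_zero_eq {g : Matrix ι ι k} (hg : IsUnit g.det) (hs : g.IsSymm) (w : Loop ι A) (α : ι) :
    neg g w (α, 0) = -∑ β, algebraMap k A (g α β) * pos (zmul w) (β, 0) := by
  simp_rw [pos_zmul_zero hg hs, mul_neg, Finset.sum_neg_distrib, neg_neg]
  rw [Finset.sum_congr rfl fun β _ => by
    rw [Finset.sum_congr rfl fun μ _ => by rw [inv_symm hs μ β]]]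
  exact (sum_inv_mul (Matrix.mul_nonsing_inv g hg) (fun μ => neg g w (μ, 0)) α).symm

variable {η : LinearMap.BilinForm k H} {φ : Module.Basis ι k H} {o : ι} {a : (ι × ℕ) →₀ k}
  {F : MvPowerSeries (ι × ℕ) k}

theorem IsGenerating.third_up (h : IsGenerating η φ o a F) {s : (ι × ℕ) →₀ A}
    (hs : ∀ i, IsNilpotent (s i)) (i j l : ι × ℕ) : third F s (up i) j l =
      ∑ μ, ∑ ν, hess F s i (μ, 0) * algebraMap k A ((gram η φ)⁻¹ μ ν) * third F s (ν, 0) j l := by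
  rw [← evalSeries_trr η φ F hs, ← h.trr]
  rfl

/-! ### Constancy of the Hessian along `z` times the tangent space. -/

section Path

open Polynomial

variable (hdet : IsUnit (gram η φ).det) (hsym : (gram η φ).IsSymm) [CharZero k]
  (h : IsGenerating η φ o a F) {s : (ι × ℕ) →₀ A} (hs : ∀ i, IsNilpotent (s i)) {w : Loop ι A}
  (hw : ∀ j, neg (gram η φ) w j = Finsupp.linearCombination A (fun i => hess F s i j) (pos w))
  (hu : ∀ i, IsNilpotent (pos (zmul w) i))

include hdet hsym h hs hw hu

/-- The deviation of the Hessian from its initial value solves a homogeneous linear system. By TRR,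
its derivative in the direction zw has as factors the components of Hess(y)·w - p(w) at the indices
(μ, 0). Tangency gives p(w) = Hess(0)·w, so these factors are combinations of the deviations
themselves. -/
theorem IsGenerating.hess_pathPoint (i j : ι × ℕ) :
    hess F (pathPoint s (pos (zmul w))) i j = C (hess F s i j) := by
  set S := pathPoint s (pos (zmul w))
  have hS : ∀ i, IsNilpotent (S i) := isNilpotent_pathPoint hs hu
  let δ : (ι × ℕ) × (ι × ℕ) → A[X] := fun ij => hess F S ij.1 ij.2 - C (hess F s ij.1 ij.2)
  refine sub_eq_zero.1 (eq_zero_of_derivative_mem_span k δ (fun ij => ?_) (fun ij => ?_) (i, j))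
  · simp only [δ]
    rw [coeff_sub, coeff_C_zero, coeff_zero_eq_eval_zero, hess, eval_evalSeries_pathPoint hs hu,
      zero_smul, add_zero, hess, sub_self]
  · obtain ⟨i, j⟩ := ij
    have hd : derivative (δ (i, j)) = Finsupp.linearCombination A[X] (fun l => third F S l i j)
        ((pos (zmul w)).mapRange C (map_zero _)) := by
      simp only [δ]
      rw [derivative_sub, derivative_C, sub_zero, hess, derivative_evalSeries_pathPoint hs hu]
      rfl
    have hC : ∀ μ, C (neg (gram η φ) w (μ, 0)) = Finsupp.linearCombination A[X]
        (fun l => C (hess F s l (μ, 0))) ((pos w).mapRange C (map_zero _)) := by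
      intro μ
      rw [hw, Finsupp.linearCombination_apply, Finsupp.linearCombination_apply,
        Finsupp.sum_mapRange_index (by simp), Finsupp.sum, Finsupp.sum, map_sum]
      simp
    rw [hd, linearCombination_pos_zmul hdet hsym]
    simp_rw [h.third_up hS]
    rw [linearCombination_sum_sum, ← Finset.sum_sub_distrib]
    refine Ideal.sum_mem _ fun ν _ => ?_
    rw [← sub_mul, ← Finset.sum_sub_distrib]
    refine Ideal.mul_mem_right _ _ (Ideal.sum_mem _ fun μ _ => ?_)
    rw [hC, ← Polynomial.algebraMap_apply, ← mul_sub]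
    refine Ideal.mul_mem_left _ _ ?_
    rw [Finsupp.linearCombination_apply, Finsupp.linearCombination_apply, Finsupp.sum, Finsupp.sum,
      ← Finset.sum_sub_distrib]
    refine Ideal.sum_mem _ fun l _ => ?_
    rw [smul_eq_mul, smul_eq_mul, ← mul_sub]
    exact Ideal.mul_mem_left _ _ (Ideal.subset_span ⟨(l, (μ, 0)), rfl⟩)

theorem IsGenerating.hess_add (i j : ι × ℕ) : hess F (s + pos (zmul w)) i j = hess F s i j := by
  have := congrArg (eval 1) (h.hess_pathPoint hdet hsym hs hw hu i j)
  rwa [hess, eval_evalSeries_pathPoint hs hu, eval_C, one_smul] at this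

/-- As the Hessian is constant along the segment, the gradient is affine in the parameter. -/
theorem IsGenerating.grad_add (j : ι × ℕ) : grad F (s + pos (zmul w)) j = grad F s j +
    Finsupp.linearCombination A (fun i => hess F s i j) (pos (zmul w)) := by
  let γ : ι × ℕ → A[X] := fun j => grad F (pathPoint s (pos (zmul w))) j - C (grad F s j) -
    C (Finsupp.linearCombination A (fun i => hess F s i j) (pos (zmul w))) * X
  have h0 := eq_zero_of_derivative_mem_span k γ (fun j => ?_) (fun j => ?_) j
  · have := congrArg (eval 1) h0
    simp only [γ, grad, eval_sub, eval_evalSeries_pathPoint hs hu, eval_C, one_smul, eval_mul,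
      eval_X, mul_one, eval_zero] at this
    rw [grad, grad]
    linear_combination this
  · simp only [γ]
    rw [coeff_sub, coeff_sub, coeff_C_zero, coeff_zero_eq_eval_zero, grad,
      eval_evalSeries_pathPoint hs hu, zero_smul, add_zero, grad, sub_self]
    simp
  · have : derivative (γ j) = 0 := by
      simp only [γ]
      rw [derivative_sub, derivative_sub, derivative_C, sub_zero, derivative_C_mul, derivative_X,
        mul_one, grad, derivative_evalSeries_pathPoint hs hu, sub_eq_zero,
        Finsupp.linearCombination_apply, Finsupp.linearCombination_apply,
        Finsupp.sum_mapRange_index (by simp), Finsupp.sum, Finsupp.sum, map_sum]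
      refine Finset.sum_congr rfl fun i _ => ?_
      have := h.hess_pathPoint hdet hsym hs hw hu i j
      rw [hess] at this
      rw [this]
      simp
    rw [this]
    exact Ideal.zero_mem _

end Path

variable (η φ o a F) in
/-- The base point of the graph. -/
def basePoint : Loop ι k :=
  mkLoop (gram η φ) (base o a) fun j => MvPowerSeries.constantCoeff (pd j.1 j.2 F)

variable (hsymm : η.IsSymm) (hη : η.Nondegenerate)

include hsymm hη

theorem isNear_basePoint [IsTestAlgebra k A] {f : Loop ι A} (hf : f ∈ graph η φ o a F A) :
    IsNear (basePoint η φ o a F) f := by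
  obtain ⟨s, hs, h1, h2⟩ := (mem_graph hsymm hη φ o a F).1 hf
  refine (isNear_iff hsymm hη φ).2 ⟨fun i => ?_, fun j => ?_⟩
  · rw [basePoint, pos_mkLoop, h1, Finsupp.add_apply, ext_apply, add_sub_cancel_left]
    exact hs i
  · rw [basePoint, neg_mkLoop (gram_isUnit_det hη φ) (gram_isSymm hsymm φ), h2]
    exact isNilpotent_evalSeries_sub _ hs

/-- Symmetry of the Hessian gives isotropy; pairing with the tangent lifts of the coordinate vectors
gives maximality. -/
theorem isLagrangian_graph : IsLagrangian η φ (graph η φ o a F) := by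
  intro A _ _ _ f hf
  obtain ⟨s, hs, h1, h2⟩ := (mem_graph hsymm hη φ o a F).1 hf
  have hT := fun v => mem_tangent_graph hsymm hη φ o a F (v := v) hs h1 h2
  ext v
  refine ⟨fun hv u hu => ?_, fun h => ?_⟩
  · rw [hT] at hu hv
    rw [omega_eq hsymm, sub_eq_zero, funext hu, funext hv, linearCombination_comm]
    simp_rw [hess_comm F s _ _]
  · rw [hT]
    intro j
    have hg := gram_isUnit_det hη φ
    have hs' := gram_isSymm hsymm φ
    have := h (mkLoop (gram η φ) (Finsupp.single j 1) fun l => hess F s j l) (by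
      change _ ∈ tangent _ _
      rw [hT]
      intro l
      rw [neg_mkLoop hg hs', pos_mkLoop, Finsupp.linearCombination_single, one_smul])
    rw [omega_eq hsymm, neg_mkLoop hg hs', pos_mkLoop, Finsupp.linearCombination_single, one_smul,
      sub_eq_zero] at this
    rw [← this]
    simp_rw [hess_comm F s _ j]

theorem isSubmanifoldGerm_graph :
    IsSubmanifoldGerm (basePoint η φ o a F) (graph η φ o a F) := by
  have hg := gram_isUnit_det hη φ
  have hs' := gram_isSymm hsymm φ
  -- The Taylor coefficients of s ↦ base + s: the base point in degree 0, unit vectors in degree 1,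
  -- and zero beyond. The unit vectors make the differential of `Φ` injective.
  let P : ((ι × ℕ) →₀ ℕ) → (ι × ℕ) →₀ k := fun m =>
    Finsupp.onFinset ((base o a).support ∪ m.support)
      (fun i => MvPowerSeries.coeff m (tvar (base o a) i.1 i.2)) (by
        intro i hi
        rw [Finset.mem_union]
        by_contra h
        push Not at h
        have := coeff_tvar_mul_eq_zero (Finsupp.notMem_support_iff.1 h.1)
          (Finsupp.notMem_support_iff.1 h.2) (1 : MvPowerSeries (ι × ℕ) k)
        rw [mul_one] at this
        exact hi this)
  let Φ : ((ι × ℕ) →₀ ℕ) → Loop ι k := fun m =>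
    mkLoop (gram η φ) (P m) fun j => MvPowerSeries.coeff m (pd j.1 j.2 F)
  have hpos : ∀ (A : Type u) [CommRing A] [Algebra k A] (t : (ι × ℕ) →₀ A),
      (∀ i, IsNilpotent (t i)) → pos (evalMap Φ t) = ext A (base o a) + t := by
    intro A _ _ t ht
    ext i
    rw [pos_evalMap ht]
    simp only [Φ, pos_mkLoop]
    exact evalSeries_tvar _ _ _ ht
  have hneg : ∀ (A : Type u) [CommRing A] [Algebra k A] (t : (ι × ℕ) →₀ A),
      (∀ i, IsNilpotent (t i)) → neg (gram η φ) (evalMap Φ t) = grad F t := by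
    intro A _ _ t ht
    ext j
    rw [neg_evalMap _ ht]
    simp only [Φ, neg_mkLoop hg hs']
    rfl
  refine ⟨Φ, ?_, ?_, fun A _ _ _ => ?_⟩
  · simp only [Φ, basePoint]
    congr 1
    ext i
    change MvPowerSeries.coeff 0 (tvar (base o a) i.1 i.2) = _
    simp [tvar]
  · refine LinearIndependent.of_comp (pos : Loop ι k →ₗ[k] _) ?_
    have : (pos : Loop ι k →ₗ[k] _) ∘ (fun i : ι × ℕ => Φ (Finsupp.single i 1)) =
        fun i => Finsupp.single i 1 := by
      funext i
      simp only [Function.comp, Φ, pos_mkLoop]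
      ext j
      change MvPowerSeries.coeff _ (tvar (base o a) j.1 j.2) = _
      rw [tvar, map_add, MvPowerSeries.coeff_C, MvPowerSeries.coeff_X, if_neg (by simp), zero_add,
        Finsupp.single_apply]
      congr 1
      rw [Finsupp.single_left_inj one_ne_zero]
    rw [this]
    exact Finsupp.basisSingleOne.linearIndependent
  · ext f
    rw [mem_graph hsymm hη, Set.mem_ofPred_eq]
    refine exists_congr fun t => and_congr_right fun ht => ?_
    rw [← hpos A t ht, ← hneg A t ht]
    exact ⟨fun h => loop_ext hg hs' h.1 h.2, fun h => h ▸ ⟨rfl, rfl⟩⟩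

variable [CharZero k] (h : IsGenerating η φ o a F)

include h

/-- In coordinates this is the quadratic relation `IsGenerating.hess_up`, contracted with `pos v`.
-/
theorem IsGenerating.zmul_mem_tangent [IsTestAlgebra k A] {f : Loop ι A}
    (hf : f ∈ graph η φ o a F A) {v : Loop ι A} (hv : v ∈ tangent (graph η φ o a F) f) :
    zmul v ∈ tangent (graph η φ o a F) f := by
  have hg := gram_isUnit_det hη φ
  have hs' := gram_isSymm hsymm φ
  obtain ⟨s, hs, h1, h2⟩ := (mem_graph hsymm hη φ o a F).1 hf
  rw [mem_tangent_graph hsymm hη φ o a F hs h1 h2] at hv ⊢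
  intro j
  have hlc := linearCombination_pos_zmul hg hs' v (RingHom.id A) (fun i => hess F s i j)
  have hid : ∀ p : (ι × ℕ) →₀ A, p.mapRange (RingHom.id A) (map_zero _) = p := fun p => by
    ext; rfl
  rw [hid, hid] at hlc
  rw [hlc, neg_zmul, hv]
  simp only [RingHom.id_apply, hv]
  rw [← linearCombination_sum_sum (fun i μ => hess F s i (μ, 0))]
  simp_rw [← h.hess_up hs' hs]
  simp only [Finsupp.linearCombination_apply, Finsupp.sum, smul_eq_mul, mul_add,
    Finset.sum_add_distrib]
  ring

theorem IsGenerating.mem_tangent_of_zmul_eq [IsTestAlgebra k A] {f : Loop ι A}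
    (hf : f ∈ graph η φ o a F A) {w : Loop ι A} (hw : zmul w = f) :
    w ∈ tangent (graph η φ o a F) f := by
  have hg := gram_isUnit_det hη φ
  have hs' := gram_isSymm hsymm φ
  have hF := h.isInfGenerating hs'
  obtain ⟨s, hs, h1, h2⟩ := (mem_graph hsymm hη φ o a F).1 hf
  rw [mem_tangent_graph hsymm hη φ o a F hs h1 h2]
  rintro ⟨α, _ | n⟩
  · rw [neg_zero_eq hg hs', hw, h1, pos_eq_down w, hw, h1, hF.string_zero A s hs]
  · have := hF.string_up A s hs (α, n)
    rw [← h1, ← hw, ← pos_eq_down, ← h2, ← hw, ← neg_up_eq] at this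
    exact this.symm

theorem IsGenerating.tangentExactlyAlongZ :
    TangentExactlyAlongZ (basePoint η φ o a F) (graph η φ o a F) := by
  intro A _ _ _ f hf
  have hg := gram_isUnit_det hη φ
  have hs' := gram_isSymm hsymm φ
  refine ⟨fun v hv => h.zmul_mem_tangent hsymm hη hf hv, ?_⟩
  obtain ⟨s, hs, h1, h2⟩ := (mem_graph hsymm hη φ o a F).1 hf
  have hT := fun v => mem_tangent_graph hsymm hη φ o a F (v := v) hs h1 h2
  ext g
  constructor
  · rintro ⟨hg1, hg2⟩
    -- The vector z⁻¹g is tangent at g, hence at f, as the two tangent spaces agree.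
    obtain ⟨w, hw⟩ := exists_zmul_eq g
    exact ⟨⟨w, hg2 ▸ h.mem_tangent_of_zmul_eq hsymm hη hg1 hw, hw⟩, isNear_basePoint hsymm hη hg1⟩
  · rintro ⟨⟨v, hv, rfl⟩, hnear⟩
    -- Since z⁻¹f is tangent at f, the displacement from f to zv is z times a tangent vector, and
    -- nearness makes its q-part nilpotent. The path lemmas then put zv on the graph, with unchanged
    -- Hessian.
    obtain ⟨w, hw⟩ := exists_zmul_eq f
    have hwT := h.mem_tangent_of_zmul_eq hsymm hη hf hw
    have hvw : v - w ∈ tangent (graph η φ o a F) f := by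
      rw [hT] at hv hwT ⊢
      intro j
      rw [map_sub, map_sub, map_sub, Pi.sub_apply, hv, hwT]
    have hzvw := h.zmul_mem_tangent hsymm hη hf hvw
    have hp : pos (zmul v) = pos f + pos (zmul (v - w)) := by
      rw [zmul_sub, map_sub, hw]
      abel
    have hn : neg (gram η φ) (zmul v) = neg (gram η φ) f + neg (gram η φ) (zmul (v - w)) := by
      rw [zmul_sub, map_sub, hw]
      abel
    have hu : ∀ i, IsNilpotent (pos (zmul (v - w)) i) := by
      intro i
      have := ((isNear_iff hsymm hη φ).1 hnear).1 i
      rw [basePoint, pos_mkLoop, hp, h1] at this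
      have h3 := (Commute.all _ _).isNilpotent_sub this (hs i)
      simp only [Finsupp.add_apply, ext_apply] at h3
      convert h3 using 1
      ring
    rw [hT] at hvw hzvw
    have hs2 : ∀ i, IsNilpotent ((s + pos (zmul (v - w))) i) := fun i =>
      (Commute.all _ _).isNilpotent_add (hs i) (hu i)
    have hp2 : pos (zmul v) = ext A (base o a) + (s + pos (zmul (v - w))) := by
      rw [hp, h1, add_assoc]
    have hn2 : neg (gram η φ) (zmul v) = grad F (s + pos (zmul (v - w))) := by
      ext j
      rw [hn, Pi.add_apply, h.grad_add hg hs' hs hvw hu, h2, hzvw]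
    refine ⟨(mem_graph hsymm hη φ o a F).2 ⟨_, hs2, hp2, hn2⟩, ?_⟩
    ext x
    rw [hT, mem_tangent_graph hsymm hη φ o a F hs2 hp2 hn2]
    simp_rw [h.hess_add hg hs' hs hvw hu]

theorem IsGenerating.isStarCone :
    IsStarCone η φ (basePoint η φ o a F) (graph η φ o a F) where
  ne_zero h0 := by
    have := congrArg pos h0
    rw [basePoint, pos_mkLoop, map_zero] at this
    exact (h.isInfGenerating (gram_isSymm hsymm φ)).base_ne_zero (gram_isUnit_det hη φ) this
  submanifold := isSubmanifoldGerm_graph hsymm hη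
  lagrangian := isLagrangian_graph hsymm hη
  tangent_along := h.tangentExactlyAlongZ hsymm hη
  cone := by
    intro A _ _ _ f hf c hc
    -- The multiple cf = z(c·z⁻¹f) lies in zT_f and near the base point, hence on the graph.
    obtain ⟨w, hw⟩ := exists_zmul_eq f
    have hwT := h.mem_tangent_of_zmul_eq hsymm hη hf hw
    obtain ⟨s, hs, h1, h2⟩ := (mem_graph hsymm hη φ o a F).1 hf
    have hcw : c • w ∈ tangent (graph η φ o a F) f := by
      rw [mem_tangent_graph hsymm hη φ o a F hs h1 h2] at hwT ⊢
      intro j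
      rw [map_smul, map_smul, map_smul, Pi.smul_apply, hwT]
    have hmem : c • f ∈ {g | g ∈ zmul '' tangent (graph η φ o a F) f ∧
        IsNear (basePoint η φ o a F) g} := by
      refine ⟨⟨c • w, hcw, by rw [zmul_smul, hw]⟩, fun α n => ?_⟩
      have h3 := isNear_basePoint hsymm hη hf α n
      have h4 : IsNilpotent ((c - 1) * (f α).coeff n) :=
        (Commute.all _ _).isNilpotent_mul_right hc
      convert (Commute.all _ _).isNilpotent_add h4 h3 using 1
      simp only [Pi.smul_apply, HahnSeries.coeff_smul, smul_eq_mul]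
      ring
    rw [← (h.tangentExactlyAlongZ hsymm hη A f hf).2] at hmem
    exact hmem.1

end GraphCone

/-! ### Lagrangian cones that are graphs come from generating functions -/

section ConeGraph

set_option linter.unusedSectionVars false

variable {k : Type u} {H : Type v} {ι : Type w} [Field k] [AddCommGroup H] [Module k H]
  [Fintype ι] [DecidableEq ι] {A : Type u} [CommRing A] [Algebra k A]

theorem fst_linearCombination (c : ι × ℕ → DualNumber A) (p q : (ι × ℕ) →₀ A) :
    (Finsupp.linearCombination (DualNumber A) c (dualPoint p q)).fst =
      Finsupp.linearCombination A (fun i => (c i).fst) p := by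
  rw [Finsupp.linearCombination_apply, Finsupp.linearCombination_apply,
    Finsupp.sum_of_support_subset (s := (dualPoint p q).support ∪ p.support) _
      Finset.subset_union_left _ (by simp),
    Finsupp.sum_of_support_subset (s := (dualPoint p q).support ∪ p.support) _
      Finset.subset_union_right _ (by simp)]
  simp [TrivSqZeroExt.fst_sum, fst_dualPoint]

theorem snd_linearCombination (c : ι × ℕ → DualNumber A) (p q : (ι × ℕ) →₀ A) :
    (Finsupp.linearCombination (DualNumber A) c (dualPoint p q)).snd =
      Finsupp.linearCombination A (fun i => (c i).snd) p +
        Finsupp.linearCombination A (fun i => (c i).fst) q := by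
  rw [Finsupp.linearCombination_apply, Finsupp.linearCombination_apply,
    Finsupp.linearCombination_apply,
    Finsupp.sum_of_support_subset (s := (dualPoint p q).support ∪ p.support ∪ q.support) _
      (fun i hi => by simp only [Finset.mem_union]; tauto) _ (by simp),
    Finsupp.sum_of_support_subset (s := (dualPoint p q).support ∪ p.support ∪ q.support) _
      (fun i hi => by simp only [Finset.mem_union]; tauto) _ (by simp),
    Finsupp.sum_of_support_subset (s := (dualPoint p q).support ∪ p.support ∪ q.support) _
      (fun i hi => by simp only [Finset.mem_union]; tauto) _ (by simp), ← Finset.sum_add_distrib]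
  simp only [TrivSqZeroExt.snd_sum, smul_eq_mul, TrivSqZeroExt.snd_mul, fst_dualPoint,
    snd_dualPoint, op_smul_eq_smul]
  exact Finset.sum_congr rfl fun i _ => by ring

theorem zmul_addEps (f v : Loop ι A) : zmul (addEps f v) = addEps (zmul f) (zmul v) := by
  have h : ∀ (B : Type u) [CommRing B] (f : Loop ι B) α n,
      (zmul f α).coeff n = (f α).coeff (n + 1) := fun B _ f α n => by
    have := zcoeff_zmul f α (-n)
    rwa [zcoeff, zcoeff, neg_neg, neg_sub, sub_neg_eq_add, add_comm] at this
  funext α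
  ext n
  · rw [h]; simp [addEps, h]
  · rw [h]; simp [addEps, h]

variable {η : LinearMap.BilinForm k H} {φ : Module.Basis ι k H} {o : ι} {a : (ι × ℕ) →₀ k}
  {F : MvPowerSeries (ι × ℕ) k}

theorem IsNear.addEps {f₀ : Loop ι k} {f : Loop ι A} (h : IsNear f₀ f) (v : Loop ι A) :
    IsNear f₀ (addEps f v) := by
  intro α n
  rw [TrivSqZeroExt.isNilpotent_iff_isNilpotent_fst]
  simpa [Givental.addEps, TrivSqZeroExt.algebraMap_eq_inl'] using h α n

theorem ext_add_dualPoint (b : (ι × ℕ) →₀ k) (s v : (ι × ℕ) →₀ A) :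
    dualPoint (ext A b + s) v = ext (DualNumber A) b + dualPoint s v := by
  ext i
  · simp [fst_dualPoint, ext_apply, TrivSqZeroExt.algebraMap_eq_inl']
  · simp [snd_dualPoint, ext_apply, TrivSqZeroExt.algebraMap_eq_inl']

variable (hsymm : η.IsSymm) (hη : η.Nondegenerate)

include hsymm hη

theorem mkLoop_single_mem_tangent [IsTestAlgebra k A] {f : Loop ι A} {s : (ι × ℕ) →₀ A}
    (hs : ∀ i, IsNilpotent (s i)) (hpos : pos f = ext A (base o a) + s)
    (hneg : neg (gram η φ) f = grad F s) (i : ι × ℕ) :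
    mkLoop (gram η φ) (Finsupp.single i 1) (hess F s i) ∈ tangent (graph η φ o a F) f := by
  rw [mem_tangent_graph hsymm hη φ o a F hs hpos hneg]
  intro l
  rw [neg_mkLoop (gram_isUnit_det hη φ) (gram_isSymm hsymm φ), pos_mkLoop,
    Finsupp.linearCombination_single, one_smul]

/-- Write f = zw with w ∈ T_f. Over A[ε] the vector w + εv is tangent at f for every v ∈ T_f, so (⋆)
puts f + εzv on the germ with the same tangent space as f. Hence the Hessian is stationary in the
direction q(zv); for v lying over the i-th coordinate vector, expanding q(zv) gives TRR. -/
theorem IsStarCone.third_up {f₀ : Loop ι k} (h : IsStarCone η φ f₀ (graph η φ o a F))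
    [IsTestAlgebra k A] {s : (ι × ℕ) →₀ A} (hs : ∀ i, IsNilpotent (s i)) (i j l : ι × ℕ) :
    third F s (up i) j l =
      ∑ μ, ∑ ν, hess F s i (μ, 0) * algebraMap k A ((gram η φ)⁻¹ μ ν) * third F s (ν, 0) j l := by
  have hg := gram_isUnit_det hη φ
  have hs' := gram_isSymm hsymm φ
  set f : Loop ι A := mkLoop (gram η φ) (ext A (base o a) + s) (grad F s)
  have hf : f ∈ graph η φ o a F A := mkLoop_mem_graph hsymm hη φ o a F hs
  have h1 : pos f = ext A (base o a) + s := pos_mkLoop _ _ _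
  have h2 : neg (gram η φ) f = grad F s := neg_mkLoop hg hs' _ _
  have hT := fun v => mem_tangent_graph hsymm hη φ o a F (v := v) hs h1 h2
  obtain ⟨hz, hset⟩ := h.tangent_along A f hf
  obtain ⟨⟨w, hw, hwf⟩, hnear⟩ := hset.subset (show f ∈ _ from ⟨hf, rfl⟩)
  have hv := mkLoop_single_mem_tangent hsymm hη hs h1 h2 i
  set v := mkLoop (gram η φ) (Finsupp.single i 1) (hess F s i)
  have h0T : (0 : Loop ι A) ∈ tangent (graph η φ o a F) f := by
    rw [hT]
    intro j
    rw [map_zero, map_zero, map_zero, Pi.zero_apply]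
  have hf' : addEps f 0 ∈ graph η φ o a F (DualNumber A) := h0T
  have hds := isNilpotent_dualPoint hs 0
  have h1' : pos (addEps f 0) = ext (DualNumber A) (base o a) + dualPoint s 0 := by
    rw [pos_addEps, h1, map_zero, ext_add_dualPoint]
  have h2' : neg (gram η φ) (addEps f 0) = grad F (dualPoint s 0) := by
    obtain ⟨t, _, ht1, ht2⟩ := (mem_graph hsymm hη φ o a F).1 hf'
    rwa [← add_left_cancel (h1'.symm.trans ht1)] at ht2
  have hhess_fst : ∀ x i j, (hess F (dualPoint s x) i j).fst = hess F s i j := fun x i j =>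
    fst_evalSeries_dualPoint hs _ _
  have hhess_snd : ∀ x i j, (hess F (dualPoint s x) i j).snd =
      Finsupp.linearCombination A (fun l => third F s l i j) x := fun x i j =>
    snd_evalSeries_dualPoint hs _ _
  have hwv : addEps w v ∈ tangent (graph η φ o a F) (addEps f 0) := by
    rw [mem_tangent_graph hsymm hη φ o a F hds h1' h2']
    rw [hT] at hw hv
    intro j
    ext
    · rw [fst_neg_addEps, pos_addEps, fst_linearCombination, hw]
      simp_rw [hhess_fst]
    · rw [snd_neg_addEps, pos_addEps, snd_linearCombination, hv]
      simp_rw [hhess_fst, hhess_snd]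
      simp [Finsupp.linearCombination_apply]
  have hmem : addEps f (zmul v) ∈ {g | g ∈ zmul '' tangent (graph η φ o a F) (addEps f 0) ∧
      IsNear f₀ g} := ⟨⟨_, hwv, by rw [zmul_addEps, hwf]⟩, hnear.addEps _⟩
  rw [← (h.tangent_along _ _ hf').2] at hmem
  obtain ⟨hgX, hgT⟩ := hmem
  obtain ⟨t, ht, ht1, ht2⟩ := (mem_graph hsymm hη φ o a F).1 hgX
  have htd : t = dualPoint s (pos (zmul v)) := by
    rw [pos_addEps, h1, ext_add_dualPoint] at ht1
    exact (add_left_cancel ht1).symm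
  -- The lift of the j-th coordinate vector at f is also tangent at f + εzv; the ε-part of that
  -- statement compares the two Hessians.
  have hx := mkLoop_single_mem_tangent hsymm hη hds h1' h2' j
  rw [← hgT, mem_tangent_graph hsymm hη φ o a F ht ht1 ht2] at hx
  have hx2 := congrArg TrivSqZeroExt.snd (hx l)
  rw [neg_mkLoop hg hs', pos_mkLoop, Finsupp.linearCombination_single, one_smul, htd, hhess_snd,
    hhess_snd, map_zero] at hx2
  have hlc := linearCombination_pos_zmul hg hs' v (RingHom.id A) (fun l' => third F s l' j l)
  have hid : ∀ p : (ι × ℕ) →₀ A, p.mapRange (RingHom.id A) (map_zero _) = p := fun p => by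
    ext; rfl
  rw [hid, hid, ← hx2, pos_mkLoop, neg_mkLoop hg hs', Finsupp.linearCombination_single, one_smul,
    eq_comm, sub_eq_zero] at hlc
  rw [hlc, Finset.sum_comm]
  simp_rw [Finset.sum_mul]
  exact Finset.sum_congr rfl fun ν _ => Finset.sum_congr rfl fun μ _ => by
    rw [RingHom.id_apply, RingHom.id_apply]
    ring

/-- Since f lies on the germ with its own tangent space, f = zw with w ∈ T_f, which is the
differential of SE. Then f = zw ∈ T_f as well, which is the differential of DE. -/
theorem IsStarCone.isInfGenerating {f₀ : Loop ι k} (h : IsStarCone η φ f₀ (graph η φ o a F)) :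
    IsInfGenerating η φ o a F := by
  have hg := gram_isUnit_det hη φ
  have hs' := gram_isSymm hsymm φ
  have key : ∀ (A : Type u) [CommRing A] [Algebra k A] [IsTestAlgebra k A] (s : (ι × ℕ) →₀ A),
      (∀ i, IsNilpotent (s i)) → (∀ j, grad F s j =
        Finsupp.linearCombination A (fun i => hess F s i j) (ext A (base o a) + s)) ∧
      ∃ w : Loop ι A, pos (zmul w) = ext A (base o a) + s ∧ neg (gram η φ) (zmul w) = grad F s ∧
        ∀ j, neg (gram η φ) w j =
          Finsupp.linearCombination A (fun i => hess F s i j) (down (ext A (base o a) + s)) := by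
    intro A _ _ _ s hs
    set f : Loop ι A := mkLoop (gram η φ) (ext A (base o a) + s) (grad F s)
    have hf : f ∈ graph η φ o a F A := mkLoop_mem_graph hsymm hη φ o a F hs
    have h1 : pos f = ext A (base o a) + s := pos_mkLoop _ _ _
    have h2 : neg (gram η φ) f = grad F s := neg_mkLoop hg hs' _ _
    have hT := fun v => mem_tangent_graph hsymm hη φ o a F (v := v) hs h1 h2
    obtain ⟨hz, hset⟩ := h.tangent_along A f hf
    obtain ⟨⟨w, hw, hwf⟩, -⟩ := hset.subset (show f ∈ _ from ⟨hf, rfl⟩)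
    have hfT := hz w hw
    rw [hwf, hT, h1, h2] at hfT
    refine ⟨hfT, w, by rw [hwf, h1], by rw [hwf, h2], ?_⟩
    rw [hT, pos_eq_down, hwf, h1] at hw
    exact hw
  refine ⟨fun A _ _ _ s hs => (key A s hs).1, fun A _ _ _ s hs α => ?_, fun A _ _ _ s hs j => ?_,
    fun A _ _ _ s hs i j l => h.third_up hsymm hη hs i j l⟩
  · obtain ⟨-, w, h1, -, h3⟩ := key A s hs
    rw [← h3, neg_zero_eq hg hs', h1]
  · obtain ⟨-, w, -, h2, h3⟩ := key A s hs
    rw [← h3, neg_up_eq, h2]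

end ConeGraph

/-! ### The action of the twisted loop group -/

section Action

set_option linter.unusedSectionVars false

/-- The substitution `z ↦ -z` as a ring homomorphism. -/
def negZHom (R : Type*) [CommRing R] : R⸨X⸩ →+* R⸨X⸩ where
  toFun := negZ
  map_zero' := by
    ext n
    exact smul_zero _
  map_one' := by
    ext n
    change (n.negOnePow : ℤˣ) • (1 : R⸨X⸩).coeff n = _
    rw [HahnSeries.coeff_one]
    split_ifs with h
    · subst h; simp
    · rw [smul_zero]
  map_add' x y := by
    ext n
    exact smul_add _ _ _
  map_mul' x y := by
    have hsupp : ∀ x : R⸨X⸩, (negZ x).support ⊆ x.support := fun x n hn h => hn (by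
      change (n.negOnePow : ℤˣ) • x.coeff n = 0
      rw [h, smul_zero])
    ext n
    change (n.negOnePow : ℤˣ) • (x * y).coeff n = _
    rw [HahnSeries.coeff_mul,
      coeff_mul_of_subset x.isPWO_support y.isPWO_support (hsupp x) (hsupp y), Finset.smul_sum]
    refine Finset.sum_congr rfl fun ij h => ?_
    rw [Finset.mem_antidiagonal] at h
    change _ = ((ij.1.negOnePow : ℤˣ) • _) * ((ij.2.negOnePow : ℤˣ) • _)
    rw [smul_mul_smul_comm, ← Int.negOnePow_add, h.2.2]

variable {k : Type u} {H : Type v} {ι : Type w} [Field k] [AddCommGroup H] [Module k H]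
  [Fintype ι] [DecidableEq ι] {A : Type u} [CommRing A] [Algebra k A]

theorem coeff_extendHom (x : k⸨X⸩) (n : ℤ) :
    (extendHom k A x).coeff n = algebraMap k A (x.coeff n) := rfl

theorem negZ_extendHom (x : k⸨X⸩) : negZ (extendHom k A x) = extendHom k A (negZ x) := by
  ext n
  change (n.negOnePow : ℤˣ) • algebraMap k A (x.coeff n) =
    algebraMap k A ((n.negOnePow : ℤˣ) • x.coeff n)
  rw [Units.smul_def, Units.smul_def, map_zsmul]

theorem map_inl_mul_map_inr (x y : A⸨X⸩) :
    x.map (TrivSqZeroExt.inlHom A A) * y.map (TrivSqZeroExt.inrHom A A) =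
      (x * y).map (TrivSqZeroExt.inrHom A A) := by
  ext1
  funext n
  rw [coeff_mul_of_subset x.isPWO_support y.isPWO_support
    (fun i hi h => hi (by simp [h])) (fun i hi h => hi (by simp [h])), HahnSeries.map_coeff,
    HahnSeries.coeff_mul, map_sum]
  refine Finset.sum_congr rfl fun ij _ => ?_
  exact TrivSqZeroExt.inl_mul_inr _ _

theorem map_inl_mul_map_inl (x y : A⸨X⸩) :
    x.map (TrivSqZeroExt.inlHom A A) * y.map (TrivSqZeroExt.inlHom A A) =
      (x * y).map (TrivSqZeroExt.inlHom A A) :=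
  (HahnSeries.map_mul ((TrivSqZeroExt.inlHom A A : A →+* TrivSqZeroExt A A) :
    A →ₙ+* TrivSqZeroExt A A)).symm

theorem extendHom_dualNumber (x : k⸨X⸩) : extendHom k (DualNumber A) x =
    (extendHom k A x).map (TrivSqZeroExt.inlHom A A) := by
  ext n <;> simp [coeff_extendHom, TrivSqZeroExt.algebraMap_eq_inl']

theorem sum_map_inl {J : Type*} (t : Finset J) (x : J → A⸨X⸩) :
    (∑ j ∈ t, x j).map (TrivSqZeroExt.inlHom A A) =
      ∑ j ∈ t, (x j).map (TrivSqZeroExt.inlHom A A) := by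
  ext1
  funext n
  rw [HahnSeries.map_coeff, HahnSeries.coeff_sum, HahnSeries.coeff_sum, map_sum]
  rfl

theorem sum_map_inr {J : Type*} (t : Finset J) (x : J → A⸨X⸩) :
    (∑ j ∈ t, x j).map (TrivSqZeroExt.inrHom A A) =
      ∑ j ∈ t, (x j).map (TrivSqZeroExt.inrHom A A) := by
  ext1
  funext n
  rw [HahnSeries.map_coeff, HahnSeries.coeff_sum, HahnSeries.coeff_sum, map_sum]
  rfl

theorem smul_eq_C_smul (c : A) (f : Loop ι A) : c • f = (HahnSeries.C c : A⸨X⸩) • f := by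
  funext α
  rw [Pi.smul_apply, Pi.smul_apply, smul_eq_mul, HahnSeries.C_mul_eq_smul]

variable (φ : Module.Basis ι k H) (M N : (Module.End k H)⸨X⸩)

/-- The action of a loop as a linear map. -/
def actLin (A : Type u) [CommRing A] [Algebra k A] : Loop ι A →ₗ[A] Loop ι A where
  toFun := act φ M
  map_add' f h := Matrix.mulVec_add _ _ _
  map_smul' c f := by
    rw [smul_eq_C_smul, act, Matrix.mulVec_smul, RingHom.id_apply, smul_eq_C_smul]
    rfl

theorem actLin_apply (f : Loop ι A) : actLin φ M A f = act φ M f := rfl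

theorem act_one (f : Loop ι A) : act φ (1 : (Module.End k H)⸨X⸩) f = f := by
  rw [act, loopMatrix_one, Matrix.map_one _ (map_zero _) (map_one _), Matrix.one_mulVec]

theorem act_mul (f : Loop ι A) : act φ (M * N) f = act φ M (act φ N f) := by
  rw [act, act, act, loopMatrix_mul, Matrix.map_mul, Matrix.mulVec_mulVec]

theorem act_zmul (f : Loop ι A) : act φ M (zmul f) = zmul (act φ M f) := by
  have h : ∀ f : Loop ι A, zmul f = (HahnSeries.single (-1) (1 : A) : A⸨X⸩) • f := fun f => rfl
  rw [h, h, act, Matrix.mulVec_smul]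
  rfl

theorem act_extend (x : Loop ι k) : act φ M (extend A x) = extend A (act φ M x) := by
  funext α
  change _ = extendHom k A _
  rw [act, act, RingHom.map_mulVec, Matrix.map_map]
  congr 1

theorem act_evalMap {t : (ι × ℕ) →₀ A} (ht : ∀ i, IsNilpotent (t i))
    (Φ : ((ι × ℕ) →₀ ℕ) → Loop ι k) :
    act φ M (evalMap Φ t) = evalMap (fun m => act φ M (Φ m)) t := by
  obtain ⟨n, hn⟩ := exists_kills ht
  rw [evalMap_eq_sum hn, evalMap_eq_sum hn, ← actLin_apply, map_sum]
  refine Finset.sum_congr rfl fun m _ => ?_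
  rw [map_smul, actLin_apply, act_extend]

/-- The entries of `M` come from `k` and have no ε-part. This is why tangent spaces are transported
by the action. -/
theorem act_addEps (f v : Loop ι A) :
    act φ M (addEps f v) = addEps (act φ M f) (act φ M v) := by
  funext α
  change ∑ β, extendHom k (DualNumber A) (loopMatrix φ M α β) * (_ + _) =
    (∑ β, extendHom k A (loopMatrix φ M α β) * f β).map (TrivSqZeroExt.inlHom A A) +
      (∑ β, extendHom k A (loopMatrix φ M α β) * v β).map (TrivSqZeroExt.inrHom A A)
  rw [sum_map_inl, sum_map_inr, ← Finset.sum_add_distrib]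
  refine Finset.sum_congr rfl fun β _ => ?_
  rw [mul_add, extendHom_dualNumber, map_inl_mul_map_inl, map_inl_mul_map_inr]

theorem isNilpotent_coeff_act {f : Loop ι A} (hf : ∀ α n, IsNilpotent ((f α).coeff n)) (α : ι)
    (n : ℤ) : IsNilpotent ((act φ M f α).coeff n) := by
  rw [act, Matrix.mulVec, dotProduct, HahnSeries.coeff_sum]
  refine isNilpotent_sum fun β _ => ?_
  rw [HahnSeries.coeff_mul]
  exact isNilpotent_sum fun ij _ => (Commute.all _ _).isNilpotent_mul_left (hf β ij.2)

theorem IsNear.act {f₀ : Loop ι k} {f : Loop ι A} (h : IsNear f₀ f) :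
    IsNear (act φ M f₀) (act φ M f) := by
  intro α n
  have h1 : ∀ α n, IsNilpotent (((f - extend A f₀) α).coeff n) := fun α n => h α n
  have h2 := isNilpotent_coeff_act φ M h1 α n
  rw [← actLin_apply, map_sub, actLin_apply, actLin_apply, act_extend] at h2
  exact h2

variable [FiniteDimensional k H] {η : LinearMap.BilinForm k H} (hsymm : η.IsSymm)
  {hη : η.Nondegenerate} {M}

-- Passes from the basis-free adjoint to matrices: with G the Gram matrix, M*(-z)M(z) = 1 turns into
-- M(-z)ᵀ G M(z) = G, the form in which Ω-invariance is read off.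
include hsymm in
theorem loopMatrix_adjNegZ : ((loopMatrix φ M).map (negZHom k)).transpose *
    (gram η φ).map (HahnSeries.C : k →+* k⸨X⸩) =
      (gram η φ).map (HahnSeries.C : k →+* k⸨X⸩) * loopMatrix φ (adjNegZ η hη M) := by
  ext α β n
  simp only [Matrix.mul_apply, Matrix.transpose_apply, Matrix.map_apply, HahnSeries.coeff_sum]
  have h1 : ∀ γ, (negZHom k (loopMatrix φ M γ α) *
      (HahnSeries.C (gram η φ γ β) : k⸨X⸩)).coeff n =
      (n.negOnePow : ℤˣ) • (gram η φ γ β * φ.repr (M.coeff n (φ α)) γ) := by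
    intro γ
    rw [mul_comm, HahnSeries.C_mul_eq_smul, HahnSeries.coeff_smul]
    change _ • ((n.negOnePow : ℤˣ) • _) = _
    rw [coeff_loopMatrix, smul_eq_mul, mul_smul_comm]
  have h2 : ∀ γ, ((HahnSeries.C (gram η φ α γ) : k⸨X⸩) *
      loopMatrix φ (adjNegZ η hη M) γ β).coeff n =
      (n.negOnePow : ℤˣ) • (gram η φ α γ * φ.repr (adj η hη (M.coeff n) (φ β)) γ) := by
    intro γ
    rw [HahnSeries.C_mul_eq_smul, HahnSeries.coeff_smul, coeff_loopMatrix, coeff_adjNegZ,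
      Units.smul_def, Units.smul_def, LinearMap.smul_apply, map_zsmul, Finsupp.smul_apply,
      smul_eq_mul, mul_smul_comm]
  simp_rw [h1, h2, ← Finset.smul_sum]
  congr 1
  have h3 : ∑ γ, gram η φ α γ * φ.repr (adj η hη (M.coeff n) (φ β)) γ =
      η (φ α) (adj η hη (M.coeff n) (φ β)) := by
    conv_rhs => rw [← φ.sum_repr (adj η hη (M.coeff n) (φ β)), map_sum]
    refine Finset.sum_congr rfl fun γ _ => ?_
    rw [map_smul, smul_eq_mul, mul_comm]
    rfl
  have h4 : ∑ γ, gram η φ γ β * φ.repr (M.coeff n (φ α)) γ = η (φ β) (M.coeff n (φ α)) := by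
    conv_rhs => rw [← φ.sum_repr (M.coeff n (φ α)), map_sum]
    refine Finset.sum_congr rfl fun γ _ => ?_
    rw [map_smul, smul_eq_mul, mul_comm, gram, hsymm.eq (φ γ) (φ β)]
  rw [h3, h4, ← adj_spec η hη, hsymm.eq (adj η hη (M.coeff n) (φ β)) (φ α)]

theorem omega_eq_dotProduct (f h : Loop ι A) : omega η φ f h =
    zcoeff ((fun α => negZ (f α)) ⬝ᵥ
      (((gram η φ).map (HahnSeries.C : k →+* k⸨X⸩)).map (extendHom k A)).mulVec h) (-1) := by
  rw [omega]
  congr 1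
  refine Finset.sum_congr rfl fun α _ => ?_
  rw [Matrix.mulVec, dotProduct, Finset.mul_sum]
  refine Finset.sum_congr rfl fun β _ => ?_
  have : extendHom k A (HahnSeries.C (η (φ α) (φ β))) =
      HahnSeries.C (algebraMap k A (η (φ α) (φ β))) := HahnSeries.map_C _ _
  rw [Matrix.map_apply, Matrix.map_apply, gram, this, mul_left_comm, HahnSeries.C_mul_eq_smul]
  ext n
  simp [Algebra.smul_def]

include hsymm in
theorem omega_act (hM : M ∈ twistedLoopGroup η hη) (f h : Loop ι A) :
    omega η φ (act φ M f) (act φ M h) = omega η φ f h := by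
  have hM' : adjNegZ η hη M * M = 1 := hM
  have hkey : ((loopMatrix φ M).map (negZHom k)).transpose *
      (gram η φ).map (HahnSeries.C : k →+* k⸨X⸩) * loopMatrix φ M =
        (gram η φ).map (HahnSeries.C : k →+* k⸨X⸩) := by
    rw [loopMatrix_adjNegZ φ hsymm (hη := hη), mul_assoc, ← loopMatrix_mul, hM', loopMatrix_one,
      mul_one]
  have hneg : (fun α => negZ (act φ M f α)) =
      (((loopMatrix φ M).map (negZHom k)).map (extendHom k A)).mulVec fun α => negZ (f α) := by
    funext α
    change negZHom A _ = _
    rw [act, RingHom.map_mulVec, Matrix.map_map, Matrix.map_map]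
    congr 1
    ext1 β γ
    exact negZ_extendHom _
  rw [omega_eq_dotProduct, omega_eq_dotProduct, hneg, act, Matrix.mulVec_mulVec, dotProduct_comm,
    Matrix.dotProduct_mulVec, ← Matrix.mulVec_transpose, Matrix.mulVec_mulVec, dotProduct_comm,
    ← Matrix.transpose_map, ← mul_assoc, ← Matrix.map_mul, ← Matrix.map_mul, hkey]

variable (M) in
theorem act_injective (hM : M ∈ twistedLoopGroup η hη) :
    Function.Injective (act φ M : Loop ι A → Loop ι A) := by
  have hM' : adjNegZ η hη M * M = 1 := hM
  exact Function.LeftInverse.injective (g := act φ (adjNegZ η hη M)) fun f => by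
    rw [← act_mul, hM', act_one]

theorem act_surjective (hM : M ∈ twistedLoopGroup η hη) :
    Function.Surjective (act φ M : Loop ι A → Loop ι A) := fun f =>
  ⟨act φ (adjNegZ η hη M) f, by rw [← act_mul, mul_adjNegZ η hη hM, act_one]⟩

theorem tangent_actGerm (hM : M ∈ twistedLoopGroup η hη) (X : Germ k ι) [IsTestAlgebra k A]
    (f : Loop ι A) : tangent (actGerm φ M X) (act φ M f) = act φ M '' tangent X f := by
  ext v
  obtain ⟨v, rfl⟩ := act_surjective φ hM v
  change addEps _ _ ∈ act φ M '' X (DualNumber A) ↔ _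
  rw [← act_addEps, (act_injective φ M hM).mem_set_image, (act_injective φ M hM).mem_set_image]
  rfl

include hsymm

theorem IsStarCone.actGerm (hM : M ∈ twistedLoopGroup η hη) {f₀ : Loop ι k} {X : Germ k ι}
    (h : IsStarCone η φ f₀ X) : IsStarCone η φ (act φ M f₀) (actGerm φ M X) where
  ne_zero h0 := h.ne_zero (act_injective φ M hM (by rw [h0]; exact (map_zero (actLin φ M k)).symm))
  submanifold := by
    obtain ⟨Φ, h1, h2, h3⟩ := h.submanifold
    refine ⟨fun m => act φ M (Φ m), congrArg _ h1, ?_, fun A _ _ _ => ?_⟩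
    · exact h2.map' (actLin φ M k) (LinearMap.ker_eq_bot.2 (act_injective φ M hM))
    · rw [Givental.actGerm, h3]
      ext f
      constructor
      · rintro ⟨_, ⟨t, ht, rfl⟩, rfl⟩
        exact ⟨t, ht, act_evalMap φ M ht Φ⟩
      · rintro ⟨t, ht, rfl⟩
        exact ⟨_, ⟨t, ht, rfl⟩, act_evalMap φ M ht Φ⟩
  lagrangian := by
    rintro A _ _ _ _ ⟨f, hf, rfl⟩
    ext v
    obtain ⟨v, rfl⟩ := act_surjective φ hM v
    rw [tangent_actGerm φ hM, (act_injective φ M hM).mem_set_image, h.lagrangian A f hf,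
      Set.mem_ofPred_eq, Set.mem_ofPred_eq, ← h.lagrangian A f hf, Set.forall_mem_image]
    simp_rw [omega_act φ hsymm hM]
  cone := by
    rintro A _ _ _ _ ⟨f, hf, rfl⟩ c hc
    exact ⟨c • f, h.cone A f hf c hc, map_smul (actLin φ M A) c f⟩
  tangent_along := by
    rintro A _ _ _ _ ⟨f, hf, rfl⟩
    obtain ⟨h1, h2⟩ := h.tangent_along A f hf
    rw [tangent_actGerm φ hM]
    constructor
    · rintro _ ⟨v, hv, rfl⟩
      exact ⟨zmul v, h1 v hv, act_zmul φ M v⟩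
    · ext g
      obtain ⟨g, rfl⟩ := act_surjective φ hM g
      have h3 := Set.ext_iff.1 h2 g
      simp only [Set.mem_ofPred_eq] at h3 ⊢
      rw [tangent_actGerm φ hM, (act_injective φ M hM).image_injective.eq_iff]
      have h4 : act φ M g ∈ Givental.actGerm φ M X A ↔ g ∈ X A :=
        (act_injective φ M hM).mem_set_image
      have h5 : act φ M g ∈ zmul '' (act φ M '' tangent X f) ↔ g ∈ zmul '' tangent X f := by
        rw [← (act_injective φ M hM).mem_set_image (s := zmul '' tangent X f), Set.image_image,
          Set.image_image]
        simp_rw [act_zmul]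
      have h6 : IsNear (act φ M f₀) (act φ M g) ↔ IsNear f₀ g := by
        refine ⟨fun h => ?_, fun h => h.act φ M⟩
        have hM' : adjNegZ η hη M * M = 1 := hM
        have := h.act φ (adjNegZ η hη M)
        rwa [← act_mul, ← act_mul, hM', act_one, act_one] at this
      rw [h4, h5, h6, h3]

theorem isStarCone_actGerm_iff (M : twistedLoopGroup η hη) {f₀ : Loop ι k} {X : Germ k ι} :
    IsStarCone η φ f₀ X ↔ IsStarCone η φ (act φ M.1 f₀) (actGerm φ M.1 X) := by
  refine ⟨fun h => h.actGerm φ hsymm M.2, fun h => ?_⟩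
  have h1 := h.actGerm φ hsymm (M⁻¹).2
  rwa [← act_mul, ← actGerm_mul, show (M⁻¹).1 * M.1 = 1 from congrArg Subtype.val
    (inv_mul_cancel M), act_one, actGerm_one] at h1

end Action

/-! ### Transverse germs are graphs -/

section Transverse

set_option linter.unusedSectionVars false

variable {k : Type u} {H : Type v} {ι : Type w} [Field k] [AddCommGroup H] [Module k H]
  [Fintype ι] [DecidableEq ι] {A : Type u} [CommRing A] [Algebra k A]

/-- A formal function differs between two points by its linear part, up to higher order. -/
theorem evalSeries_sub_sub_mem {t t' : (ι × ℕ) →₀ A} (ht : ∀ i, IsNilpotent (t i))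
    (ht' : ∀ i, IsNilpotent (t' i)) {J : Ideal A} (hJ : ∀ i, t i - t' i ∈ J)
    (G : MvPowerSeries (ι × ℕ) k) :
    evalSeries G t - evalSeries G t' - Finsupp.linearCombination A
      (fun l => algebraMap k A (MvPowerSeries.coeff (Finsupp.single l 1) G)) (t - t') ∈
        nilradical A * J := by
  obtain ⟨n₁, h₁⟩ := exists_kills ht
  obtain ⟨n₂, h₂⟩ := exists_kills ht'
  have h1 := h₁.mono (n' := n₁ + n₂) le_self_add
  have h2 := h₂.mono (n' := n₁ + n₂) le_add_self
  -- The induction needs all three estimates at once: multiplying P by X_j, the remainder becomes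
  -- (P(t) - P(t'))·t_j + (P(t') - P(0))·(t_j - t'_j).
  have hpoly : ∀ P : MvPolynomial (ι × ℕ) k,
      MvPolynomial.aeval t P - MvPolynomial.aeval t' P - Finsupp.linearCombination A
        (fun l => algebraMap k A (P.coeff (Finsupp.single l 1))) (t - t') ∈ nilradical A * J ∧
      MvPolynomial.aeval t P - MvPolynomial.aeval t' P ∈ J ∧
      MvPolynomial.aeval t' P - algebraMap k A (MvPolynomial.constantCoeff P) ∈ nilradical A := by
    intro P
    induction P using MvPolynomial.induction_on with
    | C c =>
      have : ∀ l : ι × ℕ, (MvPolynomial.C c : MvPolynomial (ι × ℕ) k).coeff (Finsupp.single l 1) = 0 :=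
        fun l => by
          rw [MvPolynomial.coeff_C, if_neg]
          exact (Finsupp.single_ne_zero.2 one_ne_zero).symm
      simp [this, Finsupp.linearCombination_apply]
    | add P Q hP hQ =>
      refine ⟨?_, ?_, ?_⟩
      · convert Ideal.add_mem _ hP.1 hQ.1 using 1
        simp only [map_add, MvPolynomial.coeff_add, Finsupp.linearCombination_apply, Finsupp.sum,
          smul_eq_mul, mul_add, Finset.sum_add_distrib]
        ring
      · convert Ideal.add_mem _ hP.2.1 hQ.2.1 using 1
        simp only [map_add]
        ring
      · convert Ideal.add_mem _ hP.2.2 hQ.2.2 using 1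
        simp only [map_add]
        ring
    | mul_X P j hP =>
      have hc : Finsupp.linearCombination A (fun l => algebraMap k A
          ((P * MvPolynomial.X j).coeff (Finsupp.single l 1))) (t - t') =
          (t j - t' j) * algebraMap k A (MvPolynomial.constantCoeff P) := by
        have hl : ∀ l, (P * MvPolynomial.X j).coeff (Finsupp.single l 1) =
            if l = j then MvPolynomial.constantCoeff P else 0 := by
          intro l
          rw [MvPolynomial.coeff_mul_X']
          by_cases h : l = j
          · subst h
            simp [MvPolynomial.constantCoeff_eq]
          · rw [if_neg h, if_neg (by simpa using Ne.symm h)]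
        simp_rw [hl]
        rw [Finsupp.linearCombination_apply, Finsupp.sum_eq_single j]
        · simp
        · intro l _ hlj
          simp [hlj]
        · simp
      refine ⟨?_, ?_, ?_⟩
      · rw [hc]
        have e1 : (MvPolynomial.aeval t P - MvPolynomial.aeval t' P) * t j ∈ nilradical A * J :=
          Ideal.mul_mem_mul_rev (mem_nilradical.2 (ht j)) hP.2.1
        have e2 : (MvPolynomial.aeval t' P - algebraMap k A (MvPolynomial.constantCoeff P)) *
            (t j - t' j) ∈ nilradical A * J := Ideal.mul_mem_mul hP.2.2 (hJ j)
        convert Ideal.add_mem _ e1 e2 using 1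
        simp only [map_mul, MvPolynomial.aeval_X]
        ring
      · convert Ideal.add_mem _ (Ideal.mul_mem_right (t j) _ hP.2.1)
          (Ideal.mul_mem_left _ (MvPolynomial.aeval t' P) (hJ j)) using 1
        simp only [map_mul, MvPolynomial.aeval_X]
        ring
      · simp only [map_mul, MvPolynomial.aeval_X, MvPolynomial.constantCoeff_X, mul_zero, map_zero,
          sub_zero]
        exact Ideal.mul_mem_left _ _ (mem_nilradical.2 (ht' j))
  rw [evalSeries_eq_aeval h1, evalSeries_eq_aeval h2]
  convert (hpoly (MvPowerSeries.trunc' k (n₁ + n₂) G)).1 using 2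
  rw [Finsupp.linearCombination_apply, Finsupp.linearCombination_apply]
  refine Finsupp.sum_congr fun l hl => ?_
  congr 2
  -- The truncation keeps the linear coefficient at `l` unless the bound there is 0; in that case
  -- both points have entry 0 at `l`, which then does not occur in the sum.
  rw [MvPowerSeries.coeff_trunc', if_pos]
  intro i
  rw [Finsupp.single_apply]
  split_ifs with hli
  · subst hli
    by_contra h
    have h0 : (n₁ + n₂) l = 0 := by omega
    have e1 := h1 l
    have e2 := h2 l
    rw [h0, zero_add, pow_one] at e1 e2
    rw [Finsupp.mem_support_iff, Finsupp.sub_apply, e1, e2, sub_zero] at hl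
    exact hl rfl
  · exact Nat.zero_le _

theorem linearCombination_apply_mem {J : Ideal A} {p : (ι × ℕ) →₀ A} (hp : ∀ i, p i ∈ J)
    (c : ι × ℕ → (ι × ℕ) →₀ A) (i : ι × ℕ) : Finsupp.linearCombination A c p i ∈ J := by
  rw [Finsupp.linearCombination_apply, Finsupp.sum_apply, Finsupp.sum]
  exact Ideal.sum_mem _ fun l _ => by
    rw [Finsupp.smul_apply, smul_eq_mul]
    exact Ideal.mul_mem_right _ _ (hp l)

theorem linearCombination_ext (T : ((ι × ℕ) →₀ k) →ₗ[k] ((ι × ℕ) →₀ k)) (x : (ι × ℕ) →₀ k) :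
    Finsupp.linearCombination A (fun i => ext A (T (Finsupp.single i 1))) (ext A x) =
      ext A (T x) := by
  have hadd : ∀ x y : (ι × ℕ) →₀ k, ext A (x + y) = ext A x + ext A y := fun x y =>
    Finsupp.mapRange_add (map_add _) x y
  have hsmul : ∀ (c : k) (x : (ι × ℕ) →₀ k), ext A (c • x) = algebraMap k A c • ext A x :=
    fun c x => by
      ext i
      simp [ext_apply, Algebra.smul_def]
  induction x using Finsupp.induction_linear with
  | zero => simp [ext]
  | add x y hx hy => rw [hadd, map_add, hx, hy, map_add, hadd]
  | single i c =>
    have : Finsupp.single i c = c • Finsupp.single i (1 : k) := by simp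
    rw [this, map_smul, hsmul, hsmul, map_smul]
    congr 1
    have : ext A (Finsupp.single i (1 : k)) = Finsupp.single i 1 := by
      rw [ext, Finsupp.mapRange_single, map_one]
    rw [this, Finsupp.linearCombination_single, one_smul]

/-- The linear part of the projection of a formal map to `H[z]`. -/
def linPart (Φ : ((ι × ℕ) →₀ ℕ) → Loop ι k) : ((ι × ℕ) →₀ k) →ₗ[k] ((ι × ℕ) →₀ k) :=
  Finsupp.linearCombination k fun i => pos (Φ (Finsupp.single i 1))

/-- The formal inverse function theorem. -/
theorem existsUnique_pos_evalMap [IsTestAlgebra k A] {Φ : ((ι × ℕ) →₀ ℕ) → Loop ι k}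
    (hΦ : Function.Bijective (linPart Φ)) {s : (ι × ℕ) →₀ A} (hs : ∀ i, IsNilpotent (s i)) :
    ∃! t : (ι × ℕ) →₀ A, (∀ i, IsNilpotent (t i)) ∧
      pos (evalMap Φ t) = ext A (pos (Φ 0)) + s := by
  let L := LinearEquiv.ofBijective (linPart Φ) hΦ
  let LA := Finsupp.linearCombination A fun i => ext A (L (Finsupp.single i 1))
  let KA := Finsupp.linearCombination A fun i => ext A (L.symm (Finsupp.single i 1))
  have hsingle : ∀ i : ι × ℕ, Finsupp.single i (1 : A) = ext A (Finsupp.single i (1 : k)) := by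
    intro i
    rw [ext, Finsupp.mapRange_single, map_one]
  have hLK : ∀ x, LA (KA x) = x := by
    intro x
    have : LA ∘ₗ KA = LinearMap.id := by
      refine Finsupp.lhom_ext' fun i => LinearMap.ext_ring ?_
      simp only [LinearMap.comp_apply, Finsupp.lsingle_apply, LinearMap.id_apply]
      rw [Finsupp.linearCombination_single, one_smul]
      refine (linearCombination_ext L.toLinearMap _).trans ?_
      rw [hsingle]
      exact congrArg _ (L.apply_symm_apply _)
    exact LinearMap.congr_fun this x
  have hKL : ∀ x, KA (LA x) = x := by
    intro x
    have : KA ∘ₗ LA = LinearMap.id := by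
      refine Finsupp.lhom_ext' fun i => LinearMap.ext_ring ?_
      simp only [LinearMap.comp_apply, Finsupp.lsingle_apply, LinearMap.id_apply]
      rw [Finsupp.linearCombination_single, one_smul]
      refine (linearCombination_ext L.symm.toLinearMap _).trans ?_
      rw [hsingle]
      exact congrArg _ (L.symm_apply_apply _)
    exact LinearMap.congr_fun this x
  -- The linearization error lies one power of the nilradical deeper than t - t'. Newton iteration
  -- with the fixed inverse `KA` therefore terminates, and two solutions agree modulo every power of
  -- the nilradical, which is nilpotent.
  have hest : ∀ (t t' : (ι × ℕ) →₀ A), (∀ i, IsNilpotent (t i)) → (∀ i, IsNilpotent (t' i)) →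
      ∀ J : Ideal A, (∀ i, (t - t') i ∈ J) →
      ∀ i, (pos (evalMap Φ t) - pos (evalMap Φ t') - LA (t - t')) i ∈ nilradical A * J := by
    intro t t' ht ht' J hJ i
    rw [Finsupp.sub_apply, Finsupp.sub_apply, pos_evalMap ht, pos_evalMap ht']
    convert evalSeries_sub_sub_mem ht ht' hJ (ofCoeff fun m => pos (Φ m) i) using 2
    rw [Finsupp.linearCombination_apply, Finsupp.sum_apply, Finsupp.linearCombination_apply]
    refine Finsupp.sum_congr fun l _ => ?_
    rw [Finsupp.smul_apply, ext_apply, coeff_ofCoeff]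
    congr 3
    change linPart Φ _ = _
    rw [linPart, Finsupp.linearCombination_single, one_smul]
  have hnil : ∃ n, nilradical A ^ n = 0 := by
    have := IsTestAlgebra.finite (k := k) (A := A)
    have : IsNoetherianRing A := isNoetherian_of_tower k inferInstance
    exact IsNoetherianRing.isNilpotent_nilradical A
  obtain ⟨n, hn⟩ := hnil
  refine existsUnique_of_exists_of_unique ?_ ?_
  · have step : ∀ j : ℕ, ∃ t : (ι × ℕ) →₀ A, (∀ i, IsNilpotent (t i)) ∧
        ∀ i, (ext A (pos (Φ 0)) + s - pos (evalMap Φ t)) i ∈ nilradical A ^ (j + 1) := by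
      intro j
      induction j with
      | zero =>
        refine ⟨0, fun i => by simp, fun i => ?_⟩
        rw [Finsupp.sub_apply, pos_evalMap (fun i => by simp), evalSeries_zero_point,
          Finsupp.add_apply, zero_add, pow_one]
        have : MvPowerSeries.constantCoeff (ofCoeff fun m => pos (Φ m) i) = pos (Φ 0) i := rfl
        rw [this, ext_apply, add_sub_cancel_left]
        exact mem_nilradical.2 (hs i)
      | succ j ih =>
        obtain ⟨t, ht, hj⟩ := ih
        have hu := linearCombination_apply_mem hj fun i => ext A (L.symm (Finsupp.single i 1))
        change ∀ i, KA _ i ∈ _ at hu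
        set u := KA (ext A (pos (Φ 0)) + s - pos (evalMap Φ t)) with hu_def
        have ht' : ∀ i, IsNilpotent ((t + u) i) := fun i =>
          (Commute.all _ _).isNilpotent_add (ht i)
            (mem_nilradical.1 (Ideal.pow_le_self (Nat.succ_ne_zero j) (hu i)))
        refine ⟨t + u, ht', fun i => ?_⟩
        have := hest (t + u) t ht' ht _ (fun i => by rw [add_sub_cancel_left]; exact hu i) i
        rw [add_sub_cancel_left, hu_def, hLK, ← hu_def, ← pow_succ'] at this
        rw [← neg_mem_iff, ← Finsupp.neg_apply]
        convert this using 2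
        abel
    obtain ⟨t, ht, h⟩ := step n
    refine ⟨t, ht, ?_⟩
    ext i
    have := h i
    rw [pow_succ, hn, zero_mul, Ideal.zero_eq_bot, Ideal.mem_bot, Finsupp.sub_apply,
      sub_eq_zero] at this
    exact this.symm
  · rintro t t' ⟨ht, h⟩ ⟨ht', h'⟩
    have step : ∀ j : ℕ, ∀ i, (t - t') i ∈ nilradical A ^ j := by
      intro j
      induction j with
      | zero => intro i; simp
      | succ j ih =>
        have h1 : ∀ i, LA (t - t') i ∈ nilradical A ^ (j + 1) := by
          intro i
          have := hest t t' ht ht' _ ih i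
          rwa [h, h', sub_self, zero_sub, Finsupp.neg_apply, neg_mem_iff, ← pow_succ'] at this
        have h2 := linearCombination_apply_mem h1 fun i => ext A (L.symm (Finsupp.single i 1))
        change ∀ i, KA _ i ∈ _ at h2
        rwa [hKL] at h2
    rw [← sub_eq_zero]
    ext i
    have := step n i
    rwa [hn, Ideal.zero_eq_bot, Ideal.mem_bot] at this

/-- The formal Poincaré lemma. -/
theorem exists_potential [CharZero k] (P : ι × ℕ → MvPowerSeries (ι × ℕ) k)
    (hP : ∀ i j, pd i.1 i.2 (P j) = pd j.1 j.2 (P i)) :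
    ∃ G : MvPowerSeries (ι × ℕ) k, ∀ j, pd j.1 j.2 G = P j := by
  have hne : ∀ m : (ι × ℕ) →₀ ℕ, m ≠ 0 → ∃ j, m j ≠ 0 := fun m hm => by
    by_contra h
    push Not at h
    exact hm (Finsupp.ext h)
  -- The coefficient is forced by the j-th equation for any j with `m j ≠ 0`; closedness makes it
  -- independent of the chosen j.
  let G : MvPowerSeries (ι × ℕ) k := ofCoeff fun m => if hm : m = 0 then 0 else
    MvPowerSeries.coeff (m - Finsupp.single (hne m hm).choose 1) (P (hne m hm).choose) /
      m (hne m hm).choose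
  have hcast : ∀ n : ℕ, (n : k) + 1 ≠ 0 := fun n => Nat.cast_add_one_ne_zero n
  refine ⟨G, fun j => ?_⟩
  ext m
  have hm : m + Finsupp.single j 1 ≠ 0 := fun h => by
    have := DFunLike.congr_fun h j
    simp at this
  rw [pd, MvPowerSeries.coeff_pderiv, coeff_ofCoeff, dif_neg hm]
  suffices key : ∀ j', (m + Finsupp.single j 1 : (ι × ℕ) →₀ ℕ) j' ≠ 0 →
      MvPowerSeries.coeff (m + Finsupp.single j 1 - Finsupp.single j' 1) (P j') /
        ((m + Finsupp.single j 1 : (ι × ℕ) →₀ ℕ) j' : k) * ((m j : k) + 1) = MvPowerSeries.coeff m (P j) from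
    key _ (hne _ hm).choose_spec
  intro j' hj'
  by_cases h : j' = j
  · rw [h, add_tsub_cancel_right, Finsupp.add_apply, Finsupp.single_eq_same]
    push_cast
    rw [div_mul_cancel₀ _ (hcast _)]
  · rw [Finsupp.add_apply, Finsupp.single_eq_of_ne h, add_zero] at hj' ⊢
    have hle : Finsupp.single j' 1 ≤ m := Finsupp.single_le_iff.2 (Nat.one_le_iff_ne_zero.2 hj')
    obtain ⟨n, rfl⟩ := le_iff_exists_add'.1 hle
    have h1 : n + Finsupp.single j' 1 + Finsupp.single j 1 - Finsupp.single j' 1 =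
        n + Finsupp.single j 1 := by
      rw [add_right_comm, add_tsub_cancel_right]
    have h2 := congrArg (MvPowerSeries.coeff n) (hP j j')
    simp only [pd, Prod.mk.eta, MvPowerSeries.coeff_pderiv] at h2
    rw [h1, Finsupp.add_apply, Finsupp.add_apply, Finsupp.single_eq_same,
      Finsupp.single_eq_of_ne (Ne.symm h)]
    push_cast
    rw [add_zero, div_mul_eq_mul_div, div_eq_iff (hcast _)]
    exact h2

end Transverse

/-! ### Transverse Lagrangian germs as graphs of differentials, and uniqueness of the generating
function. -/

section GraphOfTransverse

set_option linter.unusedSectionVars false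

variable {k : Type u} {H : Type v} {ι : Type w} [Field k] [AddCommGroup H] [Module k H]
  [Fintype ι] [DecidableEq ι]

theorem isNegative_iff {A : Type u} [CommRing A] {f : Loop ι A} : IsNegative f ↔ pos f = 0 :=
  ⟨fun h => Finsupp.ext fun i => h i.1 i.2, fun h α n => DFunLike.congr_fun h (α, n)⟩

variable {η : LinearMap.BilinForm k H} (hsymm : η.IsSymm) (hη : η.Nondegenerate)
  (φ : Module.Basis ι k H)

include hsymm hη φ

/-- First-order Taylor expansion at the base point: it identifies the tangent space there with the
span of the degree-one coefficients of `Φ`. -/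
theorem addEps_eq_evalMap {Φ : ((ι × ℕ) →₀ ℕ) → Loop ι k} (u : (ι × ℕ) →₀ k) :
    addEps (Φ 0) (Finsupp.linearCombination k (fun i => Φ (Finsupp.single i 1)) u) =
      evalMap Φ (dualPoint 0 u) := by
  have h0 : ∀ i, IsNilpotent ((0 : (ι × ℕ) →₀ k) i) := fun i => by simp
  have hd := isNilpotent_dualPoint h0 u
  have hfst : ∀ c : ((ι × ℕ) →₀ ℕ) → k, (evalSeries (ofCoeff c) (dualPoint 0 u)).fst = c 0 := by
    intro c
    rw [fst_evalSeries_dualPoint h0, evalSeries_zero_point]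
    rfl
  have hsnd : ∀ c : ((ι × ℕ) →₀ ℕ) → k, (evalSeries (ofCoeff c) (dualPoint 0 u)).snd =
      Finsupp.linearCombination k (fun i => c (Finsupp.single i 1)) u := by
    intro c
    rw [snd_evalSeries_dualPoint h0]
    congr 2
    funext i
    rw [evalSeries_zero_point, ← MvPowerSeries.coeff_zero_eq_constantCoeff_apply, pd,
      MvPowerSeries.coeff_pderiv, coeff_ofCoeff]
    simp
  refine loop_ext (gram_isUnit_det hη φ) (gram_isSymm hsymm φ) (Finsupp.ext fun i => ?_)
    (funext fun j => ?_)
  · rw [pos_evalMap hd, pos_addEps]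
    ext
    · rw [fst_dualPoint, hfst]
    · rw [snd_dualPoint, hsnd, ← LinearMap.comp_apply]
      simp [Finsupp.linearCombination_apply, Finsupp.sum, map_sum]
  · rw [neg_evalMap _ hd]
    ext
    · rw [fst_neg_addEps, hfst]
    · rw [snd_neg_addEps, hsnd]
      simp [Finsupp.linearCombination_apply, Finsupp.sum, map_sum]

/-- Complementarity to z⁻¹H[[z⁻¹]] says that q maps the tangent space at the base point bijectively
onto H[z]; linear independence identifies that tangent space with the parameter space. -/
theorem bijective_linPart {Φ : ((ι × ℕ) →₀ ℕ) → Loop ι k} {X : Germ k ι}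
    (hlin : LinearIndependent k fun i : ι × ℕ => Φ (Finsupp.single i 1))
    (hX : ∀ (A : Type u) [CommRing A] [Algebra k A] [IsTestAlgebra k A],
      X A = {f | ∃ t : (ι × ℕ) →₀ A, (∀ i, IsNilpotent (t i)) ∧ f = evalMap Φ t})
    (ht : IsTransverse X) : Function.Bijective (linPart Φ) := by
  have hg := gram_isUnit_det hη φ
  have hs' := gram_isSymm hsymm φ
  have h0 : ∀ i, IsNilpotent ((0 : (ι × ℕ) →₀ k) i) := fun i => by simp
  have hΦ0 : evalMap Φ (0 : (ι × ℕ) →₀ k) = Φ 0 := by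
    refine loop_ext hg hs' (Finsupp.ext fun i => ?_) (funext fun j => ?_)
    · rw [pos_evalMap h0, evalSeries_zero_point]
      rfl
    · rw [neg_evalMap _ h0, evalSeries_zero_point]
      rfl
  have hmem : Φ 0 ∈ X k := by
    rw [hX]
    exact ⟨0, h0, hΦ0.symm⟩
  let T := Finsupp.linearCombination k fun i : ι × ℕ => Φ (Finsupp.single i 1)
  have hT : ∀ v : Loop ι k, v ∈ tangent X (Φ 0) ↔ ∃ u, v = T u := by
    intro v
    change addEps (Φ 0) v ∈ X (DualNumber k) ↔ _
    rw [hX]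
    constructor
    · rintro ⟨t, ht, hv⟩
      have htu : t = dualPoint 0 (t.mapRange TrivSqZeroExt.snd TrivSqZeroExt.snd_zero) := by
        ext i
        · rw [fst_dualPoint, Finsupp.zero_apply]
          have := ht i
          rw [TrivSqZeroExt.isNilpotent_iff_isNilpotent_fst] at this
          exact this.eq_zero
        · rw [snd_dualPoint, Finsupp.mapRange_apply]
      refine ⟨t.mapRange TrivSqZeroExt.snd TrivSqZeroExt.snd_zero, ?_⟩
      rw [htu, ← addEps_eq_evalMap hsymm hη φ] at hv
      refine loop_ext hg hs' (Finsupp.ext fun i => ?_) (funext fun j => ?_)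
      · have := congrArg (fun f => (pos f i).snd) hv
        simpa only [pos_addEps, snd_dualPoint] using this
      · have := congrArg (fun f => (neg (gram η φ) f j).snd) hv
        simpa only [snd_neg_addEps] using this
    · rintro ⟨u, rfl⟩
      exact ⟨dualPoint 0 u, isNilpotent_dualPoint h0 u, addEps_eq_evalMap hsymm hη φ u⟩
  have hLT : ∀ u, linPart Φ u = pos (T u) := by
    intro u
    simp [linPart, T, Finsupp.linearCombination_apply, Finsupp.sum, map_sum]
  constructor
  · rw [injective_iff_map_eq_zero]
    intro u hu
    obtain ⟨l, -, huniq⟩ := ht (Φ 0) hmem 0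
    have h1 := huniq (T u) ⟨(hT _).2 ⟨u, rfl⟩, by
      rw [isNegative_iff, map_sub, ← hLT, hu, map_zero, sub_zero]⟩
    have h2 := huniq 0 ⟨(hT _).2 ⟨0, (map_zero T).symm⟩, by
      rw [isNegative_iff, sub_zero, map_zero]⟩
    exact hlin ((h1.trans h2.symm).trans (map_zero T).symm)
  · intro p
    obtain ⟨l, ⟨hl, hneg⟩, -⟩ := ht (Φ 0) hmem (mkLoop (gram η φ) p 0)
    obtain ⟨u, rfl⟩ := (hT _).1 hl
    rw [isNegative_iff, map_sub, pos_mkLoop, sub_eq_zero] at hneg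
    exact ⟨u, by rw [hLT, hneg]⟩

/-- The inverse function theorem lets q parametrize the germ. Uniqueness makes the inverse natural
in the algebra, so p becomes a formal function of q. -/
theorem IsSubmanifoldGerm.exists_section {f₀ : Loop ι k} {X : Germ k ι}
    (h : IsSubmanifoldGerm f₀ X) (ht : IsTransverse X) :
    ∃ P : ι × ℕ → MvPowerSeries (ι × ℕ) k,
      ∀ (A : Type u) [CommRing A] [Algebra k A] [IsTestAlgebra k A] (f : Loop ι A),
        f ∈ X A ↔ ∃ s : (ι × ℕ) →₀ A, (∀ i, IsNilpotent (s i)) ∧ pos f = ext A (pos f₀) + s ∧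
          ∀ j, neg (gram η φ) f j = evalSeries (P j) s := by
  classical
  have hg := gram_isUnit_det hη φ
  have hs' := gram_isSymm hsymm φ
  obtain ⟨Φ, rfl, hlin, hX⟩ := h
  have hΦ := bijective_linPart hsymm hη φ hlin hX ht
  have hex := fun (A : Type u) [CommRing A] [Algebra k A] [IsTestAlgebra k A] (s : (ι × ℕ) →₀ A)
    (hs : ∀ i, IsNilpotent (s i)) => existsUnique_pos_evalMap hΦ hs
  let Θ : ∀ (A : Type u) [CommRing A] [Algebra k A] [IsTestAlgebra k A],
      ((ι × ℕ) →₀ A) → ((ι × ℕ) →₀ A) := fun A _ _ _ s =>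
    -- The value 0 away from nilpotent points only makes `Θ` total.
    if hs : ∀ i, IsNilpotent (s i) then (hex A s hs).choose else 0
  have hΘ : ∀ (A : Type u) [CommRing A] [Algebra k A] [IsTestAlgebra k A] (s : (ι × ℕ) →₀ A),
      (∀ i, IsNilpotent (s i)) → (∀ i, IsNilpotent (Θ A s i)) ∧
        pos (evalMap Φ (Θ A s)) = ext A (pos (Φ 0)) + s := by
    intro A _ _ _ s hs
    simp only [Θ, dif_pos hs]
    exact (hex A s hs).choose_spec.1
  have hnat : ∀ j, ∃ P : MvPowerSeries (ι × ℕ) k,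
      ∀ (A : Type u) [CommRing A] [Algebra k A] [IsTestAlgebra k A] (s : (ι × ℕ) →₀ A),
        (∀ i, IsNilpotent (s i)) → neg (gram η φ) (evalMap Φ (Θ A s)) j = evalSeries P s := by
    intro j
    refine exists_series_of_natural
      (fun A _ _ _ s => neg (gram η φ) (evalMap Φ (Θ A s)) j) ?_
    intro A B _ _ _ _ _ _ ψ s s' hs hss'
    obtain ⟨h1, h2⟩ := hΘ A s hs
    have hs2 : ∀ i, IsNilpotent (s' i) := fun i => by rw [hss']; exact (hs i).map ψ
    obtain ⟨h3, h4⟩ := hΘ B s' hs2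
    let t : (ι × ℕ) →₀ B := (Θ A s).mapRange ψ (map_zero ψ)
    have htn : ∀ i, IsNilpotent (t i) := fun i => (h1 i).map ψ
    have htp : pos (evalMap Φ t) = ext B (pos (Φ 0)) + s' := by
      ext i
      rw [pos_evalMap htn, ← map_evalSeries ψ h1 (s' := t) (fun _ => rfl), ← pos_evalMap h1, h2,
        Finsupp.add_apply, Finsupp.add_apply, map_add, hss', ext_apply, ext_apply,
        AlgHom.commutes]
    have : Θ B s' = t := (hex B s' hs2).unique ⟨h3, h4⟩ ⟨htn, htp⟩
    rw [this, neg_evalMap _ htn, neg_evalMap _ h1, map_evalSeries ψ h1 (s' := t) (fun _ => rfl)]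
  choose P hP using hnat
  refine ⟨P, fun A _ _ _ f => ?_⟩
  rw [hX]
  constructor
  · rintro ⟨t, ht, rfl⟩
    have hs : ∀ i, IsNilpotent ((pos (evalMap Φ t) - ext A (pos (Φ 0))) i) := by
      intro i
      rw [Finsupp.sub_apply, pos_evalMap ht]
      exact isNilpotent_evalSeries_sub _ ht
    refine ⟨_, hs, (add_sub_cancel _ _).symm, fun j => ?_⟩
    rw [← hP j A _ hs]
    obtain ⟨h3, h4⟩ := hΘ A _ hs
    rw [(hex A _ hs).unique ⟨h3, h4⟩ ⟨ht, (add_sub_cancel _ _).symm⟩]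
  · rintro ⟨s, hs, h1, h2⟩
    obtain ⟨h3, h4⟩ := hΘ A s hs
    refine ⟨Θ A s, h3, loop_ext hg hs' (h1.trans h4.symm) (funext fun j => ?_)⟩
    rw [h2, hP j A s hs]

/-- For a section p = P(q), the tangent vectors over the coordinate vectors i and j pair under Ω to
∂_iP_j - ∂_jP_i up to sign. Isotropy thus makes P closed, hence a gradient. -/
theorem IsTransverse.exists_eq_graph [CharZero k] (o : ι) {f₀ : Loop ι k} {X : Germ k ι}
    (ht : IsTransverse X) (h : IsSubmanifoldGerm f₀ X) (hlag : IsLagrangian η φ X) :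
    ∃ (b : (ι × ℕ) →₀ k) (G : MvPowerSeries (ι × ℕ) k), X = graph η φ o b G := by
  have hg := gram_isUnit_det hη φ
  have hs' := gram_isSymm hsymm φ
  obtain ⟨P, hP⟩ := h.exists_section hsymm hη φ ht
  have hcurl : ∀ i j, pd i.1 i.2 (P j) = pd j.1 j.2 (P i) := by
    intro i j
    refine series_ext fun A _ _ _ s hs => ?_
    set f : Loop ι A := mkLoop (gram η φ) (ext A (pos f₀) + s) fun j => evalSeries (P j) s with hf
    have hfX : f ∈ X A := (hP A f).2 ⟨s, hs, pos_mkLoop _ _ _, fun j => by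
      rw [hf, neg_mkLoop hg hs']⟩
    have hv : ∀ i, mkLoop (gram η φ) (Finsupp.single i 1)
        (fun j => evalSeries (pd i.1 i.2 (P j)) s) ∈ tangent X f := by
      intro i
      refine (hP (DualNumber A) _).2 ⟨dualPoint s (Finsupp.single i 1),
        isNilpotent_dualPoint hs _, ?_, fun j => ?_⟩
      · rw [pos_addEps, hf, pos_mkLoop, pos_mkLoop, ext_add_dualPoint]
      · ext
        · rw [fst_neg_addEps, fst_evalSeries_dualPoint hs, hf, neg_mkLoop hg hs']
        · rw [snd_neg_addEps, snd_evalSeries_dualPoint hs, neg_mkLoop hg hs',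
            Finsupp.linearCombination_single, one_smul]
    have hj := hv j
    rw [hlag A f hfX] at hj
    have := hj _ (hv i)
    rw [omega_eq hsymm, pos_mkLoop, pos_mkLoop, neg_mkLoop hg hs', neg_mkLoop hg hs',
      Finsupp.linearCombination_single, Finsupp.linearCombination_single, one_smul, one_smul,
      sub_eq_zero] at this
    exact this
  obtain ⟨G, hG⟩ := exists_potential P hcurl
  -- The added term undoes the dilaton shift contained in `base`.
  refine ⟨pos f₀ + Finsupp.single (o, 1) 1, G, ?_⟩
  funext A _ _ _
  ext f
  rw [hP, mem_graph hsymm hη, base, add_sub_cancel_right]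
  refine exists_congr fun s => and_congr_right fun _ => and_congr_right fun _ => ?_
  rw [funext_iff]
  refine forall_congr' fun j => ?_
  rw [grad, hG]

/-- Over `k` the only nilpotent point is 0, so the q-part of the unique `k`-point determines the
centre. The gradients then agree at all nilpotent points. -/
theorem graph_injective {o : ι} {a b : (ι × ℕ) →₀ k} {F G : MvPowerSeries (ι × ℕ) k}
    (h : graph η φ o a F = graph η φ o b G) : a = b ∧ ∀ α l, pd α l F = pd α l G := by
  have key : ∀ (A : Type u) [CommRing A] [Algebra k A] [IsTestAlgebra k A] (s : (ι × ℕ) →₀ A),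
      (∀ i, IsNilpotent (s i)) → ∃ s' : (ι × ℕ) →₀ A, (∀ i, IsNilpotent (s' i)) ∧
        ext A (base o a) + s = ext A (base o b) + s' ∧ grad F s = grad G s' := by
    intro A _ _ _ s hs
    have h1 := mkLoop_mem_graph hsymm hη φ o a F hs
    rw [h] at h1
    obtain ⟨s', hs', h2, h3⟩ := (mem_graph hsymm hη φ o b G).1 h1
    rw [pos_mkLoop] at h2
    rw [neg_mkLoop (gram_isUnit_det hη φ) (gram_isSymm hsymm φ)] at h3
    exact ⟨s', hs', h2, h3⟩
  have hb : base o a = base o b := by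
    obtain ⟨s', hs', h1, -⟩ := key k 0 (fun i => by simp)
    ext i
    have := DFunLike.congr_fun h1 i
    rw [Finsupp.add_apply, Finsupp.add_apply, (hs' i).eq_zero] at this
    simpa [ext_apply] using this
  refine ⟨sub_left_injective hb, fun α l => series_ext fun A _ _ _ s hs => ?_⟩
  obtain ⟨s', hs', h1, h2⟩ := key A s hs
  rw [hb, add_right_inj] at h1
  subst h1
  exact congrFun h2 (α, l)

omit hsymm hη in
theorem graph_add_C (o : ι) (a : (ι × ℕ) →₀ k) (F : MvPowerSeries (ι × ℕ) k) (c : k) :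
    graph η φ o a (F + MvPowerSeries.C c) = graph η φ o a F := by
  unfold graph
  simp only [pd_add_C]
  rfl

theorem IsStarCone.existsUnique_isGenerating [CharZero k] {o : ι} {b : (ι × ℕ) →₀ k}
    {G : MvPowerSeries (ι × ℕ) k} {f₀ : Loop ι k} (h : IsStarCone η φ f₀ (graph η φ o b G)) :
    ∃! c : k, IsGenerating η φ o b (G + MvPowerSeries.C c) :=
  existsUnique_of_exists_of_unique
    ((h.isInfGenerating hsymm hη).exists_isGenerating (gram_isSymm hsymm φ))
    fun _ _ h1 h2 => h1.const_unique h2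

theorem IsStarCone.existsUnique_graph [CharZero k] (o : ι) {f₀ : Loop ι k} {X : Germ k ι}
    (h : IsStarCone η φ f₀ X) (ht : IsTransverse X) :
    ∃! p : ((ι × ℕ) →₀ k) × MvPowerSeries (ι × ℕ) k,
      X = graph η φ o p.1 p.2 ∧ IsGenerating η φ o p.1 p.2 := by
  refine existsUnique_of_exists_of_unique ?_ ?_
  · obtain ⟨b, G, rfl⟩ := ht.exists_eq_graph hsymm hη φ o h.submanifold h.lagrangian
    obtain ⟨c, hc, -⟩ := h.existsUnique_isGenerating hsymm hη φ
    exact ⟨(b, G + MvPowerSeries.C c), (graph_add_C φ o b G c).symm, hc⟩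
  · rintro ⟨a, F⟩ ⟨b, G⟩ ⟨h1, h2⟩ ⟨h3, h4⟩
    simp only at h1 h2 h3 h4
    obtain ⟨rfl, hpd⟩ := graph_injective hsymm hη φ (h1.symm.trans h3)
    -- Equal gradients leave only a constant difference, which the term -2F of DE rules out.
    have hc := series_const (F := F - G) fun α l => by rw [pd_sub, hpd, sub_self]
    rw [sub_eq_iff_eq_add'] at hc
    rw [hc] at h2
    rw [← add_zero G, ← map_zero MvPowerSeries.C] at h4
    rw [h2.const_unique h4, map_zero, add_zero] at hc
    rw [hc]

end GraphOfTransverse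

end Givental

end

theorem mainTheorem4 {k : Type u} {H : Type v} {ι : Type w} [Field k] [CharZero k]
    [AddCommGroup H] [Module k H] [FiniteDimensional k H] [Fintype ι] [DecidableEq ι]
    (η : LinearMap.BilinForm k H) (hsymm : η.IsSymm) (hη : η.Nondegenerate)
    (φ : Module.Basis ι k H) (o : ι)
    (M : twistedLoopGroup η hη) :
    (∀ (f₀ : Loop ι k) (X : Germ k ι),
      IsStarCone η φ f₀ X ↔ IsStarCone η φ (act φ M.1 f₀) (actGerm φ M.1 X)) ∧
    ∀ (a : (ι × ℕ) →₀ k) (F : MvPowerSeries (ι × ℕ) k), IsGenerating η φ o a F →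
      (IsTransverse (actGerm φ M.1 (graph η φ o a F)) →
        ∃! p : ((ι × ℕ) →₀ k) × MvPowerSeries (ι × ℕ) k,
          actGerm φ M.1 (graph η φ o a F) = graph η φ o p.1 p.2 ∧ IsGenerating η φ o p.1 p.2) ∧
      ∀ (b : (ι × ℕ) →₀ k) (G : MvPowerSeries (ι × ℕ) k),
        actGerm φ M.1 (graph η φ o a F) = graph η φ o b G →
          ∃! c : k, IsGenerating η φ o b (G + MvPowerSeries.C c) := by
  refine ⟨fun f₀ X => isStarCone_actGerm_iff φ hsymm M, fun a F hF => ?_⟩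
  -- Both (a) and (b) use the image germ only through its being a Lagrangian cone with (⋆).
  have hM := (hF.isStarCone hsymm hη).actGerm φ hsymm M.2
  refine ⟨fun ht => hM.existsUnique_graph hsymm hη φ o ht, fun b G hG => ?_⟩
  rw [hG] at hM
  exact hM.existsUnique_isGenerating hsymm hη φ
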